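/- **Notation.** Let $f\colon\mathbb{C}\to\mathbb{P}^n(\mathbb{C})$ be an entire (holomorphic) curve with a reduced representation $f=[f_0:\dots:f_n]$, i.e. the $f_i$ are entire functions without common zeros, and put $\|f(z)\|=\max_i|f_i(z)|$. Let $D=\{Q=0\}\subset\mathbb{P}^n(\mathbb{C})$ be a smooth hypersurface, where $Q$ is homogeneous of degree $d\ge 1$ and the gradient of $Q$ vanishes at no point of $\{Q=0\}\setminus\{0\}$. The Cartan order function of $f$ is $$T_f(r)=\frac1{2\pi}\int_0^{2\pi}\log\|f(re^{i\theta})\|\,d\theta,$$ and, if $f(\mathbb{C})\not\subset D$, the counting function of $f$ for $D$ truncated at level $1$ is $$N_f^{[1]}(r,D)=\int_1^r\Big(\sum_{|a|<t}\min\{1,\operatorname{ord}_a(Q\circ f)\}\Big)\frac{dt}{t}\qquad(r>1).$$ We write $S_f(r)$ for any real function of $r>0$ for which there is a constant $C$ such that, for every $\delta>0$, the inequality $S_f(r)\le C\log T_f(r)+\delta\log r$ holds for all $r>0$ outside a set of finite Lebesgue measure (which may depend on $\delta$). For integers $k,m\ge 0$ let $E^{GG}_{k,m}T^*_{\mathbb{P}^n(\mathbb{C})}(\log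 D)$ be the logarithmic Green–Griffiths bundle of jet differentials of order $k$ and weighted degree $m$ along $D$. A global section $\mathscr{P}$ of $E^{GG}_{k,m}T^*_{\mathbb{P}^n(\mathbb{C})}(\log D)\otimes\mathcal{O}_{\mathbb{P}^n(\mathbb{C})}(1)^{-\widetilde m}$ is an object that, around every point of $\mathbb{P}^n(\mathbb{C})$, in local coordinates $x_1,\dots,x_n$ in which $D$ is either empty or $\{x_1=0\}$, is a polynomial, with local holomorphic sections of $\mathcal{O}_{\mathbb{P}^n(\mathbb{C})}(1)^{-\widetilde m}$ as coefficients, in the jet-coordinates $x_i^{(j)}$ ($1\le j\le k$), where $x_1^{(j)}$ is replaced by $(\log x_1)^{(j)}$ if $D=\{x_1=0\}$, and is weighted homogeneous of degree $m$ when the jet-coordinates of order $j$ have weight $j$. It takes a value $\mathscr{P}(j_k(f))(z)$ in the fibre of $\mathcal{O}_{\mathbb{P}^n(\mathbb{C})}(1)^{-\widetilde m}$ at $f(z)$ for every $z$ with $f(z)\notin D$; the condition $\mathscr{P}(j_k(f))\not\equiv0$ means that this value is nonzero for some such $z$ (in particular $f(\mathbb{C})\not\subset D$). **Theorem.** Let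 $f\colon\mathbb{C}\to\mathbb{P}^n(\mathbb{C})$ be an entire curve, let $D\subset\mathbb{P}^n(\mathbb{C})$ be a smooth hypersurface and let $\widetilde m$ be a positive integer. If there exists a global logarithmic jet differential $$\mathscr{P}\in H^0\big(\mathbb{P}^n(\mathbb{C}),\,E^{GG}_{k,m}T^*_{\mathbb{P}^n(\mathbb{C})}(\log D)\otimes\mathcal{O}_{\mathbb{P}^n(\mathbb{C})}(1)^{-\widetilde m}\big)$$ such that $\mathscr{P}(j_k(f))\not\equiv 0$, then $$T_f(r)\le\frac{m}{\widetilde m}\,N_f^{[1]}(r,D)+S_f(r)\qquad(r>1).$$ -/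

import Mathlib

open scoped LinearAlgebra.Projectivization

noncomputable section

/-- Complex projective space `ℙⁿ(ℂ)`. -/
abbrev Pn (n : ℕ) : Type := ℙ ℂ (Fin (n + 1) → ℂ)

/-- The punctured cone in `ℂⁿ⁺¹ ∖ {0}` over a subset of `ℙⁿ(ℂ)`. -/
def cone {n : ℕ} (U : Set (Pn n)) : Set (Fin (n + 1) → ℂ) :=
  {v | ∃ h : v ≠ 0, Projectivization.mk ℂ v h ∈ U}

open Classical in
/-- The function `v ↦ φ [v]` on `ℂⁿ⁺¹ ∖ {0}` attached to a function on `ℙⁿ(ℂ)`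
(with the irrelevant value `0` at the origin). -/
def onCone {n : ℕ} {E : Type*} [Zero E] (φ : Pn n → E) (v : Fin (n + 1) → ℂ) : E :=
  if h : v ≠ 0 then φ (Projectivization.mk ℂ v h) else 0

/-- A map `g` from `ℂ` to `ℙⁿ(ℂ)` is holomorphic near `z₀`. -/
def HolomorphicCurveAt {n : ℕ} (g : ℂ → Pn n) (z₀ : ℂ) : Prop :=
  ∃ G : ℂ → Fin (n + 1) → ℂ, AnalyticAt ℂ G z₀ ∧
    ∀ᶠ z in nhds z₀, ∃ h : G z ≠ 0, Projectivization.mk ℂ (G z) h = g z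

/-- Entire holomorphic curves `ℂ → ℙⁿ(ℂ)`. -/
def IsEntireCurve {n : ℕ} (f : ℂ → Pn n) : Prop :=
  ∀ z, HolomorphicCurveAt f z

/-- `f = [F₀ : ⋯ : Fₙ]` with entire functions `Fᵢ` without common zeros. -/
def IsReducedRepresentation {n : ℕ} (F : ℂ → Fin (n + 1) → ℂ) (f : ℂ → Pn n) : Prop :=
  Differentiable ℂ F ∧ ∀ z, ∃ h : F z ≠ 0, Projectivization.mk ℂ (F z) h = f z

/-! ### Hypersurfaces -/

/-- The zero set in `ℙⁿ(ℂ)` of a (homogeneous) polynomial. -/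
def hypersurface {n : ℕ} (Q : MvPolynomial (Fin (n + 1)) ℂ) : Set (Pn n) :=
  {x | ∀ (v : Fin (n + 1) → ℂ) (h : v ≠ 0),
    Projectivization.mk ℂ v h = x → MvPolynomial.eval v Q = 0}

/-- `Q` is a homogeneous equation of degree `d ≥ 1` of a smooth hypersurface. -/
structure IsSmoothEquation {n : ℕ} (Q : MvPolynomial (Fin (n + 1)) ℂ) (d : ℕ) : Prop where
  homogeneous : Q.IsHomogeneous d
  one_le_degree : 1 ≤ d
  smooth : ∀ v : Fin (n + 1) → ℂ, v ≠ 0 → MvPolynomial.eval v Q = 0 →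
    ∃ i, MvPolynomial.eval v (MvPolynomial.pderiv i Q) ≠ 0

/-! ### Jets -/

/-- Local holomorphic coordinates on an open subset of `ℙⁿ(ℂ)`. -/
structure ProjChart (n : ℕ) where
  source : Set (Pn n)
  coord : Pn n → Fin n → ℂ
  isOpen_source : IsOpen (cone source)
  holomorphic : DifferentiableOn ℂ (onCone coord) (cone source)
  injOn : Set.InjOn coord source
  submersive : ∀ v ∈ cone source, Function.Surjective (fderiv ℂ (onCone coord) v)

/-- Germs of holomorphic maps `(ℂ, 0) → ℙⁿ(ℂ)`. -/
def CurveGerm (n : ℕ) : Type := {g : ℂ → Pn n // HolomorphicCurveAt g 0}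

/-- Two germs define the same `k`-jet if they have the same base point and the same Taylor
expansion up to order `k` in local coordinates around it. -/
def jetSetoid (n k : ℕ) : Setoid (CurveGerm n) where
  r g h := g.1 0 = h.1 0 ∧ ∀ c : ProjChart n, g.1 0 ∈ c.source → ∀ j ≤ k, ∀ i : Fin n,
    iteratedDeriv j (fun t => c.coord (g.1 t) i) 0 =
      iteratedDeriv j (fun t => c.coord (h.1 t) i) 0
  iseqv :=
    { refl := fun _ => ⟨rfl, fun _ _ _ _ _ => rfl⟩
      symm := fun H => ⟨H.1.symm, fun c hc j hj i => (H.2 c (H.1 ▸ hc) j hj i).symm⟩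
      trans := fun H K => ⟨H.1.trans K.1, fun c hc j hj i =>
        (H.2 c hc j hj i).trans (K.2 c (H.1 ▸ hc) j hj i)⟩ }

/-- The space `J_k(ℙⁿ(ℂ))` of `k`-jets of holomorphic germs. -/
def JetSpace (n k : ℕ) : Type := Quotient (jetSetoid n k)

/-- The `k`-jet of a germ. -/
def CurveGerm.jet {n : ℕ} (k : ℕ) (g : CurveGerm n) : JetSpace n k :=
  Quotient.mk (jetSetoid n k) g

theorem HolomorphicCurveAt.translate {n : ℕ} {f : ℂ → Pn n} {z : ℂ}
    (hf : HolomorphicCurveAt f z) : HolomorphicCurveAt (fun t => f (z + t)) 0 := by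
  obtain ⟨G, hG, hev⟩ := hf
  have hz : z + (0 : ℂ) = z := add_zero z
  refine ⟨fun t => G (z + t), ?_, ?_⟩
  · have hG' : AnalyticAt ℂ G (z + (0 : ℂ)) := by rwa [hz]
    exact hG'.fun_comp (analyticAt_const.add analyticAt_id)
  · have ht : Filter.Tendsto (fun t : ℂ => z + t) (nhds 0) (nhds z) := by
      have hc : Continuous fun t : ℂ => z + t := by fun_prop
      have h0 := hc.tendsto 0
      rwa [hz] at h0
    exact ht.eventually hev

/-- The `k`-jet `j_k(f)` of an entire curve at `z ∈ ℂ`, that is, of the germ `t ↦ f (z + t)`. -/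
def curveJet {n : ℕ} (k : ℕ) (f : ℂ → Pn n) (hf : IsEntireCurve f) (z : ℂ) : JetSpace n k :=
  CurveGerm.jet k ⟨fun t => f (z + t), (hf z).translate⟩

/-! ### Logarithmic jet differentials -/

/-- Local coordinates adapted to the hypersurface `D = {Q = 0}`: either `D` does not meet the
chart (`logIndex = none`), or `D` is given in the chart by the vanishing of one distinguished
coordinate (`logIndex = some i`). -/
structure LogChart {n : ℕ} (Q : MvPolynomial (Fin (n + 1)) ℂ) extends ProjChart n where
  logIndex : Option (Fin n)
  mem_hypersurface_iff : ∀ x ∈ source, x ∈ hypersurface Q ↔ ∃ i ∈ logIndex, coord x i = 0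

/-- The logarithmic jet-coordinates of a germ `g` with `g(0) ∉ D`. With `xᵢ = (i-th coordinate) ∘ g`,
the coordinate of index `(j, i)` is `(log xᵢ)^(j+1) = (xᵢ' / xᵢ)^(j)` at `0` if `i` is the
distinguished index, and `xᵢ^(j+1)` at `0` otherwise. -/
def LogChart.jetCoord {n : ℕ} {Q : MvPolynomial (Fin (n + 1)) ℂ} (c : LogChart Q) (k : ℕ)
    (g : CurveGerm n) (p : Fin k × Fin n) : ℂ :=
  if p.2 ∈ c.logIndex then
    iteratedDeriv (p.1 : ℕ) (logDeriv fun t => c.coord (g.1 t) p.2) 0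
  else
    iteratedDeriv ((p.1 : ℕ) + 1) (fun t => c.coord (g.1 t) p.2) 0

/-- Global sections of `E^{GG}_{k,m} T^*(log D) ⊗ 𝒪(1)^{-μ}` on `ℙⁿ(ℂ)`, where `D = {Q = 0}`.

Sections of `𝒪(1)^{-μ}` are functions on the cone that are homogeneous of degree `-μ`.
A section is recorded through its values `toFun ξ v` at the `k`-jets `ξ` based at points of
`ℙⁿ(ℂ) ∖ D` and at the vectors `v ≠ 0` on the line that is the base point of `ξ`
(other values play no role). Around every point of `ℙⁿ(ℂ)`, points of `D` included, it has to
be a polynomial in the logarithmic jet-coordinates, weighted homogeneous of degree `m`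
(the coordinates of order `j` having weight `j`), whose coefficients are holomorphic sections of
`𝒪(1)^{-μ}`. -/
structure LogJetDifferential {n : ℕ} (Q : MvPolynomial (Fin (n + 1)) ℂ) (k m μ : ℕ) where
  toFun : JetSpace n k → (Fin (n + 1) → ℂ) → ℂ
  local_form : ∀ x : Pn n, ∃ c : LogChart Q, x ∈ c.source ∧
    ∃ A : (Fin (n + 1) → ℂ) → MvPolynomial (Fin k × Fin n) ℂ,
      (∀ v ∈ cone c.source,
        (A v).IsWeightedHomogeneous (fun p : Fin k × Fin n => (p.1 : ℕ) + 1) m) ∧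
      (∀ α : (Fin k × Fin n) →₀ ℕ,
        DifferentiableOn ℂ (fun v => (A v).coeff α) (cone c.source)) ∧
      (∀ v ∈ cone c.source, ∀ a : ℂ, a ≠ 0 → A (a • v) = (a ^ μ)⁻¹ • A v) ∧
      ∀ g : CurveGerm n, g.1 0 ∈ c.source → g.1 0 ∉ hypersurface Q →
        ∀ (v : Fin (n + 1) → ℂ) (h : v ≠ 0), Projectivization.mk ℂ v h = g.1 0 →
          toFun (g.jet k) v = MvPolynomial.eval (c.jetCoord k g) (A v)

/-! ### Nevanlinna theory -/

/-- The Cartan order function `T_f(r)`, computed from a reduced representation `F` of `f`; the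
norm on `Fin (n + 1) → ℂ` is the maximum norm. -/
def orderFunction {n : ℕ} (F : ℂ → Fin (n + 1) → ℂ) (r : ℝ) : ℝ :=
  (2 * Real.pi)⁻¹ * ∫ θ in (0 : ℝ)..(2 * Real.pi), Real.log ‖F (circleMap 0 r θ)‖

/-- `n^{[K]}(t, E)` for the zero divisor `E` of an entire function `u ≢ 0`. -/
def truncatedDegree (K : ℕ∞) (u : ℂ → ℂ) (t : ℝ) : ℕ :=
  ∑ᶠ a ∈ Metric.ball (0 : ℂ) t, (min K (analyticOrderAt u a)).toNat

/-- `N_f^{[K]}(r, D)` for `D = {Q = 0}`, computed from a reduced representation `F` of `f`. -/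
def countingFunction {n : ℕ} (K : ℕ∞) (F : ℂ → Fin (n + 1) → ℂ)
    (Q : MvPolynomial (Fin (n + 1)) ℂ) (r : ℝ) : ℝ :=
  ∫ t in (1 : ℝ)..r, (truncatedDegree K (fun z => MvPolynomial.eval (F z) Q) t : ℝ) / t

/-- `S` is an error term `S_f(r)` relative to the order function `T = T_f`: there is a constant `C`
such that for every `δ > 0` one has `S(r) ≤ C log T(r) + δ log r` for all `r > 0` outside a set of
finite Lebesgue measure, which may depend on `δ`. -/
def IsSmallErrorTerm (T S : ℝ → ℝ) : Prop :=
  ∃ C : ℝ, ∀ δ : ℝ, 0 < δ → ∃ E : Set ℝ, MeasureTheory.volume E < ⊤ ∧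
    ∀ r : ℝ, 0 < r → r ∉ E → S r ≤ C * Real.log (T r) + δ * Real.log r

end

open Metric Filter Topology MeasureTheory

/-!
Evaluated on the jet of a reduced representation `F`, the jet differential gives a meromorphic
function `u` on `ℂ` with poles only over `D`. In logarithmic coordinates a jet-coordinate of order
`j` has a pole of order at most `j` there, whatever the multiplicity of the intersection with `D`,
so weighted homogeneity bounds the pole orders of `u` by `m`. Jensen's formula then bounds the
average of `log ‖u‖` over the circle `|z| = r` from below by `-m N^[1](r, D)`, up to a constant.

In the other direction, `u` is homogeneous of degree `-μ` in `F`, so compactness of `ℙⁿ` bounds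
`‖u‖ ‖F‖ ^ μ` by a power of the derivatives of the logarithmic derivatives of the quotients
`F_s / F_l` and `Q(F) / F_l ^ d`. The lemma on the logarithmic derivative, a consequence of the
Poisson–Jensen formula and Borel's growth lemma, makes the circle averages of their logarithms
small, hence that of `log ‖u‖` at most `-μ T_f(r)` plus a small error term. Comparing the two
bounds gives the theorem.
-/

/-! ### Holomorphic functions of several variables -/

section SeveralVariables

variable {E : Type*} [NormedAddCommGroup E] [NormedSpace ℂ E] {H Φ q : E → ℂ} {W : Set E}
  {v v₀ e : E} {ε : ℝ}

theorem hasDerivAt_comp_line {ζ : ℂ} (h : DifferentiableAt ℂ H (v + ζ • e)) :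
    HasDerivAt (fun ζ : ℂ => H (v + ζ • e)) (fderiv ℂ H (v + ζ • e) e) ζ := by
  have hline : HasDerivAt (fun ζ : ℂ => v + ζ • e) e ζ := by
    simpa using ((hasDerivAt_id ζ).smul_const e).const_add v
  exact h.hasFDerivAt.comp_hasDerivAt ζ hline

theorem eventually_forall_add_smul_mem (hW : IsOpen W) {K : Set ℂ} (hK : IsCompact K)
    (h : ∀ ζ ∈ K, v₀ + ζ • e ∈ W) : ∀ᶠ v in 𝓝 v₀, ∀ ζ ∈ K, v + ζ • e ∈ W := by
  refine hK.eventually_forall_of_forall_eventually fun ζ hζ => ?_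
  have hc : Continuous fun p : E × ℂ => p.1 + p.2 • e := by fun_prop
  exact hc.continuousAt.eventually_mem (hW.mem_nhds (h ζ hζ))

theorem exists_eventually_norm_fderiv_le (hW : IsOpen W) (hH : DifferentiableOn ℂ H W)
    (hv₀ : v₀ ∈ W) : ∃ M, ∀ᶠ v in 𝓝 v₀, ‖fderiv ℂ H v‖ ≤ M := by
  have hclose : ∀ᶠ v in 𝓝 v₀, v ∈ W ∧ dist (H v) (H v₀) < 1 :=
    (hW.eventually_mem hv₀).and
      ((hH.differentiableAt (hW.mem_nhds hv₀)).continuousAt (ball_mem_nhds _ one_pos))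
  obtain ⟨ρ, hρ, hball⟩ := Metric.eventually_nhds_iff_ball.1 hclose
  refine ⟨2 / (ρ / 2), ?_⟩
  filter_upwards [ball_mem_nhds v₀ (half_pos hρ)] with v hv
  have hsub : ball v (ρ / 2) ⊆ ball v₀ ρ := ball_subset_ball' (by rw [mem_ball] at hv; linarith)
  refine Complex.norm_fderiv_le_div_of_mapsTo_ball
    (hH.mono fun y hy => (hball y (hsub hy)).1) (fun y hy => ?_) (half_pos hρ)
  have hy' := (hball y (hsub hy)).2
  have hv' := (hball v (hsub (mem_ball_self (half_pos hρ)))).2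
  rw [mem_closedBall]
  linarith [dist_triangle_right (H y) (H v) (H v₀)]

theorem exists_eventually_forall_norm_fderiv_add_smul_le (hW : IsOpen W)
    (hH : DifferentiableOn ℂ H W) {K : Set ℂ} (hK : IsCompact K) (h : ∀ ζ ∈ K, v₀ + ζ • e ∈ W) :
    ∃ M, ∀ᶠ v in 𝓝 v₀, ∀ ζ ∈ K, ‖fderiv ℂ H (v + ζ • e)‖ ≤ M := by
  have hline : Continuous fun p : E × ℂ => p.1 + p.2 • e := by fun_prop
  refine hK.induction_on (p := fun s => ∃ M, ∀ᶠ v in 𝓝 v₀, ∀ ζ ∈ s, ‖fderiv ℂ H (v + ζ • e)‖ ≤ M)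
    ⟨0, by simp⟩ (fun s t hst ⟨M, hM⟩ => ⟨M, hM.mono fun v hv ζ hζ => hv ζ (hst hζ)⟩) ?_ ?_
  · rintro s t ⟨M, hM⟩ ⟨M', hM'⟩
    refine ⟨max M M', ?_⟩
    filter_upwards [hM, hM'] with v hv hv' ζ hζ
    exact hζ.elim (fun hs => (hv ζ hs).trans (le_max_left _ _))
      fun ht => (hv' ζ ht).trans (le_max_right _ _)
  · intro ζ hζ
    obtain ⟨M, hM⟩ := exists_eventually_norm_fderiv_le hW hH (h ζ hζ)
    have hnear : ∀ᶠ p : E × ℂ in 𝓝 (v₀, ζ), ‖fderiv ℂ H (p.1 + p.2 • e)‖ ≤ M :=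
      (hline.tendsto' (v₀, ζ) (v₀ + ζ • e) rfl).eventually hM
    rw [nhds_prod_eq] at hnear
    obtain ⟨U, hU, V, hV, hUV⟩ := eventually_prod_iff.1 hnear
    exact ⟨{ζ | V ζ}, mem_nhdsWithin_of_mem_nhds hV, M, hU.mono fun v hv ζ' hζ' => hUV hv hζ'⟩

theorem diffContOnCl_comp_line (hW : IsOpen W) (hH : DifferentiableOn ℂ H W) (hε : ε ≠ 0)
    (hv : ∀ ζ ∈ closedBall (0 : ℂ) ε, v + ζ • e ∈ W) :
    DiffContOnCl ℂ (fun ζ : ℂ => H (v + ζ • e)) (ball 0 ε) := by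
  refine DifferentiableOn.diffContOnCl fun ζ hζ => ?_
  rw [closure_ball _ hε] at hζ
  exact (hasDerivAt_comp_line (hH.differentiableAt
    (hW.mem_nhds (hv ζ hζ)))).differentiableAt.differentiableWithinAt

theorem fderiv_apply_eq_circleIntegral (hW : IsOpen W) (hH : DifferentiableOn ℂ H W) (hε : 0 < ε)
    (hv : ∀ ζ ∈ closedBall (0 : ℂ) ε, v + ζ • e ∈ W) :
    fderiv ℂ H v e = (2 * Real.pi * Complex.I : ℂ)⁻¹ *
      ∮ ζ in C(0, ε), ((ζ - 0) ^ 2)⁻¹ * H (v + ζ • e) := by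
  have hv0 : v + (0 : ℂ) • e ∈ W := hv 0 (mem_closedBall_self hε.le)
  have h := (diffContOnCl_comp_line hW hH hε.ne' hv).deriv_eq_smul_circleIntegral hε
  rw [(hasDerivAt_comp_line (hH.differentiableAt (hW.mem_nhds hv0))).deriv, zero_smul,
    add_zero] at h
  rw [eq_inv_mul_iff_mul_eq₀ (by simp [Real.pi_ne_zero])]
  simpa using h.symm

variable [FiniteDimensional ℂ E]

theorem differentiableAt_circleIntegral_line (hW : IsOpen W) (hH : DifferentiableOn ℂ H W)
    (hε : 0 ≤ ε) {κ : ℂ → ℂ} (hκ : ContinuousOn κ (sphere 0 ε))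
    (hv₀ : ∀ ζ ∈ sphere (0 : ℂ) ε, v₀ + ζ • e ∈ W) :
    DifferentiableAt ℂ (fun v => ∮ ζ in C(0, ε), κ ζ * H (v + ζ • e)) v₀ := by
  have : ProperSpace E := FiniteDimensional.proper ℂ E
  borelize E
  have hsph : ∀ θ, circleMap 0 ε θ ∈ sphere (0 : ℂ) ε := circleMap_mem_sphere _ hε
  have hmem := eventually_forall_add_smul_mem hW (isCompact_sphere 0 ε) hv₀
  obtain ⟨M, hM⟩ := exists_eventually_forall_norm_fderiv_add_smul_le hW hH
    (isCompact_sphere 0 ε) hv₀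
  set κ' : ℝ → ℂ := fun θ => deriv (circleMap 0 ε) θ * κ (circleMap 0 ε θ) with hκ'
  have hκ'c : Continuous κ' := by
    simp only [hκ', deriv_circleMap]
    exact (by fun_prop : Continuous fun θ => circleMap 0 ε θ * Complex.I).mul
      (hκ.comp_continuous (continuous_circleMap 0 ε) hsph)
  have hcont : ∀ v, (∀ ζ ∈ sphere (0 : ℂ) ε, v + ζ • e ∈ W) →
      Continuous fun θ => κ' θ * H (v + circleMap 0 ε θ • e) := fun v hv =>
    hκ'c.mul (hH.continuousOn.comp_continuous (by fun_prop) fun θ => hv _ (hsph θ))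
  have hmeas : Measurable fun θ => κ' θ • fderiv ℂ H (v₀ + circleMap 0 ε θ • e) :=
    hκ'c.measurable.smul ((measurable_fderiv ℂ H).comp (Continuous.measurable (by fun_prop)))
  have hderiv : ∀ v, (∀ ζ ∈ sphere (0 : ℂ) ε, v + ζ • e ∈ W) → ∀ θ,
      HasFDerivAt (fun v => κ' θ * H (v + circleMap 0 ε θ • e))
        (κ' θ • fderiv ℂ H (v + circleMap 0 ε θ • e)) v := fun v hv θ => by
    refine HasFDerivAt.const_mul ?_ _
    exact (hasFDerivAt_comp_add_right _).2
      (hH.differentiableAt (hW.mem_nhds (hv _ (hsph θ)))).hasFDerivAt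
  simp only [circleIntegral, smul_eq_mul, ← mul_assoc]
  refine (intervalIntegral.hasFDerivAt_integral_of_dominated_of_fderiv_le
    (F' := fun v θ => κ' θ • fderiv ℂ H (v + circleMap 0 ε θ • e)) (bound := fun θ => ‖κ' θ‖ * M)
    (hmem.and hM) (hmem.mono fun v hv => (hcont v hv).aestronglyMeasurable)
    ((hcont v₀ hv₀).intervalIntegrable _ _) hmeas.aemeasurable.aestronglyMeasurable
    (ae_of_all _ fun θ _ v hv => ?_) (Continuous.intervalIntegrable (by fun_prop) _ _)
    (ae_of_all _ fun θ _ v hv => hderiv v hv.1 θ)).differentiableAt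
  rw [norm_smul]
  exact mul_le_mul_of_nonneg_left (hv.2 _ (hsph θ)) (norm_nonneg _)

theorem differentiableOn_fderiv_apply (hW : IsOpen W) (hH : DifferentiableOn ℂ H W) (e : E) :
    DifferentiableOn ℂ (fun v => fderiv ℂ H v e) W := by
  intro v₀ hv₀
  have hline : Continuous fun ζ : ℂ => v₀ + ζ • e := by fun_prop
  obtain ⟨ε, hε, hball⟩ := Metric.nhds_basis_closedBall.mem_iff.1
    (hline.continuousAt.preimage_mem_nhds (x := 0) (hW.mem_nhds (by simpa using hv₀)))
  have hκ : ContinuousOn (fun ζ : ℂ => ((ζ - 0) ^ 2)⁻¹) (sphere 0 ε) :=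
    ContinuousOn.inv₀ (by fun_prop) fun ζ hζ => by
      simpa using ne_of_mem_sphere hζ hε.ne'
  refine (((differentiableAt_circleIntegral_line hW hH hε.le hκ fun ζ hζ =>
    hball (sphere_subset_closedBall hζ)).const_mul
      (2 * Real.pi * Complex.I : ℂ)⁻¹).congr_of_eventuallyEq ?_).differentiableWithinAt
  filter_upwards [eventually_forall_add_smul_mem hW (isCompact_closedBall 0 ε) hball] with v hv
  exact fderiv_apply_eq_circleIntegral hW hH hε hv

theorem contDiffOn_nat_of_differentiableOn_complex (hW : IsOpen W) (hH : DifferentiableOn ℂ H W)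
    (N : ℕ) : ContDiffOn ℂ N H W := by
  induction N generalizing H with
  | zero => exact contDiffOn_zero.2 hH.continuousOn
  | succ N ih =>
    push_cast
    rw [contDiffOn_succ_iff_fderiv_of_isOpen hW]
    exact ⟨hH, by simp, contDiffOn_clm_apply.2 fun e => ih (differentiableOn_fderiv_apply hW hH e)⟩

end SeveralVariables

section LocalFactorization

theorem exists_differentiableOn_eq_div {a b : ℂ → ℂ} {U : Set ℂ} (hU : IsOpen U)
    (ha : DifferentiableOn ℂ a U) (hb : DifferentiableOn ℂ b U)
    (hab : ∀ ζ ∈ U, b ζ = 0 → a ζ = 0) (hb' : ∀ ζ ∈ U, b ζ = 0 → deriv b ζ ≠ 0) :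
    ∃ κ : ℂ → ℂ, DifferentiableOn ℂ κ U ∧ ∀ ζ, b ζ ≠ 0 → κ ζ = a ζ / b ζ := by
  classical
  refine ⟨fun ζ => if b ζ = 0 then deriv a ζ / deriv b ζ else a ζ / b ζ, ?_, fun ζ hζ => if_neg hζ⟩
  intro ζ₀ hζ₀
  refine DifferentiableAt.differentiableWithinAt ?_
  have hn : U ∈ 𝓝 ζ₀ := hU.mem_nhds hζ₀
  by_cases h0 : b ζ₀ = 0
  · -- Near a zero `ζ₀` of `b` the quotient is `dslope a ζ₀ / dslope b ζ₀`.
    have hda := ((Complex.differentiableOn_dslope hn).2 ha).differentiableAt hn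
    have hdb := ((Complex.differentiableOn_dslope hn).2 hb).differentiableAt hn
    have hne : dslope b ζ₀ ζ₀ ≠ 0 := by rw [dslope_same]; exact hb' ζ₀ hζ₀ h0
    refine (hda.div hdb hne).congr_of_eventuallyEq ?_
    filter_upwards [hdb.continuousAt.eventually_ne hne] with ζ hζ
    rcases eq_or_ne ζ ζ₀ with rfl | hz
    · simp [h0]
    · have hz' : ζ - ζ₀ ≠ 0 := sub_ne_zero.2 hz
      rw [dslope_of_ne _ hz, slope_def_field, h0, sub_zero] at hζ
      have hbz : b ζ ≠ 0 := fun h => hζ (by simp [h])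
      rw [if_neg hbz, Pi.div_apply, dslope_of_ne _ hz, dslope_of_ne _ hz, slope_def_field,
        slope_def_field, h0, hab ζ₀ hζ₀ h0, sub_zero, sub_zero, div_div_div_cancel_right₀ hz']
  · refine ((ha.differentiableAt hn).div (hb.differentiableAt hn) h0).congr_of_eventuallyEq ?_
    filter_upwards [(hb.differentiableAt hn).continuousAt.eventually_ne h0] with ζ hζ
    exact if_neg hζ

variable {E : Type*} [NormedAddCommGroup E] [NormedSpace ℂ E] {Φ q ψ : E → ℂ} {W : Set E}
  {v v₀ e : E} {ε : ℝ}

theorem differentiableOn_div_inter_ne_zero (hΦ : DifferentiableOn ℂ Φ W)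
    (hq : DifferentiableOn ℂ q W) : DifferentiableOn ℂ (fun v => Φ v / q v) (W ∩ q ⁻¹' {0}ᶜ) := by
  simp only [div_eq_mul_inv]
  exact (hΦ.mono Set.inter_subset_left).mul ((hq.mono Set.inter_subset_left).inv fun v hv => hv.2)

/-- The open subset of `W` on which `q` is a submersion in the direction `e`. -/
def transverseSet (q : E → ℂ) (e : E) (W : Set E) : Set E :=
  W ∩ (fun v => fderiv ℂ q v e) ⁻¹' {0}ᶜ

theorem div_eq_circleIntegral_of_transverse (hW : IsOpen W) (hW' : IsOpen (transverseSet q e W))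
    (hΦ : DifferentiableOn ℂ Φ W) (hq : DifferentiableOn ℂ q W) (hε : 0 < ε)
    (hz : ∀ v ∈ W, q v = 0 → Φ v = 0)
    (hball : ∀ ζ ∈ closedBall (0 : ℂ) ε, v + ζ • e ∈ transverseSet q e W)
    (hsphere : ∀ ζ ∈ sphere (0 : ℂ) ε, q (v + ζ • e) ≠ 0) (hv : q v ≠ 0) :
    Φ v / q v = (2 * Real.pi * Complex.I : ℂ)⁻¹ *
      ∮ ζ in C(0, ε), ζ⁻¹ * (Φ (v + ζ • e) / q (v + ζ • e)) := by
  set U : Set ℂ := (fun ζ : ℂ => v + ζ • e) ⁻¹' transverseSet q e W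
  have hU : IsOpen U := hW'.preimage (by fun_prop)
  have hline : ∀ {H : E → ℂ}, DifferentiableOn ℂ H W → ∀ ζ ∈ U,
      HasDerivAt (fun ζ : ℂ => H (v + ζ • e)) (fderiv ℂ H (v + ζ • e) e) ζ := fun hH ζ hζ =>
    hasDerivAt_comp_line (hH.differentiableAt (hW.mem_nhds hζ.1))
  obtain ⟨κ, hκ, hκeq⟩ := exists_differentiableOn_eq_div hU
    (fun ζ hζ => (hline hΦ ζ hζ).differentiableAt.differentiableWithinAt)
    (fun ζ hζ => (hline hq ζ hζ).differentiableAt.differentiableWithinAt)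
    (fun ζ hζ h => hz _ hζ.1 h) (fun ζ hζ _ => by rw [(hline hq ζ hζ).deriv]; exact hζ.2)
  have hcauchy : (∮ ζ in C(0, ε), (ζ - 0)⁻¹ • κ ζ) = (2 * Real.pi * Complex.I : ℂ) • κ 0 :=
    (hκ.mono hball).circleIntegral_sub_inv_smul (mem_ball_self hε)
  have hcongr : (∮ ζ in C(0, ε), ζ⁻¹ * (Φ (v + ζ • e) / q (v + ζ • e))) =
      ∮ ζ in C(0, ε), (ζ - 0)⁻¹ • κ ζ :=
    circleIntegral.integral_congr hε.le fun ζ hζ => by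
      simp only [sub_zero, smul_eq_mul, hκeq ζ (hsphere ζ hζ)]
  rw [hcongr, hcauchy, smul_eq_mul, inv_mul_cancel_left₀ (by simp [Real.pi_ne_zero]),
    hκeq 0 (by simpa using hv), zero_smul, add_zero]

theorem exists_closedBall_transverse (hW : IsOpen W) (hW' : IsOpen (transverseSet q e W))
    (hq : DifferentiableOn ℂ q W) (hv₀ : v₀ ∈ transverseSet q e W) :
    ∃ ε > 0, (∀ ζ ∈ closedBall (0 : ℂ) ε, v₀ + ζ • e ∈ transverseSet q e W) ∧
      ∀ ζ ∈ sphere (0 : ℂ) ε, q (v₀ + ζ • e) ≠ 0 := by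
  have hline : Continuous fun ζ : ℂ => v₀ + ζ • e := by fun_prop
  have hmem : ∀ᶠ ζ : ℂ in 𝓝 0, v₀ + ζ • e ∈ transverseSet q e W :=
    hline.continuousAt.eventually_mem (hW'.mem_nhds (by simpa using hv₀))
  have hne : ∀ᶠ ζ : ℂ in 𝓝[≠] 0, q (v₀ + ζ • e) ≠ 0 := by
    have hd : HasDerivAt (fun ζ : ℂ => q (v₀ + ζ • e)) (fderiv ℂ q v₀ e) 0 := by
      simpa using hasDerivAt_comp_line (v := v₀) (e := e) (ζ := 0)
        (by simpa using hq.differentiableAt (hW.mem_nhds hv₀.1))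
    exact hd.eventually_ne (c := 0) hv₀.2
  obtain ⟨ε, hε, hball⟩ := Metric.nhds_basis_closedBall.eventually_iff.1
    (hmem.and (eventually_nhdsWithin_iff.1 hne))
  exact ⟨ε, hε, fun ζ hζ => (hball hζ).1, fun ζ hζ =>
    (hball (sphere_subset_closedBall hζ)).2 (ne_of_mem_sphere hζ hε.ne')⟩

theorem exists_eq_exp_of_ne_zero (hW : IsOpen W) (hψ : DifferentiableOn ℂ ψ W) (hv₀ : v₀ ∈ W)
    (h0 : ψ v₀ ≠ 0) :
    ∃ (V : Set E) (ℓ : E → ℂ), IsOpen V ∧ v₀ ∈ V ∧ V ⊆ W ∧ DifferentiableOn ℂ ℓ V ∧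
      ∀ v ∈ V, ψ v = Complex.exp (ℓ v) := by
  have hdiv : DifferentiableOn ℂ (fun v => ψ v / ψ v₀) W := by
    simp only [div_eq_mul_inv]
    exact hψ.mul_const _
  refine ⟨W ∩ (fun v => ψ v / ψ v₀) ⁻¹' Complex.slitPlane,
    fun v => Complex.log (ψ v / ψ v₀) + Complex.log (ψ v₀),
    hdiv.continuousOn.isOpen_inter_preimage hW Complex.isOpen_slitPlane, ⟨hv₀, by simp [h0]⟩,
    Set.inter_subset_left, fun v hv => ?_, fun v hv => ?_⟩
  · exact (((hdiv v hv.1).mono Set.inter_subset_left).clog hv.2).add_const _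
  · rw [Complex.exp_add, Complex.exp_log (Complex.slitPlane_ne_zero hv.2), Complex.exp_log h0,
      div_mul_cancel₀ _ h0]

variable [FiniteDimensional ℂ E]

theorem isOpen_transverseSet (hW : IsOpen W) (hq : DifferentiableOn ℂ q W) (e : E) :
    IsOpen (transverseSet q e W) :=
  (differentiableOn_fderiv_apply hW hq e).continuousOn.isOpen_inter_preimage hW
    isOpen_compl_singleton

/- Along complex lines transverse to the zero set of `q`, the quotient `Φ / q` has removable
singularities, so Cauchy's formula on a circle avoiding that set extends it holomorphically. -/
theorem exists_eq_mul_of_fderiv_ne_zero (hW : IsOpen W) (hΦ : DifferentiableOn ℂ Φ W)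
    (hq : DifferentiableOn ℂ q W) (hv₀ : v₀ ∈ W) (hq' : fderiv ℂ q v₀ ≠ 0)
    (hz : ∀ v ∈ W, q v = 0 → Φ v = 0) :
    ∃ (V : Set E) (ψ : E → ℂ), IsOpen V ∧ v₀ ∈ V ∧ V ⊆ W ∧ DifferentiableOn ℂ ψ V ∧
      ∀ v ∈ V, Φ v = q v * ψ v := by
  obtain ⟨e, he⟩ : ∃ e, fderiv ℂ q v₀ e ≠ 0 := by
    by_contra! h
    exact hq' (ContinuousLinearMap.ext h)
  have hW' := isOpen_transverseSet hW hq e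
  have hW₀ : IsOpen (W ∩ q ⁻¹' {0}ᶜ) :=
    hq.continuousOn.isOpen_inter_preimage hW isOpen_compl_singleton
  obtain ⟨ε, hε, hball, hsphere⟩ := exists_closedBall_transverse hW hW' hq ⟨hv₀, he⟩
  obtain ⟨V, hV, hVo, hv₀V⟩ := _root_.eventually_nhds_iff.1
    ((eventually_forall_add_smul_mem hW' (isCompact_closedBall 0 ε) hball).and
      (eventually_forall_add_smul_mem hW₀ (isCompact_sphere 0 ε) fun ζ hζ =>
        ⟨(hball ζ (sphere_subset_closedBall hζ)).1, hsphere ζ hζ⟩))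
  have hVW : V ⊆ W := fun v hv => by
    simpa using ((hV v hv).1 0 (mem_closedBall_self hε.le)).1
  refine ⟨V, fun v => (2 * Real.pi * Complex.I : ℂ)⁻¹ *
    ∮ ζ in C(0, ε), ζ⁻¹ * (Φ (v + ζ • e) / q (v + ζ • e)), hVo, hv₀V, hVW, fun v hv => ?_,
    fun v hv => ?_⟩
  · have hκ : ContinuousOn (fun ζ : ℂ => ζ⁻¹) (sphere 0 ε) :=
      continuousOn_id.inv₀ fun ζ hζ => ne_of_mem_sphere hζ hε.ne'
    exact ((differentiableAt_circleIntegral_line hW₀ (differentiableOn_div_inter_ne_zero hΦ hq)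
      hε.le hκ (hV v hv).2).const_mul _).differentiableWithinAt
  · rcases eq_or_ne (q v) 0 with hqv | hqv
    · rw [hqv, zero_mul, hz v (hVW hv) hqv]
    · beta_reduce
      rw [← div_eq_circleIntegral_of_transverse hW hW' hΦ hq hε hz (hV v hv).1
        (fun ζ hζ => ((hV v hv).2 ζ hζ).2) hqv, mul_div_cancel₀ _ hqv]

theorem exists_eq_mul_ne_zero_of_zeros_eq (hW : IsOpen W) (hΦ : DifferentiableOn ℂ Φ W)
    (hq : DifferentiableOn ℂ q W) (hv₀ : v₀ ∈ W) (hq' : q v₀ = 0 → fderiv ℂ q v₀ ≠ 0)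
    (hΦ' : Φ v₀ = 0 → fderiv ℂ Φ v₀ ≠ 0) (hz : ∀ v ∈ W, q v = 0 ↔ Φ v = 0) :
    ∃ (V : Set E) (ψ : E → ℂ), IsOpen V ∧ v₀ ∈ V ∧ V ⊆ W ∧ DifferentiableOn ℂ ψ V ∧
      ψ v₀ ≠ 0 ∧ ∀ v ∈ V, Φ v = q v * ψ v := by
  by_cases h0 : q v₀ = 0
  · obtain ⟨V, ψ, hV, hvV, hVW, hψ, hmul⟩ := exists_eq_mul_of_fderiv_ne_zero hW hΦ hq hv₀ (hq' h0)
      fun v hv => (hz v hv).1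
    refine ⟨V, ψ, hV, hvV, hVW, hψ, fun hψ0 => hΦ' ((hz v₀ hv₀).1 h0) ?_, hmul⟩
    have hprod := (hq.differentiableAt (hW.mem_nhds hv₀)).hasFDerivAt.mul
      (hψ.differentiableAt (hV.mem_nhds hvV)).hasFDerivAt
    have heq : Φ =ᶠ[𝓝 v₀] q * ψ := eventually_of_mem (hV.mem_nhds hvV) hmul
    rw [heq.fderiv_eq, hprod.fderiv, h0, hψ0]
    exact ContinuousLinearMap.ext fun e => by change (0 : ℂ) * _ + 0 * _ = 0; ring
  · refine ⟨W ∩ q ⁻¹' {0}ᶜ, fun v => Φ v / q v,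
      hq.continuousOn.isOpen_inter_preimage hW isOpen_compl_singleton, ⟨hv₀, h0⟩,
      Set.inter_subset_left, differentiableOn_div_inter_ne_zero hΦ hq,
      div_ne_zero (fun h => h0 ((hz v₀ hv₀).2 h)) h0, fun v hv => ?_⟩
    exact (mul_div_cancel₀ _ hv.2).symm

theorem exists_eq_mul_exp_of_zeros_eq (hW : IsOpen W) (hΦ : DifferentiableOn ℂ Φ W)
    (hq : DifferentiableOn ℂ q W) (hv₀ : v₀ ∈ W) (hq' : q v₀ = 0 → fderiv ℂ q v₀ ≠ 0)
    (hΦ' : Φ v₀ = 0 → fderiv ℂ Φ v₀ ≠ 0) (hz : ∀ v ∈ W, q v = 0 ↔ Φ v = 0) :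
    ∃ (V : Set E) (ℓ : E → ℂ), IsOpen V ∧ v₀ ∈ V ∧ V ⊆ W ∧ DifferentiableOn ℂ ℓ V ∧
      ∀ v ∈ V, Φ v = q v * Complex.exp (ℓ v) := by
  obtain ⟨V, ψ, hV, hvV, hVW, hψ, hψ0, hmul⟩ :=
    exists_eq_mul_ne_zero_of_zeros_eq hW hΦ hq hv₀ hq' hΦ' hz
  obtain ⟨V', ℓ, hV', hvV', hV'V, hℓ, hexp⟩ := exists_eq_exp_of_ne_zero hV hψ hvV hψ0
  exact ⟨V', ℓ, hV', hvV', hV'V.trans hVW, hℓ, fun v hv => by rw [hmul v (hV'V hv), hexp v hv]⟩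

end LocalFactorization

section Composition

variable {E : Type*} [NormedAddCommGroup E] [NormedSpace ℂ E] {Φ : E → ℂ} {W : Set E} {v₀ : E}
  {k : ℕ}

theorem exists_eventually_norm_iteratedFDeriv_le (hΦ : ContDiffAt ℂ k Φ v₀) :
    ∃ C, 0 ≤ C ∧ ∀ᶠ v in 𝓝 v₀, ∀ i ≤ k, ‖iteratedFDeriv ℂ i Φ v‖ ≤ C := by
  refine ⟨∑ i ∈ Finset.range (k + 1), (‖iteratedFDeriv ℂ i Φ v₀‖ + 1), by positivity, ?_⟩
  have hnear : ∀ᶠ v in 𝓝 v₀, ∀ i ∈ Finset.range (k + 1),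
      ‖iteratedFDeriv ℂ i Φ v‖ < ‖iteratedFDeriv ℂ i Φ v₀‖ + 1 := by
    refine (Finset.eventually_all _).2 fun i hi => ?_
    have hik : i ≤ k := Nat.lt_succ_iff.1 (Finset.mem_range.1 hi)
    exact (hΦ.continuousAt_iteratedFDeriv (by exact_mod_cast hik)).norm.eventually_lt_const
      (lt_add_one _)
  filter_upwards [hnear] with v hv i hik
  have hi : i ∈ Finset.range (k + 1) := Finset.mem_range.2 (Nat.lt_succ_iff.2 hik)
  exact (hv i hi).le.trans (Finset.single_le_sum
    (f := fun i => ‖iteratedFDeriv ℂ i Φ v₀‖ + 1) (fun i _ => by positivity) hi)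

theorem norm_iteratedDeriv_comp_le [CompleteSpace E] {G : ℂ → E} {z : ℂ} {C D : ℝ} {j : ℕ}
    (hW : IsOpen W) (hΦ : ContDiffOn ℂ j Φ W) (hG : AnalyticAt ℂ G z) (hGW : G z ∈ W)
    (hC : ∀ i ≤ j, ‖iteratedFDeriv ℂ i Φ (G z)‖ ≤ C)
    (hD : ∀ i, 1 ≤ i → i ≤ j → ‖iteratedDeriv i G z‖ ≤ D ^ i) :
    ‖iteratedDeriv j (fun w => Φ (G w)) z‖ ≤ j.factorial * C * D ^ j := by
  obtain ⟨s, hGs, hs, hzs⟩ := _root_.eventually_nhds_iff.1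
    (hG.eventually_analyticAt.and (hG.continuousAt.eventually_mem (hW.mem_nhds hGW)))
  have hGs' : ContDiffOn ℂ j G s := fun w hw => (hGs w hw).1.contDiffAt.contDiffWithinAt
  rw [← norm_iteratedFDeriv_eq_norm_iteratedDeriv, ← iteratedFDerivWithin_of_isOpen j hs hzs]
  refine norm_iteratedFDerivWithin_comp_le hΦ hGs' le_rfl hW.uniqueDiffOn hs.uniqueDiffOn
    (fun w hw => (hGs w hw).2) hzs (fun i hi => ?_) fun i hi hij => ?_
  · rw [iteratedFDerivWithin_of_isOpen i hW hGW]
    exact hC i hi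
  · rw [iteratedFDerivWithin_of_isOpen i hs hzs, norm_iteratedFDeriv_eq_norm_iteratedDeriv]
    exact hD i hi hij

theorem exists_bound_iteratedDeriv_comp [FiniteDimensional ℂ E] (hW : IsOpen W)
    (hΦ : DifferentiableOn ℂ Φ W) (hv₀ : v₀ ∈ W) (k : ℕ) :
    ∃ V ∈ 𝓝 v₀, ∃ C : ℝ, 0 ≤ C ∧ ∀ (G : ℂ → E) (z : ℂ) (D : ℝ), AnalyticAt ℂ G z → G z ∈ V →
      1 ≤ D → (∀ i, 1 ≤ i → i ≤ k → ‖iteratedDeriv i G z‖ ≤ D) →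
      ∀ j ≤ k, ‖iteratedDeriv j (fun w => Φ (G w)) z‖ ≤ C * D ^ k := by
  have : CompleteSpace E := FiniteDimensional.complete ℂ E
  have hcd := contDiffOn_nat_of_differentiableOn_complex hW hΦ k
  obtain ⟨C, hC0, hC⟩ := exists_eventually_norm_iteratedFDeriv_le
    (hcd.contDiffAt (hW.mem_nhds hv₀))
  refine ⟨_, inter_mem hC (hW.mem_nhds hv₀), k.factorial * C, by positivity, ?_⟩
  intro G z D hG ⟨hGC, hGW⟩ hD hGi j hj
  have hjD : ∀ i, 1 ≤ i → i ≤ j → ‖iteratedDeriv i G z‖ ≤ D ^ i := fun i hi hij =>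
    (hGi i hi (hij.trans hj)).trans (le_self_pow₀ hD (by omega))
  refine (norm_iteratedDeriv_comp_le hW (hcd.of_le (by exact_mod_cast hj)) hG hGW
    (fun i hi => hGC i (hi.trans hj)) hjD).trans ?_
  gcongr

end Composition

/-! ### Circle averages -/

theorem norm_circleAverage_le {E : Type*} [NormedAddCommGroup E] [NormedSpace ℝ E] {f : ℂ → E}
    {c : ℂ} {R : ℝ} : ‖Real.circleAverage f c R‖ ≤ Real.circleAverage (fun z => ‖f z‖) c R := by
  have hpi := Real.two_pi_pos
  rw [Real.circleAverage_def, Real.circleAverage_def, norm_smul, smul_eq_mul,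
    Real.norm_of_nonneg (by positivity)]
  gcongr
  exact intervalIntegral.norm_integral_le_integral_norm hpi.le

theorem circleIntegrable_norm_sub_rpow {r : ℝ} (hr : 0 ≤ r) {a : ℂ} (ha : ‖a‖ ≠ r) (p : ℝ) :
    CircleIntegrable (fun z => ‖z - a‖ ^ p) 0 r := by
  refine ContinuousOn.circleIntegrable hr (ContinuousOn.rpow_const (by fun_prop)
    fun z hz => Or.inl fun h => ha ?_)
  rw [← sub_eq_zero.1 (norm_eq_zero.1 h)]
  simpa using hz

theorem intervalIntegrable_abs_sin_rpow_neg {α : ℝ} (hα0 : 0 ≤ α) (hα1 : α < 1) (a b : ℝ) :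
    IntervalIntegrable (fun θ => |Real.sin θ| ^ (-α)) volume a b := by
  have hpi := Real.pi_pos
  have hper : Function.Periodic (fun θ => |Real.sin θ| ^ (-α)) Real.pi := fun θ => by
    simp [Real.sin_add_pi]
  have hmeas : Measurable fun θ => |Real.sin θ| ^ (-α) := by fun_prop
  have hright : IntervalIntegrable (fun θ => |Real.sin θ| ^ (-α)) volume 0 (Real.pi / 2) := by
    have hdom : IntervalIntegrable (fun θ : ℝ => (2 / Real.pi) ^ (-α) * θ ^ (-α)) volume 0
        (Real.pi / 2) :=
      (intervalIntegral.intervalIntegrable_rpow' (by linarith)).const_mul _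
    refine hdom.mono_fun hmeas.aestronglyMeasurable ?_
    rw [Filter.EventuallyLE, ae_restrict_iff' measurableSet_uIoc]
    refine Eventually.of_forall fun θ hθ => ?_
    rw [Set.uIoc_of_le (by positivity)] at hθ
    have hsin := Real.mul_le_sin hθ.1.le hθ.2
    have hpos : 0 < 2 / Real.pi * θ := mul_pos (by positivity) hθ.1
    rw [← Real.mul_rpow (by positivity) hθ.1.le, Real.norm_of_nonneg (by positivity),
      Real.norm_of_nonneg (Real.rpow_nonneg hpos.le _), abs_of_nonneg (hpos.le.trans hsin)]
    exact Real.rpow_le_rpow_of_nonpos hpos hsin (by linarith)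
  have hleft : IntervalIntegrable (fun θ => |Real.sin θ| ^ (-α)) volume (-(Real.pi / 2)) 0 := by
    simpa using (hright.comp_sub_left 0 (by simp)).symm
  exact hper.intervalIntegrable hpi.ne' (t := -(Real.pi / 2))
    (by simpa [show -(Real.pi / 2) + Real.pi = Real.pi / 2 by ring] using hleft.trans hright) a b

theorem mul_abs_sin_le_norm_circleMap_sub {r : ℝ} (hr : 0 ≤ r) (a : ℂ) (θ : ℝ) :
    r * |Real.sin (θ - a.arg)| ≤ ‖circleMap 0 r θ - a‖ := by
  have hrot : circleMap 0 r θ - a = Complex.exp (a.arg * Complex.I) *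
      (r * Complex.exp ((θ - a.arg : ℝ) * Complex.I) - ‖a‖) := by
    conv_lhs => rw [← Complex.norm_mul_exp_arg_mul_I a]
    simp only [circleMap, zero_add, mul_sub, Complex.ofReal_sub, sub_mul, Complex.exp_sub]
    have := Complex.exp_ne_zero (a.arg * Complex.I)
    field_simp
  rw [hrot, norm_mul, Complex.norm_exp_ofReal_mul_I, one_mul]
  refine le_trans (le_of_eq ?_) (Complex.abs_im_le_norm _)
  simp [Complex.exp_ofReal_mul_I_im, abs_mul, abs_of_nonneg hr, -Complex.ofReal_sub]

theorem ae_sin_sub_ne_zero (c : ℝ) : ∀ᵐ θ : ℝ, Real.sin (θ - c) ≠ 0 := by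
  refine Set.Countable.ae_notMem (s := {θ : ℝ | Real.sin (θ - c) = 0})
    ((Set.countable_range fun k : ℤ => k * Real.pi + c).mono fun θ hθ => ?_) volume
  obtain ⟨k, hk⟩ := Real.sin_eq_zero_iff.1 hθ
  exact ⟨k, by simp only [hk, sub_add_cancel]⟩

theorem integral_abs_sin_sub_rpow (p c : ℝ) :
    ∫ θ in (0 : ℝ)..2 * Real.pi, |Real.sin (θ - c)| ^ p =
      ∫ θ in (0 : ℝ)..2 * Real.pi, |Real.sin θ| ^ p := by
  have hper : Function.Periodic (fun θ => |Real.sin θ| ^ p) (2 * Real.pi) := fun θ => by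
    simp [Real.sin_add_two_pi]
  rw [intervalIntegral.integral_comp_sub_right (fun θ => |Real.sin θ| ^ p)]
  simpa [sub_eq_neg_add] using hper.intervalIntegral_add_eq (0 - c) 0

theorem exists_circleAverage_norm_sub_rpow_neg_le {α : ℝ} (hα0 : 0 ≤ α) (hα1 : α < 1) :
    ∃ C : ℝ, 0 ≤ C ∧ ∀ (r : ℝ) (a : ℂ), 0 < r → ‖a‖ ≠ r →
      Real.circleAverage (fun z => ‖z - a‖ ^ (-α)) 0 r ≤ C * r ^ (-α) := by
  have hpi := Real.two_pi_pos
  refine ⟨(2 * Real.pi)⁻¹ * ∫ θ in (0 : ℝ)..2 * Real.pi, |Real.sin θ| ^ (-α),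
    mul_nonneg (by positivity) (intervalIntegral.integral_nonneg hpi.le fun θ _ => by positivity),
    fun r a hr ha => ?_⟩
  have hsin : IntervalIntegrable (fun θ => r ^ (-α) * |Real.sin (θ - a.arg)| ^ (-α)) volume 0
      (2 * Real.pi) := by
    refine IntervalIntegrable.const_mul ?_ _
    simpa using (intervalIntegrable_abs_sin_rpow_neg hα0 hα1 (0 - a.arg)
      (2 * Real.pi - a.arg)).comp_sub_right a.arg
  rw [Real.circleAverage_def, smul_eq_mul, mul_assoc]
  refine mul_le_mul_of_nonneg_left ?_ (by positivity)
  rw [mul_comm _ (r ^ (-α)), ← integral_abs_sin_sub_rpow (-α) a.arg,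
    ← intervalIntegral.integral_const_mul]
  refine intervalIntegral.integral_mono_ae hpi.le (circleIntegrable_norm_sub_rpow hr.le ha _)
    hsin ?_
  filter_upwards [ae_sin_sub_ne_zero a.arg] with θ hθ
  rw [← Real.mul_rpow hr.le (abs_nonneg _)]
  exact Real.rpow_le_rpow_of_nonpos (mul_pos hr (abs_pos.2 hθ))
    (mul_abs_sin_le_norm_circleMap_sub hr.le a θ) (by linarith)

theorem norm_circleMap_sub_circleMap_comm (R r φ θ : ℝ) :
    ‖circleMap 0 R φ - circleMap 0 r θ‖ = ‖circleMap 0 R θ - circleMap 0 r φ‖ := by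
  have hconj : (starRingEnd ℂ) (circleMap 0 R φ - circleMap 0 r θ) *
      Complex.exp ((θ + φ : ℝ) * Complex.I) = circleMap 0 R θ - circleMap 0 r φ := by
    simp only [circleMap, zero_add, map_sub, map_mul, Complex.conj_ofReal, ← Complex.exp_conj,
      Complex.conj_I, sub_mul, mul_assoc, ← Complex.exp_add]
    congr 3 <;> · push_cast; ring_nf
  rw [← hconj, norm_mul, Complex.norm_exp_ofReal_mul_I, mul_one, Complex.norm_conj]

theorem norm_sub_pos_of_mem_sphere {R : ℝ} {z ζ : ℂ} (hz : z ∈ ball (0 : ℂ) R)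
    (hζ : ζ ∈ sphere (0 : ℂ) R) : 0 < ‖ζ - z‖ := by
  rw [norm_pos_iff, sub_ne_zero]
  rintro rfl
  exact sphere_disjoint_ball.ne_of_mem hζ hz rfl

theorem continuousOn_mul_inv_norm_sub_sq {w : ℂ → ℝ} {R : ℝ} {z : ℂ} (hz : z ∈ ball (0 : ℂ) R)
    (hw : ContinuousOn w (sphere 0 R)) :
    ContinuousOn (fun ζ => w ζ * (‖ζ - z‖ ^ 2)⁻¹) (sphere 0 R) :=
  hw.mul (ContinuousOn.inv₀ (by fun_prop)
    fun _ hζ => (pow_pos (norm_sub_pos_of_mem_sphere hz hζ) 2).ne')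

theorem circleAverage_poissonKernel_mul_eq {w : ℂ → ℝ} {R : ℝ} {z : ℂ} :
    Real.circleAverage (fun ζ => poissonKernel 0 z ζ * w ζ) 0 R =
      (R ^ 2 - ‖z‖ ^ 2) * Real.circleAverage (fun ζ => w ζ * (‖ζ - z‖ ^ 2)⁻¹) 0 R := by
  rw [← smul_eq_mul, ← Real.circleAverage_fun_smul]
  refine Real.circleAverage_congr_sphere fun ζ hζ => ?_
  have hζR : ‖ζ‖ = |R| := by simpa using hζ
  simp only [poissonKernel_def, sub_zero, hζR, sq_abs, smul_eq_mul]
  ring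

theorem circleAverage_inv_norm_sub_sq {r R : ℝ} (hr : 0 ≤ r) (hrR : r < R) (φ : ℝ) :
    Real.circleAverage (fun z => (‖circleMap 0 R φ - z‖ ^ 2)⁻¹) 0 r = (R ^ 2 - r ^ 2)⁻¹ := by
  have hmem : circleMap 0 r φ ∈ ball (0 : ℂ) R := by simpa [abs_of_nonneg hr] using hrR
  have hpoisson := (InnerProductSpace.harmonicOnNhd_const (s := closedBall (0 : ℂ) R)
    (1 : ℝ)).circleAverage_poissonKernel_smul hmem
  have hnorm : (R ^ 2 - r ^ 2) *
      Real.circleAverage (fun ζ => (‖ζ - circleMap 0 r φ‖ ^ 2)⁻¹) 0 R = 1 := by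
    simpa [abs_of_nonneg hr] using
      (circleAverage_poissonKernel_mul_eq (w := fun _ => 1)).symm.trans hpoisson
  have hsymm : Real.circleAverage (fun z => (‖circleMap 0 R φ - z‖ ^ 2)⁻¹) 0 r =
      Real.circleAverage (fun ζ => (‖ζ - circleMap 0 r φ‖ ^ 2)⁻¹) 0 R := by
    simp only [Real.circleAverage_def, norm_circleMap_sub_circleMap_comm R r φ]
  rw [hsymm]
  exact eq_inv_of_mul_eq_one_right hnorm

theorem continuous_mul_inv_norm_circleMap_sub_sq {w : ℂ → ℝ} {r R : ℝ} (hr : 0 ≤ r) (hrR : r < R)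
    (hw : ContinuousOn w (sphere 0 R)) :
    Continuous fun p : ℝ × ℝ =>
      w (circleMap 0 R p.2) * (‖circleMap 0 R p.2 - circleMap 0 r p.1‖ ^ 2)⁻¹ := by
  have hcirc : ∀ θ, circleMap 0 R θ ∈ sphere (0 : ℂ) R := circleMap_mem_sphere _ (hr.trans hrR.le)
  have hw' : Continuous fun p : ℝ × ℝ => w (circleMap 0 R p.2) :=
    hw.comp_continuous (by fun_prop) fun p => hcirc _
  refine hw'.mul (Continuous.inv₀ (by fun_prop) fun p => ?_)
  exact (pow_pos (norm_sub_pos_of_mem_sphere (by simpa [abs_of_nonneg hr]) (hcirc _)) 2).ne'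

theorem circleIntegrable_circleAverage_mul_inv_norm_sub_sq {w : ℂ → ℝ} {r R : ℝ} (hr : 0 ≤ r)
    (hrR : r < R) (hw : ContinuousOn w (sphere 0 R)) :
    CircleIntegrable (fun z => Real.circleAverage (fun ζ => w ζ * (‖ζ - z‖ ^ 2)⁻¹) 0 R) 0 r := by
  refine Continuous.intervalIntegrable ?_ _ _
  simp only [Real.circleAverage_def, smul_eq_mul]
  exact continuous_const.mul
    (intervalIntegral.continuous_parametric_intervalIntegral_of_continuous'
      (f := fun θ φ => w (circleMap 0 R φ) * (‖circleMap 0 R φ - circleMap 0 r θ‖ ^ 2)⁻¹)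
      (continuous_mul_inv_norm_circleMap_sub_sq hr hrR hw) _ _)

theorem circleAverage_circleAverage_mul_inv_norm_sub_sq {w : ℂ → ℝ} {r R : ℝ} (hr : 0 ≤ r)
    (hrR : r < R) (hw : ContinuousOn w (sphere 0 R)) :
    Real.circleAverage (fun z => Real.circleAverage (fun ζ => w ζ * (‖ζ - z‖ ^ 2)⁻¹) 0 R) 0 r =
      (R ^ 2 - r ^ 2)⁻¹ * Real.circleAverage w 0 R := by
  have hswap := intervalIntegral_intervalIntegral_swap
    (F := fun θ φ => w (circleMap 0 R φ) * (‖circleMap 0 R φ - circleMap 0 r θ‖ ^ 2)⁻¹)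
    (a := 0) (b := 2 * Real.pi) (c := 0) (d := 2 * Real.pi)
    (((continuous_mul_inv_norm_circleMap_sub_sq hr hrR hw).continuousOn.integrableOn_compact
      (isCompact_uIcc.prod isCompact_uIcc)).mono_set
        (Set.prod_mono Set.uIoc_subset_uIcc Set.uIoc_subset_uIcc))
  have hinner : ∀ φ, ∫ θ in (0 : ℝ)..2 * Real.pi,
      w (circleMap 0 R φ) * (‖circleMap 0 R φ - circleMap 0 r θ‖ ^ 2)⁻¹ =
      w (circleMap 0 R φ) * (2 * Real.pi * (R ^ 2 - r ^ 2)⁻¹) := by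
    intro φ
    rw [intervalIntegral.integral_const_mul, ← circleAverage_inv_norm_sub_sq hr hrR φ,
      Real.circleAverage_def, smul_eq_mul]
    field_simp
  simp only [Real.circleAverage_def, smul_eq_mul, intervalIntegral.integral_const_mul, hswap,
    hinner, intervalIntegral.integral_mul_const]
  field_simp

/-! ### The Poisson–Jensen formula and logarithmic derivatives -/

/-- The holomorphic function on the ball `|w| < R` whose real part is the Poisson integral of the
boundary values `g` on the circle `|ζ| = R`. -/
noncomputable def herglotzIntegral (g : ℂ → ℝ) (R : ℝ) (w : ℂ) : ℂ :=
  Real.circleAverage (fun ζ => herglotzRieszKernel 0 w ζ • (g ζ : ℂ)) 0 R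

theorem herglotzIntegral_congr {g₁ g₂ : ℂ → ℝ} {R : ℝ} (h : Set.EqOn g₁ g₂ (sphere 0 |R|)) :
    herglotzIntegral g₁ R = herglotzIntegral g₂ R :=
  funext fun _ => Real.circleAverage_congr_sphere fun ζ hζ => by simp only [h hζ]

section HerglotzIntegral

variable {g : ℂ → ℝ} {R : ℝ} {w z : ℂ}

theorem circleIntegrable_ofReal (hg : ContinuousOn g (sphere 0 R)) (hR : 0 ≤ R) :
    CircleIntegrable (fun ζ => (g ζ : ℂ)) 0 R :=
  (Complex.continuous_ofReal.comp_continuousOn hg).circleIntegrable hR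

theorem analyticOnNhd_herglotzIntegral (hg : ContinuousOn g (sphere 0 R)) :
    AnalyticOnNhd ℂ (herglotzIntegral g R) (ball 0 R) := fun w hw =>
  analyticOnNhd_circleAverage_herglotzRieszKernel_smul
    (circleIntegrable_ofReal hg (pos_of_mem_ball hw).le) w hw

theorem norm_deriv_herglotzIntegral_le (hg : ContinuousOn g (sphere 0 R)) (hw : w ∈ ball 0 R) :
    ‖deriv (herglotzIntegral g R) w‖ ≤
      2 * R * Real.circleAverage (fun ζ => |g ζ| * (‖ζ - w‖ ^ 2)⁻¹) 0 R := by
  have hR : 0 < R := pos_of_mem_ball hw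
  have hderiv : deriv (herglotzIntegral g R) w =
      Real.circleAverage (fun ζ => (2 * ζ / (ζ - w) ^ 2) • (g ζ : ℂ)) 0 R :=
    (hasDerivAt_circleAverage_herglotzRieszKernel_smul (circleIntegrable_ofReal hg hR.le) hw).deriv
  rw [hderiv, ← smul_eq_mul (2 * R), ← Real.circleAverage_fun_smul]
  refine norm_circleAverage_le.trans (Real.circleAverage_congr_sphere fun ζ hζ => ?_).le
  have hζR : ‖ζ‖ = R := by simpa [abs_of_pos hR] using hζ
  simp only [norm_div, norm_mul, norm_pow, hζR, Complex.norm_real, Real.norm_eq_abs,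
    smul_eq_mul, Complex.norm_ofNat]
  ring

theorem norm_sub_le_two_mul_norm_sub {ζ : ℂ} (hζ : ‖ζ‖ = R)
    (hwz : ‖w - z‖ ≤ (R - ‖z‖) / 2) : ‖ζ - z‖ ≤ 2 * ‖ζ - w‖ := by
  have htri : ‖ζ - z‖ ≤ ‖ζ - w‖ + ‖w - z‖ := norm_sub_le_norm_sub_add_norm_sub _ _ _
  have hdist : R - ‖z‖ ≤ ‖ζ - z‖ := hζ ▸ norm_sub_norm_le ζ z
  linarith

theorem mem_ball_of_norm_sub_le (hz : z ∈ ball (0 : ℂ) R) (hwz : ‖w - z‖ ≤ (R - ‖z‖) / 2) :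
    w ∈ ball (0 : ℂ) R := by
  rw [mem_ball_zero_iff] at hz ⊢
  linarith [norm_le_norm_sub_add w z]

theorem circleAverage_mul_inv_norm_sub_sq_le (hg : ContinuousOn g (sphere 0 R))
    (hz : z ∈ ball 0 R) (hwz : ‖w - z‖ ≤ (R - ‖z‖) / 2) :
    Real.circleAverage (fun ζ => |g ζ| * (‖ζ - w‖ ^ 2)⁻¹) 0 R ≤
      4 * Real.circleAverage (fun ζ => |g ζ| * (‖ζ - z‖ ^ 2)⁻¹) 0 R := by
  have hR : 0 < R := pos_of_mem_ball hz
  have hw := mem_ball_of_norm_sub_le hz hwz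
  rw [← smul_eq_mul 4, ← Real.circleAverage_fun_smul]
  refine Real.circleAverage_mono
    ((continuousOn_mul_inv_norm_sub_sq hw hg.abs).circleIntegrable hR.le)
    (((continuousOn_mul_inv_norm_sub_sq hz hg.abs).const_smul (4 : ℝ)).circleIntegrable hR.le)
    fun ζ hζ => ?_
  rw [abs_of_pos hR] at hζ
  have hζz := norm_sub_pos_of_mem_sphere hz hζ
  have hle := norm_sub_le_two_mul_norm_sub (mem_sphere_zero_iff_norm.1 hζ) hwz
  calc |g ζ| * (‖ζ - w‖ ^ 2)⁻¹ ≤ |g ζ| * ((‖ζ - z‖ / 2) ^ 2)⁻¹ := by gcongr; linarith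
    _ = 4 • (|g ζ| * (‖ζ - z‖ ^ 2)⁻¹) := by rw [div_pow]; simp; ring
    _ = _ := by simp

theorem norm_iteratedDeriv_deriv_herglotzIntegral_le (hg : ContinuousOn g (sphere 0 R))
    (hz : z ∈ ball 0 R) (j : ℕ) :
    ‖iteratedDeriv j (deriv (herglotzIntegral g R)) z‖ ≤ j.factorial * (8 * R) /
      ((R - ‖z‖) / 2) ^ j * Real.circleAverage (fun ζ => |g ζ| * (‖ζ - z‖ ^ 2)⁻¹) 0 R := by
  have hρ : 0 < (R - ‖z‖) / 2 := half_pos (sub_pos.2 (mem_ball_zero_iff.1 hz))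
  have hclosedBall : ∀ w ∈ closedBall z ((R - ‖z‖) / 2), w ∈ ball (0 : ℂ) R := fun w hw =>
    mem_ball_of_norm_sub_le hz (mem_closedBall_iff_norm.1 hw)
  have hdiff : DiffContOnCl ℂ (deriv (herglotzIntegral g R)) (ball z ((R - ‖z‖) / 2)) := by
    refine DifferentiableOn.diffContOnCl fun w hw => ?_
    rw [closure_ball _ hρ.ne'] at hw
    exact ((analyticOnNhd_herglotzIntegral hg).deriv w
      (hclosedBall w hw)).differentiableAt.differentiableWithinAt
  have hbound : ∀ w ∈ sphere z ((R - ‖z‖) / 2), ‖deriv (herglotzIntegral g R) w‖ ≤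
      8 * R * Real.circleAverage (fun ζ => |g ζ| * (‖ζ - z‖ ^ 2)⁻¹) 0 R := fun w hw => by
    have hR : 0 < R := pos_of_mem_ball hz
    refine (norm_deriv_herglotzIntegral_le hg
      (hclosedBall w (sphere_subset_closedBall hw))).trans ?_
    have := circleAverage_mul_inv_norm_sub_sq_le hg hz (mem_sphere_iff_norm.1 hw).le
    nlinarith
  refine (Complex.norm_iteratedDeriv_le_of_forall_mem_sphere_norm_le j hρ hdiff hbound).trans_eq ?_
  ring

end HerglotzIntegral

theorem logDeriv_eq_deriv_of_norm_eq_exp_re {U : Set ℂ} (hU : IsOpen U) (hUc : IsPreconnected U)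
    {h L : ℂ → ℂ} (hh : DifferentiableOn ℂ h U) (hL : DifferentiableOn ℂ L U)
    (hhL : ∀ w ∈ U, ‖h w‖ = Real.exp (L w).re) {w : ℂ} (hw : w ∈ U) :
    logDeriv h w = deriv L w := by
  have hnorm : ∀ x ∈ U, ‖h x * Complex.exp (-L x)‖ = 1 := fun x hx => by
    rw [norm_mul, hhL x hx, Complex.norm_exp, ← Real.exp_add, Complex.neg_re, add_neg_cancel,
      Real.exp_zero]
  obtain ⟨c, hc⟩ : ∃ c, ∀ x ∈ U, h x * Complex.exp (-L x) = c :=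
    ⟨_, Complex.eqOn_of_isPreconnected_of_isMaxOn_norm hUc hU (hh.mul hL.neg.cexp) hw
      fun x hx => ((hnorm x hx).trans (hnorm w hw).symm).le⟩
  have hmul : ∀ x ∈ U, h x = c * Complex.exp (L x) := fun x hx => by
    rw [← hc x hx, mul_assoc, ← Complex.exp_add, neg_add_cancel, Complex.exp_zero, mul_one]
  have hne : c ≠ 0 := norm_ne_zero_iff.1 (by rw [← hc w hw, hnorm w hw]; exact one_ne_zero)
  have hderiv := ((hL.differentiableAt (hU.mem_nhds hw)).hasDerivAt.cexp).const_mul c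
  rw [logDeriv_apply, (Filter.eventuallyEq_of_mem (hU.mem_nhds hw) hmul).deriv_eq, hderiv.deriv,
    hmul w hw, ← mul_assoc, mul_div_cancel_left₀ _ (mul_ne_zero hne (Complex.exp_ne_zero _))]

theorem logDeriv_eq_deriv_herglotzIntegral {h : ℂ → ℂ} {R : ℝ}
    (hh : AnalyticOnNhd ℂ h (closedBall 0 R)) (h0 : ∀ w ∈ closedBall (0 : ℂ) R, h w ≠ 0)
    {w : ℂ} (hw : w ∈ ball (0 : ℂ) R) :
    logDeriv h w = deriv (herglotzIntegral (fun ζ => Real.log ‖h ζ‖) R) w := by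
  have hR : 0 < R := pos_of_mem_ball hw
  have hlog : ContinuousOn (fun ζ => Real.log ‖h ζ‖) (sphere 0 R) :=
    (hh.continuousOn.mono sphere_subset_closedBall).norm.log fun ζ hζ =>
      norm_ne_zero_iff.2 (h0 ζ (sphere_subset_closedBall hζ))
  refine logDeriv_eq_deriv_of_norm_eq_exp_re isOpen_ball (convex_ball _ _).isPreconnected
    (hh.differentiableOn.mono ball_subset_closedBall)
    (analyticOnNhd_herglotzIntegral hlog).differentiableOn (fun x hx => ?_) hw
  have hre : (herglotzIntegral (fun ζ => Real.log ‖h ζ‖) R x).re = Real.log ‖h x‖ := by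
    rw [herglotzIntegral, re_circleAverage_herglotzRieszKernel_smul
      (hlog.circleIntegrable hR.le) hx]
    exact InnerProductSpace.HarmonicOnNhd.circleAverage_re_herglotzRieszKernel_smul
      (fun y hy => (hh y hy).harmonicAt_log_norm (h0 y hy)) hx
  rw [hre, Real.exp_log (norm_pos_iff.2 (h0 x (ball_subset_closedBall hx)))]

/-- `u` is holomorphic and nonzero at every point of `s`: for meromorphic `u`, the set `s` avoids
the divisor of `u` (and removable singularities with a wrong value). -/
def RegularOn (u : ℂ → ℂ) (s : Set ℂ) : Prop :=
  ∀ z ∈ s, AnalyticAt ℂ u z ∧ u z ≠ 0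

theorem analyticAt_iteratedDeriv_logDeriv {u : ℂ → ℂ} {z : ℂ} (hu : AnalyticAt ℂ u z)
    (h0 : u z ≠ 0) (j : ℕ) : AnalyticAt ℂ (iteratedDeriv j (logDeriv u)) z := by
  rw [iteratedDeriv_eq_iterate]
  exact (hu.deriv.div hu h0).iterated_deriv j

namespace RegularOn

variable {u : ℂ → ℂ} {s : Set ℂ}

theorem continuousOn_iteratedDeriv_logDeriv (hu : RegularOn u s) (j : ℕ) :
    ContinuousOn (iteratedDeriv j (logDeriv u)) s := fun z hz =>
  (analyticAt_iteratedDeriv_logDeriv (hu z hz).1 (hu z hz).2 j).continuousAt.continuousWithinAt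

theorem continuousOn_log_norm (hu : RegularOn u s) :
    ContinuousOn (fun z => Real.log ‖u z‖) s := fun z hz =>
  ((hu z hz).1.continuousAt.norm.log (norm_ne_zero_iff.2 (hu z hz).2)).continuousWithinAt

end RegularOn

section ZerosAndPoles

variable {u : ℂ → ℂ} {R : ℝ}

/-- The zeros and poles of a meromorphic function in the open ball of radius `R`, as a finite
set over which the factors of the Poisson–Jensen formula are indexed. -/
noncomputable def zerosAndPoles (hu : Meromorphic u) (R : ℝ) : Finset ℂ :=
  (hu.meromorphicOn (s := closedBall 0 R)).divisor_ball_support_finite.toFinset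

theorem mem_zerosAndPoles {hu : Meromorphic u} {a : ℂ} :
    a ∈ zerosAndPoles hu R ↔ MeromorphicOn.divisor u (ball 0 R) a ≠ 0 := by
  simp [zerosAndPoles]

theorem mem_ball_of_mem_zerosAndPoles {hu : Meromorphic u} {a : ℂ} (ha : a ∈ zerosAndPoles hu R) :
    a ∈ ball (0 : ℂ) R :=
  (MeromorphicOn.divisor u (ball 0 R)).supportWithinDomain (mem_zerosAndPoles.1 ha)

theorem divisor_eq_zero_of_analyticAt {s : Set ℂ} (hu : Meromorphic u) {w : ℂ}
    (hw : AnalyticAt ℂ u w) (hw0 : u w ≠ 0) : MeromorphicOn.divisor u s w = 0 := by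
  by_cases hws : w ∈ s
  · rw [MeromorphicOn.divisor_apply hu.meromorphicOn hws,
      hw.meromorphicNFAt.meromorphicOrderAt_eq_zero_iff.2 hw0, WithTop.untop₀_zero]
  · exact Function.locallyFinsuppWithin.apply_eq_zero_of_notMem _ hws

theorem ne_of_mem_zerosAndPoles {hu : Meromorphic u} {a w : ℂ} (ha : a ∈ zerosAndPoles hu R)
    (hw : AnalyticAt ℂ u w) (hw0 : u w ≠ 0) : w ≠ a := by
  rintro rfl
  exact mem_zerosAndPoles.1 ha (divisor_eq_zero_of_analyticAt hu hw hw0)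

theorem exists_nonvanishing_factor (hR : 0 < R) (hu : Meromorphic u)
    (hord : ∀ z, meromorphicOrderAt u z ≠ ⊤) (hs : RegularOn u (sphere 0 R)) :
    ∃ h : ℂ → ℂ, AnalyticOnNhd ℂ h (closedBall 0 R) ∧ (∀ w ∈ closedBall (0 : ℂ) R, h w ≠ 0) ∧
      (∀ w ∈ sphere (0 : ℂ) R, ‖h w‖ = ‖u w‖) ∧
      ∀ w ∈ closedBall (0 : ℂ) R, AnalyticAt ℂ u w → u w ≠ 0 →
        h w = (∏ a ∈ zerosAndPoles hu R,
          Complex.canonicalFactor R a w ^ MeromorphicOn.divisor u (ball 0 R) a) * u w := by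
  obtain ⟨h, D⟩ := (hu.meromorphicOn (s := closedBall 0 R)).exists_ecanonicalDecomp
    fun z => hord z
  have hprod : ∀ w ∈ closedBall (0 : ℂ) R, AnalyticAt ℂ u w → u w ≠ 0 →
        h w = (∏ a ∈ zerosAndPoles hu R,
          Complex.canonicalFactor R a w ^ MeromorphicOn.divisor u (ball 0 R) a) * u w := by
    intro w hw hwa hw0
    have hsphere : ∀ i, MeromorphicOn.divisor u (sphere 0 R) i = 0 := fun i => by
      by_cases hi : i ∈ sphere (0 : ℂ) R
      · exact divisor_eq_zero_of_analyticAt hu (hs i hi).1 (hs i hi).2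
      · exact Function.locallyFinsuppWithin.apply_eq_zero_of_notMem _ hi
    have hone : ∏ᶠ i, (w - i) ^ (-MeromorphicOn.divisor u (sphere 0 R)) i = 1 := by
      simp [hsphere]
    rw [D.eq_smul_meromorphicTrailingCoeffAt_of_meromorphicOrderAt hw
      (hwa.meromorphicNFAt.meromorphicOrderAt_eq_zero_iff.2 hw0) hR,
      hwa.meromorphicTrailingCoeffAt_of_ne_zero hw0, smul_eq_mul, hone, mul_one]
    congr 1
    refine finprod_eq_prod_of_mulSupport_subset _ fun a ha => ?_
    rw [Finset.mem_coe, mem_zerosAndPoles]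
    intro h0
    simp [h0] at ha
  refine ⟨h, D.analyticOnNhd, D.ne_zero, fun w hw => ?_, hprod⟩
  rw [hprod w (sphere_subset_closedBall hw) (hs w hw).1 (hs w hw).2, norm_mul, norm_prod,
    Finset.prod_eq_one, one_mul]
  intro a ha
  rw [norm_zpow, Complex.norm_canonicalFactor_eval_circle_eq_one
    (mem_ball_of_mem_zerosAndPoles ha) hw, one_zpow]

end ZerosAndPoles

theorem norm_iteratedDeriv_logDeriv_linear_sub (c d z : ℂ) (j : ℕ) :
    ‖iteratedDeriv j (logDeriv fun w => c * w - d) z‖ =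
      j.factorial * (‖c‖ / ‖c * z - d‖) ^ (j + 1) := by
  have hlog : (logDeriv fun w => c * w - d) = fun w => c * (c * w - d)⁻¹ := by
    ext w
    rw [logDeriv_apply, deriv_sub_const, deriv_const_mul_field, deriv_id'', mul_one, div_eq_mul_inv]
  have hexp : -1 - (j : ℤ) = -((j + 1 : ℕ) : ℤ) := by push_cast; ring
  rw [hlog, iteratedDeriv_const_mul_field, iteratedDeriv_eq_iterate, iter_deriv_inv_linear_sub]
  simp only [hexp, zpow_neg, zpow_natCast, norm_mul, norm_pow, norm_neg, norm_one, one_pow, one_mul,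
    norm_inv, RCLike.norm_natCast, div_pow]
  ring

theorem mul_norm_sub_le_norm_sq_sub_conj_mul {R : ℝ} {a z : ℂ} (ha : a ∈ ball (0 : ℂ) R)
    (hz : z ∈ ball (0 : ℂ) R) :
    R * ‖z - a‖ ≤ ‖(R : ℂ) ^ 2 - (starRingEnd ℂ) a * z‖ := by
  have hR : 0 < R := pos_of_mem_ball ha
  rw [mem_ball_zero_iff] at ha hz
  have hsq : ‖(R : ℂ) ^ 2 - (starRingEnd ℂ) a * z‖ ^ 2 - (R * ‖z - a‖) ^ 2 =
      (R ^ 2 - ‖a‖ ^ 2) * (R ^ 2 - ‖z‖ ^ 2) := by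
    rw [mul_pow, ← Complex.normSq_eq_norm_sq, ← Complex.normSq_eq_norm_sq,
      ← Complex.normSq_eq_norm_sq, ← Complex.normSq_eq_norm_sq]
    simp only [Complex.normSq_apply, Complex.sub_re, Complex.sub_im, Complex.mul_re,
      Complex.mul_im, Complex.conj_re, Complex.conj_im, sq, Complex.ofReal_re, Complex.ofReal_im]
    ring
  have hnonneg : 0 ≤ (R ^ 2 - ‖a‖ ^ 2) * (R ^ 2 - ‖z‖ ^ 2) :=
    mul_nonneg (by nlinarith [norm_nonneg a]) (by nlinarith [norm_nonneg z])
  exact (pow_le_pow_iff_left₀ (by positivity) (norm_nonneg _) two_ne_zero).1 (by linarith)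

section CanonicalFactor

variable {R : ℝ} {a z : ℂ}

theorem sq_sub_conj_mul_ne_zero (ha : a ∈ ball 0 R) (hz : z ∈ ball 0 R) (haz : z ≠ a) :
    (R : ℂ) ^ 2 - (starRingEnd ℂ) a * z ≠ 0 :=
  norm_pos_iff.1 ((mul_pos (pos_of_mem_ball ha) (norm_pos_iff.2 (sub_ne_zero.2 haz))).trans_le
    (mul_norm_sub_le_norm_sq_sub_conj_mul ha hz))

theorem logDeriv_canonicalFactor (ha : a ∈ ball 0 R) (hz : z ∈ ball 0 R) (haz : z ≠ a) :
    logDeriv (Complex.canonicalFactor R a) z =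
      logDeriv (fun w => (starRingEnd ℂ) a * w - (R : ℂ) ^ 2) z -
        logDeriv (fun w => 1 * w - a) z := by
  have hR : (R : ℂ) ≠ 0 := by exact_mod_cast (pos_of_mem_ball ha).ne'
  have hza : z - a ≠ 0 := sub_ne_zero.2 haz
  have hnum := sq_sub_conj_mul_ne_zero ha hz haz
  have hnum' : (starRingEnd ℂ) a * z - (R : ℂ) ^ 2 ≠ 0 := by rwa [← neg_sub, neg_ne_zero]
  rw [Complex.canonicalFactor_def, logDeriv_div (f := fun z => (R : ℂ) ^ 2 - (starRingEnd ℂ) a * z)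
    (g := fun z => (R : ℂ) * (z - a)) z hnum (mul_ne_zero hR hza) (by fun_prop) (by fun_prop)]
  have hlinear : ∀ c d : ℂ, deriv (fun w => c * w - d) z = c := fun c d => by simp
  have hderivNum : deriv (fun w => (R : ℂ) ^ 2 - (starRingEnd ℂ) a * w) z = -(starRingEnd ℂ) a := by
    simp
  have hderivDen : deriv (fun w => (R : ℂ) * (w - a)) z = R := by simp
  simp only [logDeriv_apply, hlinear, hderivNum, hderivDen]
  field_simp
  ring

theorem norm_iteratedDeriv_logDeriv_canonicalFactor_le (ha : a ∈ ball 0 R) (hz : z ∈ ball 0 R)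
    (haz : z ≠ a) (j : ℕ) :
    ‖iteratedDeriv j (logDeriv (Complex.canonicalFactor R a)) z‖ ≤
      2 * j.factorial * (‖z - a‖ ^ (j + 1))⁻¹ := by
  have hev : logDeriv (Complex.canonicalFactor R a) =ᶠ[𝓝 z]
      logDeriv (fun w => (starRingEnd ℂ) a * w - (R : ℂ) ^ 2) - logDeriv fun w => 1 * w - a := by
    filter_upwards [isOpen_ball.mem_nhds hz, isOpen_ne.mem_nhds haz] with w hw hwa
    exact logDeriv_canonicalFactor ha hw hwa
  have hanalytic : ∀ c d : ℂ, c * z - d ≠ 0 → ContDiffAt ℂ j (logDeriv fun w => c * w - d) z :=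
    fun c d h => AnalyticAt.contDiffAt
      (analyticAt_iteratedDeriv_logDeriv (u := fun w => c * w - d) (by fun_prop) h 0)
  have hpos : 0 < ‖z - a‖ := norm_pos_iff.2 (sub_ne_zero.2 haz)
  have hR : 0 < R := pos_of_mem_ball ha
  have hnum := mul_norm_sub_le_norm_sq_sub_conj_mul ha hz
  have hratio : ‖(starRingEnd ℂ) a‖ / ‖(starRingEnd ℂ) a * z - (R : ℂ) ^ 2‖ ≤ ‖z - a‖⁻¹ := by
    rw [← norm_neg (_ - _), neg_sub, Complex.norm_conj, div_le_iff₀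
      ((mul_pos hR hpos).trans_le hnum), inv_mul_eq_div, le_div_iff₀ hpos]
    nlinarith [mem_ball_zero_iff.1 ha]
  rw [hev.iteratedDeriv_eq, iteratedDeriv_sub
    (hanalytic _ _ (by rw [← neg_sub, neg_ne_zero]; exact sq_sub_conj_mul_ne_zero ha hz haz))
    (hanalytic _ _ (by rwa [one_mul, sub_ne_zero]))]
  refine (norm_sub_le _ _).trans ?_
  rw [norm_iteratedDeriv_logDeriv_linear_sub, norm_iteratedDeriv_logDeriv_linear_sub, norm_one,
    one_mul, one_div, ← inv_pow, mul_assoc, two_mul]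
  gcongr

theorem one_le_norm_canonicalFactor (ha : a ∈ ball 0 R) (hz : z ∈ ball 0 R) (haz : z ≠ a) :
    1 ≤ ‖Complex.canonicalFactor R a z‖ := by
  have hR : 0 < R := pos_of_mem_ball ha
  rw [Complex.canonicalFactor_apply, norm_div, norm_mul, Complex.norm_of_nonneg hR.le,
    one_le_div₀ (mul_pos hR (norm_pos_iff.2 (sub_ne_zero.2 haz)))]
  exact mul_norm_sub_le_norm_sq_sub_conj_mul ha hz

end CanonicalFactor

theorem eventually_nhdsNE_ne_zero {h : ℂ → ℂ} (hd : Differentiable ℂ h) (h0 : ∃ z, h z ≠ 0)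
    (z : ℂ) : ∀ᶠ w in 𝓝[≠] z, h w ≠ 0 := by
  obtain ⟨x, hx⟩ := h0
  rcases (Complex.analyticOnNhd_univ_iff_differentiable.2
    hd).eqOn_zero_or_eventually_ne_zero_of_preconnected isPreconnected_univ with hzero | hne
  · exact absurd (hzero (Set.mem_univ x)) hx
  · have hmem := disjoint_principal_right.1 (mem_codiscrete.1 hne z)
    rwa [compl_compl] at hmem

theorem meromorphicOrderAt_ne_top_of_differentiable {h : ℂ → ℂ} (hd : Differentiable ℂ h)
    (h0 : ∃ z, h z ≠ 0) (z : ℂ) : meromorphicOrderAt h z ≠ ⊤ :=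
  (meromorphicOrderAt_ne_top_iff_eventually_ne_zero (hd.analyticAt z).meromorphicAt).2
    (eventually_nhdsNE_ne_zero hd h0 z)

theorem countable_norm_image_setOf_not {p : ℂ → Prop} (hp : ∀ z, ∀ᶠ w in 𝓝[≠] z, p w) :
    (norm '' {z | ¬p z}).Countable := by
  have hcodiscrete : {z | p z} ∈ codiscrete ℂ :=
    mem_codiscrete.2 fun z => disjoint_principal_right.2 (by rw [compl_compl]; exact hp z)
  exact ((HereditarilyLindelofSpace.isLindelof _).countable_of_isDiscrete
    (mem_codiscrete'.1 hcodiscrete).2).image norm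

section PoissonJensen

variable {u : ℂ → ℂ} {R : ℝ} {z : ℂ}

theorem logDeriv_prod_zpow_mul {s : Finset ℂ} {f : ℂ → ℂ → ℂ} {e : ℂ → ℤ}
    (hf : ∀ a ∈ s, DifferentiableAt ℂ (f a) z) (hf0 : ∀ a ∈ s, f a z ≠ 0)
    (hu : DifferentiableAt ℂ u z) (hu0 : u z ≠ 0) :
    logDeriv (fun w => (∏ a ∈ s, f a w ^ e a) * u w) z =
      (∑ a ∈ s, (e a : ℂ) * logDeriv (f a) z) + logDeriv u z := by
  have hne : ∀ a ∈ s, f a z ^ e a ≠ 0 := fun a ha => zpow_ne_zero _ (hf0 a ha)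
  have hdiff : ∀ a ∈ s, DifferentiableAt ℂ (fun w => f a w ^ e a) z := fun a ha =>
    (hf a ha).zpow (Or.inl (hf0 a ha))
  rw [logDeriv_mul z (Finset.prod_ne_zero_iff.2 hne) hu0 (DifferentiableAt.fun_finsetProd hdiff) hu,
    logDeriv_prod (f := fun a w => f a w ^ e a) hne hdiff]
  exact congrArg (· + _) (Finset.sum_congr rfl fun a ha => logDeriv_fun_zpow (hf a ha) _)

theorem logDeriv_eq_herglotzIntegral_sub_sum (hu : Meromorphic u)
    (hord : ∀ z, meromorphicOrderAt u z ≠ ⊤) (hs : RegularOn u (sphere 0 R))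
    (hz : z ∈ ball (0 : ℂ) R) (hza : AnalyticAt ℂ u z) (hz0 : u z ≠ 0) :
    logDeriv u z = deriv (herglotzIntegral (fun ζ => Real.log ‖u ζ‖) R) z -
      ∑ a ∈ zerosAndPoles hu R,
        (MeromorphicOn.divisor u (ball 0 R) a : ℂ) * logDeriv (Complex.canonicalFactor R a) z := by
  have hR : 0 < R := pos_of_mem_ball hz
  obtain ⟨h, hh, hh0, hnorm, hprod⟩ := exists_nonvanishing_factor hR hu hord hs
  have hcongr : herglotzIntegral (fun ζ => Real.log ‖u ζ‖) R =
      herglotzIntegral (fun ζ => Real.log ‖h ζ‖) R :=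
    herglotzIntegral_congr fun ζ hζ => by simp only [hnorm ζ (abs_of_pos hR ▸ hζ)]
  have hev : h =ᶠ[𝓝 z] fun w => (∏ a ∈ zerosAndPoles hu R,
      Complex.canonicalFactor R a w ^ MeromorphicOn.divisor u (ball 0 R) a) * u w := by
    filter_upwards [isOpen_ball.mem_nhds hz, hza.eventually_analyticAt,
      hza.continuousAt.eventually_ne hz0] with w hw hwa hw0
    exact hprod w (ball_subset_closedBall hw) hwa hw0
  have hne : ∀ a ∈ zerosAndPoles hu R, z ≠ a := fun a ha => ne_of_mem_zerosAndPoles ha hza hz0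
  rw [hcongr, ← logDeriv_eq_deriv_herglotzIntegral hh hh0 hz, logDeriv_apply h, hev.deriv_eq,
    hev.eq_of_nhds, ← logDeriv_apply, logDeriv_prod_zpow_mul
      (fun a ha => (Complex.analyticOnNhd_canonicalFactor R a z (hne a ha)).differentiableAt)
      (fun a ha => Complex.canonicalFactor_ne_zero (mem_ball_of_mem_zerosAndPoles ha)
        (ball_subset_closedBall hz) (hne a ha)) hza.differentiableAt hz0]
  ring

theorem norm_iteratedDeriv_logDeriv_le (hu : Meromorphic u)
    (hord : ∀ z, meromorphicOrderAt u z ≠ ⊤) (hs : RegularOn u (sphere 0 R))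
    (hz : z ∈ ball (0 : ℂ) R) (hza : AnalyticAt ℂ u z) (hz0 : u z ≠ 0) (j : ℕ) :
    ‖iteratedDeriv j (logDeriv u) z‖ ≤ j.factorial * (8 * R) / ((R - ‖z‖) / 2) ^ j *
        Real.circleAverage (fun ζ => |Real.log ‖u ζ‖| * (‖ζ - z‖ ^ 2)⁻¹) 0 R +
      ∑ a ∈ zerosAndPoles hu R, |(MeromorphicOn.divisor u (ball 0 R) a : ℝ)| *
        (2 * j.factorial * (‖z - a‖ ^ (j + 1))⁻¹) := by
  have hne : ∀ a ∈ zerosAndPoles hu R, z ≠ a := fun a ha => ne_of_mem_zerosAndPoles ha hza hz0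
  have hfactor : ∀ a ∈ zerosAndPoles hu R,
      ContDiffAt ℂ j (logDeriv (Complex.canonicalFactor R a)) z := fun a ha =>
    AnalyticAt.contDiffAt (analyticAt_iteratedDeriv_logDeriv
      (Complex.analyticOnNhd_canonicalFactor R a z (hne a ha))
      (Complex.canonicalFactor_ne_zero (mem_ball_of_mem_zerosAndPoles ha)
        (ball_subset_closedBall hz) (hne a ha)) 0)
  have hev : logDeriv u =ᶠ[𝓝 z] fun w => deriv (herglotzIntegral (fun ζ => Real.log ‖u ζ‖) R) w -
      ∑ a ∈ zerosAndPoles hu R,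
        (MeromorphicOn.divisor u (ball 0 R) a : ℂ) * logDeriv (Complex.canonicalFactor R a) w := by
    filter_upwards [isOpen_ball.mem_nhds hz, hza.eventually_analyticAt,
      hza.continuousAt.eventually_ne hz0] with w hw hwa hw0
    exact logDeriv_eq_herglotzIntegral_sub_sum hu hord hs hw hwa hw0
  rw [hev.iteratedDeriv_eq, iteratedDeriv_fun_sub
      ((analyticOnNhd_herglotzIntegral hs.continuousOn_log_norm).deriv z hz).contDiffAt
      (ContDiffAt.sum fun a ha => contDiffAt_const.mul (hfactor a ha)),
    iteratedDeriv_fun_sum fun a ha => contDiffAt_const.mul (hfactor a ha)]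
  refine (norm_sub_le _ _).trans (add_le_add (norm_iteratedDeriv_deriv_herglotzIntegral_le
    hs.continuousOn_log_norm hz j) ((norm_sum_le _ _).trans (Finset.sum_le_sum fun a ha => ?_)))
  rw [iteratedDeriv_const_mul_field, norm_mul, Complex.norm_intCast]
  gcongr
  exact norm_iteratedDeriv_logDeriv_canonicalFactor_le (mem_ball_of_mem_zerosAndPoles ha) hz
    (hne a ha) j

theorem log_norm_le_circleAverage_poissonKernel_mul (hu : Differentiable ℂ u)
    (hs : ∀ ζ ∈ sphere (0 : ℂ) R, u ζ ≠ 0) (hz : z ∈ ball (0 : ℂ) R) (hz0 : u z ≠ 0) :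
    Real.log ‖u z‖ ≤ Real.circleAverage (fun ζ => poissonKernel 0 z ζ * Real.log ‖u ζ‖) 0 R := by
  have hR : 0 < R := pos_of_mem_ball hz
  have hmero : Meromorphic u := fun w => (hu.analyticAt w).meromorphicAt
  obtain ⟨h, hh, hh0, hnorm, hprod⟩ := exists_nonvanishing_factor hR hmero
    (meromorphicOrderAt_ne_top_of_differentiable hu ⟨z, hz0⟩)
    fun ζ hζ => ⟨hu.analyticAt ζ, hs ζ hζ⟩
  have hnorm_le : ‖u z‖ ≤ ‖h z‖ := by
    rw [hprod z (ball_subset_closedBall hz) (hu.analyticAt z) hz0, norm_mul, norm_prod]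
    refine le_mul_of_one_le_left (norm_nonneg _) (Finset.one_le_prod fun a ha => ?_)
    have hdiv : 0 ≤ MeromorphicOn.divisor u (ball 0 R) a :=
      MeromorphicOn.AnalyticOnNhd.divisor_nonneg (fun w _ => hu.analyticAt w) a
    lift MeromorphicOn.divisor u (ball 0 R) a to ℕ using hdiv with e
    rw [zpow_natCast, norm_pow]
    exact one_le_pow₀ (one_le_norm_canonicalFactor (mem_ball_of_mem_zerosAndPoles ha) hz
      (ne_of_mem_zerosAndPoles ha (hu.analyticAt z) hz0))
  have hpoisson : Real.circleAverage (poissonKernel 0 z • fun ζ => Real.log ‖h ζ‖) 0 R =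
      Real.log ‖h z‖ :=
    InnerProductSpace.HarmonicOnNhd.circleAverage_poissonKernel_smul
      (fun w hw => (hh w hw).harmonicAt_log_norm (hh0 w hw)) hz
  refine (Real.log_le_log (norm_pos_iff.2 hz0) hnorm_le).trans (hpoisson.symm.trans ?_).le
  refine Real.circleAverage_congr_sphere fun ζ hζ => ?_
  simp only [Pi.smul_apply', smul_eq_mul, hnorm ζ (abs_of_pos hR ▸ hζ)]

end PoissonJensen

theorem rpow_sum_le_sum_rpow {ι : Type*} (s : Finset ι) {f : ι → ℝ} {p : ℝ} (hp0 : 0 < p)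
    (hp1 : p ≤ 1) (hf : ∀ i ∈ s, 0 ≤ f i) : (∑ i ∈ s, f i) ^ p ≤ ∑ i ∈ s, f i ^ p :=
  Finset.le_sum_of_subadditive_on_pred (· ^ p) (0 ≤ ·) (Real.zero_rpow hp0.ne').le
    (fun _ _ hx hy => Real.rpow_add_le_add_rpow hx hy hp0.le hp1) (fun _ _ => add_nonneg) f hf

theorem rpow_mul_inv_pow_le {c t α : ℝ} (hc : c = 0 ∨ 1 ≤ c) (ht : 0 ≤ t) (hα0 : 0 < α)
    (j : ℕ) (hαj : α ≤ j + 1) : (c * (t ^ (j + 1))⁻¹) ^ (α / (j + 1)) ≤ c * t ^ (-α) := by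
  have hβ0 : 0 < α / (j + 1) := by positivity
  rcases hc with rfl | hc
  · rw [zero_mul, zero_mul, Real.zero_rpow hβ0.ne']
  have hpow : ((t ^ (j + 1))⁻¹) ^ (α / (j + 1)) = t ^ (-α) := by
    rw [Real.inv_rpow (by positivity), ← Real.rpow_natCast, ← Real.rpow_mul ht, Real.rpow_neg ht,
      Nat.cast_succ, mul_div_cancel₀ _ (by positivity)]
  rw [Real.mul_rpow (by linarith) (by positivity), hpow]
  gcongr
  exact Real.rpow_le_self_of_one_le hc ((div_le_one (by positivity)).2 hαj)

theorem log_one_add_le_of_rpow_le {x y β M : ℝ} (hβ0 : 0 < β) (hβ1 : β ≤ 1) (hx : 0 ≤ x)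
    (hxy : x ^ β ≤ y) (hM : 0 ≤ M) :
    Real.log (1 + x) ≤ β⁻¹ * (Real.log (1 + M) + (y - M) / (1 + M)) := by
  have hy : 0 ≤ y := (Real.rpow_nonneg hx _).trans hxy
  have hpow : (1 + x) ^ β ≤ 1 + y := by
    refine (Real.rpow_add_le_add_rpow zero_le_one hx hβ0.le hβ1).trans ?_
    rw [Real.one_rpow]
    gcongr
  have htangent : Real.log (1 + y) ≤ Real.log (1 + M) + (y - M) / (1 + M) := by
    have hlog := Real.log_le_sub_one_of_pos (x := (1 + y) / (1 + M)) (by positivity)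
    rw [Real.log_div (by positivity) (by positivity), div_sub_one (by positivity),
      add_sub_add_left_eq_sub] at hlog
    linarith
  rw [← div_eq_inv_mul, le_div_iff₀ hβ0, mul_comm, ← Real.log_rpow (by positivity)]
  exact (Real.log_le_log (by positivity) hpow).trans htangent

theorem circleAverage_log_one_add_le {x y : ℂ → ℝ} {c : ℂ} {β r M : ℝ} (hβ0 : 0 < β)
    (hβ1 : β ≤ 1) (hx : ∀ z ∈ sphere c |r|, 0 ≤ x z) (hxy : ∀ z ∈ sphere c |r|, x z ^ β ≤ y z)
    (hxi : CircleIntegrable (fun z => Real.log (1 + x z)) c r) (hyi : CircleIntegrable y c r)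
    (hM0 : 0 ≤ M) (hM : Real.circleAverage y c r ≤ M) :
    Real.circleAverage (fun z => Real.log (1 + x z)) c r ≤ β⁻¹ * Real.log (1 + M) := by
  have hpoint : ∀ z ∈ sphere c |r|, Real.log (1 + x z) ≤
      β⁻¹ * (Real.log (1 + M) - M / (1 + M)) + (β⁻¹ * (1 + M)⁻¹) • y z := fun z hz => by
    refine (log_one_add_le_of_rpow_le hβ0 hβ1 (hx z hz) (hxy z hz) hM0).trans_eq ?_
    rw [smul_eq_mul]
    ring
  have hyi' : CircleIntegrable (fun z => (β⁻¹ * (1 + M)⁻¹) • y z) c r := hyi.const_fun_smul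
  calc Real.circleAverage (fun z => Real.log (1 + x z)) c r
      ≤ Real.circleAverage (fun z => β⁻¹ * (Real.log (1 + M) - M / (1 + M)) +
          (β⁻¹ * (1 + M)⁻¹) • y z) c r :=
        Real.circleAverage_mono hxi ((circleIntegrable_const _ _ _).add hyi') hpoint
    _ = β⁻¹ * (Real.log (1 + M) - M / (1 + M)) + β⁻¹ * (1 + M)⁻¹ * Real.circleAverage y c r := by
        rw [Real.circleAverage_fun_add (circleIntegrable_const _ _ _) hyi',
          Real.circleAverage_const, Real.circleAverage_fun_smul, smul_eq_mul]
    _ ≤ β⁻¹ * (Real.log (1 + M) - M / (1 + M)) + β⁻¹ * (1 + M)⁻¹ * M := by gcongr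
    _ = β⁻¹ * Real.log (1 + M) := by ring

section LogDerivative

variable {u : ℂ → ℂ} {r R α : ℝ} {j : ℕ}

/-- A majorant on the circle `|z| = r` of the power `α / (j + 1)` of the `j`-th derivative of
`u' / u`, read off from the Poisson–Jensen formula on the ball of radius `R`. -/
noncomputable def logDerivMajorant (hu : Meromorphic u) (j : ℕ) (α r R : ℝ) (z : ℂ) : ℝ :=
  1 + (j.factorial * (8 * R) / ((R - r) / 2) ^ j) •
      Real.circleAverage (fun ζ => |Real.log ‖u ζ‖| * (‖ζ - z‖ ^ 2)⁻¹) 0 R +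
    ∑ a ∈ zerosAndPoles hu R,
      (|(MeromorphicOn.divisor u (ball 0 R) a : ℝ)| * (2 * j.factorial)) • ‖z - a‖ ^ (-α)

theorem abs_divisor_mul_factorial_eq_zero_or_one_le (s : Set ℂ) (a : ℂ) :
    |(MeromorphicOn.divisor u s a : ℝ)| * (2 * j.factorial) = 0 ∨
      1 ≤ |(MeromorphicOn.divisor u s a : ℝ)| * (2 * j.factorial) := by
  rcases eq_or_ne (MeromorphicOn.divisor u s a) 0 with h | h
  · exact Or.inl (by rw [h, Int.cast_zero, abs_zero, zero_mul])
  · have hdiv : (1 : ℝ) ≤ |(MeromorphicOn.divisor u s a : ℝ)| := by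
      exact_mod_cast Int.one_le_abs h
    have hfac : (1 : ℝ) ≤ j.factorial := by exact_mod_cast j.factorial_pos
    exact Or.inr (one_le_mul_of_one_le_of_one_le hdiv (by linarith))

theorem rpow_norm_iteratedDeriv_logDeriv_le (hu : Meromorphic u)
    (hord : ∀ z, meromorphicOrderAt u z ≠ ⊤) (hsr : RegularOn u (sphere 0 r))
    (hsR : RegularOn u (sphere 0 R)) (hrR : r < R) (hα0 : 0 < α) (hαj : α ≤ j + 1) {z : ℂ}
    (hz : z ∈ sphere (0 : ℂ) r) :
    ‖iteratedDeriv j (logDeriv u) z‖ ^ (α / (j + 1)) ≤ logDerivMajorant hu j α r R z := by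
  have hzr : ‖z‖ = r := mem_sphere_zero_iff_norm.1 hz
  have hzR : z ∈ ball (0 : ℂ) R := mem_ball_zero_iff.2 (hzr.trans_lt hrR)
  have hR : 0 < R := pos_of_mem_ball hzR
  have : 0 < R - r := sub_pos.2 hrR
  have hβ0 : 0 < α / (j + 1) := by positivity
  have hβ1 : α / (j + 1) ≤ 1 := (div_le_one (by positivity)).2 hαj
  have hle_one_add : ∀ t : ℝ, 0 ≤ t → t ^ (α / (j + 1)) ≤ 1 + t := fun t ht => by
    rcases le_total t 1 with h | h
    · linarith [Real.rpow_le_one ht h hβ0.le]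
    · linarith [Real.rpow_le_self_of_one_le h hβ1]
  have havg : 0 ≤ Real.circleAverage (fun ζ => |Real.log ‖u ζ‖| * (‖ζ - z‖ ^ 2)⁻¹) 0 R :=
    Real.circleAverage_nonneg_of_nonneg fun ζ _ => by positivity
  have hbound := norm_iteratedDeriv_logDeriv_le hu hord hsR hzR (hsr z hz).1 (hsr z hz).2 j
  rw [hzr] at hbound
  refine (Real.rpow_le_rpow (norm_nonneg _) hbound hβ0.le).trans ((Real.rpow_add_le_add_rpow
    (by positivity) (Finset.sum_nonneg fun a _ => by positivity) hβ0.le hβ1).trans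
    (add_le_add (hle_one_add _ (by positivity)) ((rpow_sum_le_sum_rpow _ hβ0 hβ1
      fun a _ => by positivity).trans (Finset.sum_le_sum fun a _ => ?_))))
  rw [← mul_assoc, smul_eq_mul]
  exact rpow_mul_inv_pow_le (abs_divisor_mul_factorial_eq_zero_or_one_le _ a) (norm_nonneg _) hα0 j
    hαj

theorem norm_ne_of_mem_zerosAndPoles {hu : Meromorphic u} (hsr : RegularOn u (sphere 0 r)) {a : ℂ}
    (ha : a ∈ zerosAndPoles hu R) : ‖a‖ ≠ r := fun har => by
  obtain ⟨hana, hne⟩ := hsr a (mem_sphere_zero_iff_norm.2 har)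
  exact ne_of_mem_zerosAndPoles ha hana hne rfl

theorem circleIntegrable_logDerivMajorant_terms (hu : Meromorphic u)
    (hsr : RegularOn u (sphere 0 r)) (hsR : RegularOn u (sphere 0 R)) (hr : 0 ≤ r) (hrR : r < R) :
    CircleIntegrable (fun z => 1 + (j.factorial * (8 * R) / ((R - r) / 2) ^ j) •
      Real.circleAverage (fun ζ => |Real.log ‖u ζ‖| * (‖ζ - z‖ ^ 2)⁻¹) 0 R) 0 r ∧
    ∀ a ∈ zerosAndPoles hu R, CircleIntegrable (fun z =>
      (|(MeromorphicOn.divisor u (ball 0 R) a : ℝ)| * (2 * j.factorial)) • ‖z - a‖ ^ (-α)) 0 r :=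
  ⟨(circleIntegrable_const (1 : ℝ) 0 r).add
    (circleIntegrable_circleAverage_mul_inv_norm_sub_sq hr hrR
      hsR.continuousOn_log_norm.abs).const_fun_smul,
    fun _ ha => (circleIntegrable_norm_sub_rpow hr
      (norm_ne_of_mem_zerosAndPoles hsr ha) _).const_fun_smul⟩

theorem circleIntegrable_logDerivMajorant (hu : Meromorphic u)
    (hsr : RegularOn u (sphere 0 r)) (hsR : RegularOn u (sphere 0 R)) (hr : 0 ≤ r) (hrR : r < R) :
    CircleIntegrable (logDerivMajorant hu j α r R) 0 r :=
  have hterms := circleIntegrable_logDerivMajorant_terms (α := α) (j := j) hu hsr hsR hr hrR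
  hterms.1.add (CircleIntegrable.fun_sum _ hterms.2)

theorem circleAverage_logDerivMajorant_le {K : ℝ} (hK : ∀ a : ℂ, ‖a‖ ≠ r →
      Real.circleAverage (fun z => ‖z - a‖ ^ (-α)) 0 r ≤ K * r ^ (-α)) (hu : Meromorphic u)
    (hsr : RegularOn u (sphere 0 r)) (hsR : RegularOn u (sphere 0 R)) (hr : 0 ≤ r) (hrR : r < R) :
    Real.circleAverage (logDerivMajorant hu j α r R) 0 r ≤
      1 + j.factorial * (8 * R) / ((R - r) / 2) ^ j * ((R ^ 2 - r ^ 2)⁻¹ *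
          Real.circleAverage (fun z => |Real.log ‖u z‖|) 0 R) +
        2 * j.factorial * K * (∑ a ∈ zerosAndPoles hu R,
          |(MeromorphicOn.divisor u (ball 0 R) a : ℝ)|) * r ^ (-α) := by
  have hlog : ContinuousOn (fun z => |Real.log ‖u z‖|) (sphere 0 R) :=
    hsR.continuousOn_log_norm.abs
  obtain ⟨hconst, hterm⟩ :=
    circleIntegrable_logDerivMajorant_terms (α := α) (j := j) hu hsr hsR hr hrR
  calc Real.circleAverage (logDerivMajorant hu j α r R) 0 r
      = 1 + j.factorial * (8 * R) / ((R - r) / 2) ^ j * ((R ^ 2 - r ^ 2)⁻¹ *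
          Real.circleAverage (fun z => |Real.log ‖u z‖|) 0 R) +
        ∑ a ∈ zerosAndPoles hu R, |(MeromorphicOn.divisor u (ball 0 R) a : ℝ)| *
          (2 * j.factorial) * Real.circleAverage (fun z => ‖z - a‖ ^ (-α)) 0 r := by
        unfold logDerivMajorant
        rw [Real.circleAverage_fun_add hconst (CircleIntegrable.fun_sum _ hterm),
          Real.circleAverage_fun_add (circleIntegrable_const _ _ _)
            (circleIntegrable_circleAverage_mul_inv_norm_sub_sq hr hrR hlog).const_fun_smul,
          Real.circleAverage_const, Real.circleAverage_fun_smul, smul_eq_mul,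
          circleAverage_circleAverage_mul_inv_norm_sub_sq hr hrR hlog,
          Real.circleAverage_fun_sum hterm]
        exact congrArg _ (Finset.sum_congr rfl fun a _ => Real.circleAverage_fun_smul)
    _ ≤ _ := by
        rw [mul_assoc (2 * _ * K), Finset.sum_mul, Finset.mul_sum]
        refine add_le_add_right (Finset.sum_le_sum fun a ha => ?_) _
        refine (mul_le_mul_of_nonneg_left (hK a (norm_ne_of_mem_zerosAndPoles hsr ha))
          (by positivity)).trans_eq ?_
        ring

theorem factorial_mul_div_half_pow_mul_inv_le (j : ℕ) (hr : 0 ≤ r) (hrR : r < R) :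
    j.factorial * (8 * R) / ((R - r) / 2) ^ j * (R ^ 2 - r ^ 2)⁻¹ ≤
      8 * 2 ^ j * j.factorial * ((R - r) ^ (j + 1))⁻¹ := by
  have hR : 0 < R := hr.trans_lt hrR
  have : 0 < R - r := sub_pos.2 hrR
  have heq : j.factorial * (8 * R) / ((R - r) / 2) ^ j * (R ^ 2 - r ^ 2)⁻¹ =
      8 * 2 ^ j * j.factorial * ((R - r) ^ (j + 1))⁻¹ * (R / (R + r)) := by
    rw [sq_sub_sq, div_pow]
    field_simp
    ring
  rw [heq]
  exact mul_le_of_le_one_right (by positivity) ((div_le_one (by positivity)).2 (by linarith))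

theorem exists_circleAverage_log_iteratedDeriv_logDeriv_le (j : ℕ) (hα0 : 0 < α) (hα1 : α < 1) :
    ∃ C : ℝ, 0 ≤ C ∧ ∀ (u : ℂ → ℂ) (r R : ℝ) (hu : Meromorphic u), 0 < r → r < R →
      (∀ z, meromorphicOrderAt u z ≠ ⊤) → RegularOn u (sphere 0 r) → RegularOn u (sphere 0 R) →
      Real.circleAverage (fun z => Real.log (1 + ‖iteratedDeriv j (logDeriv u) z‖)) 0 r ≤
        (j + 1) / α * Real.log (2 + C *
          (∑ a ∈ zerosAndPoles hu R, |(MeromorphicOn.divisor u (ball 0 R) a : ℝ)|) * r ^ (-α) +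
          C * ((R - r) ^ (j + 1))⁻¹ * Real.circleAverage (fun z => |Real.log ‖u z‖|) 0 R) := by
  obtain ⟨K, hK0, hK⟩ := exists_circleAverage_norm_sub_rpow_neg_le hα0.le hα1
  have hαj : α ≤ j + 1 := by linarith [j.cast_nonneg (α := ℝ)]
  refine ⟨2 * j.factorial * K + 8 * 2 ^ j * j.factorial, by positivity,
    fun u r R hu hr hrR hord hsr hsR => ?_⟩
  have : 0 < R - r := sub_pos.2 hrR
  have hlog : 0 ≤ Real.circleAverage (fun z => |Real.log ‖u z‖|) 0 R :=
    Real.circleAverage_nonneg_of_nonneg fun z _ => abs_nonneg _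
  have hcont : ContinuousOn (fun z => Real.log (1 + ‖iteratedDeriv j (logDeriv u) z‖))
      (sphere 0 r) :=
    (continuousOn_const.add (hsr.continuousOn_iteratedDeriv_logDeriv j).norm).log
      fun z _ => (add_pos_of_pos_of_nonneg one_pos (norm_nonneg _)).ne'
  have htwo : ∀ x y : ℝ, 2 + x + y = 1 + (1 + y + x) := fun x y => by ring
  rw [← inv_div, htwo]
  refine circleAverage_log_one_add_le (by positivity) ((div_le_one (by positivity)).2 hαj)
    (fun _ _ => norm_nonneg _) (fun z hz => rpow_norm_iteratedDeriv_logDeriv_le hu hord hsr hsR hrR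
      hα0 hαj (abs_of_pos hr ▸ hz)) (hcont.circleIntegrable hr.le)
    (circleIntegrable_logDerivMajorant hu hsr hsR hr.le hrR) (by positivity)
    ((circleAverage_logDerivMajorant_le (hK r · hr) hu hsr hsR hr.le hrR).trans ?_)
  rw [← mul_assoc]
  refine add_le_add (add_le_add_right (mul_le_mul_of_nonneg_right
    ((factorial_mul_div_half_pow_mul_inv_le j hr.le hrR).trans ?_) hlog) _) ?_
  · gcongr
    exact le_add_of_nonneg_left (by positivity)
  · gcongr
    exact le_add_of_nonneg_right (by positivity)

end LogDerivative

/-! ### Order functions and counting functions -/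

theorem exists_norm_apply_eq_norm {ι E : Type*} [Fintype ι] [Nonempty ι] [SeminormedAddCommGroup E]
    (v : ι → E) : ∃ i, ‖v i‖ = ‖v‖ := by
  obtain ⟨i, hi⟩ := Finite.exists_max fun i => ‖v i‖
  exact ⟨i, le_antisymm (norm_le_pi_norm v i) ((pi_norm_le_iff_of_nonneg (norm_nonneg _)).2 hi)⟩

theorem countable_norm_image_zeros {h : ℂ → ℂ} (hd : Differentiable ℂ h) (h0 : ∃ z, h z ≠ 0) :
    (norm '' {z | h z = 0}).Countable := by
  simpa only [not_not] using countable_norm_image_setOf_not (eventually_nhdsNE_ne_zero hd h0)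

theorem continuous_log_norm {X E : Type*} [TopologicalSpace X] [NormedAddCommGroup E] {F : X → E}
    (hF : Continuous F) (hF0 : ∀ z, F z ≠ 0) :
    Continuous fun z => Real.log ‖F z‖ :=
  hF.norm.log fun z => norm_ne_zero_iff.2 (hF0 z)

theorem circleIntegrable_log_norm {E : Type*} [NormedAddCommGroup E] {F : ℂ → E}
    (hF : Continuous F) (hF0 : ∀ z, F z ≠ 0) (r : ℝ) :
    CircleIntegrable (fun z => Real.log ‖F z‖) 0 r :=
  ((continuous_log_norm hF hF0).comp (continuous_circleMap 0 r)).intervalIntegrable _ _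

section OrderFunction

variable {n : ℕ} {F : ℂ → Fin (n + 1) → ℂ} {r R : ℝ}

theorem orderFunction_eq_circleAverage (F : ℂ → Fin (n + 1) → ℂ) (r : ℝ) :
    orderFunction F r = Real.circleAverage (fun z => Real.log ‖F z‖) 0 r := rfl

theorem log_norm_le_circleAverage_mul_inv_norm_sub_sq (hF : Differentiable ℂ F)
    (hF0 : ∀ z, F z ≠ 0) (hreg : ∀ i, (∃ z, F z i ≠ 0) → ∀ ζ ∈ sphere 0 R, F ζ i ≠ 0) {z : ℂ}
    (hz : z ∈ ball (0 : ℂ) R) :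
    Real.log ‖F z‖ ≤ (R ^ 2 - ‖z‖ ^ 2) *
      Real.circleAverage (fun ζ => Real.log ‖F ζ‖ * (‖ζ - z‖ ^ 2)⁻¹) 0 R := by
  have hR : 0 < R := pos_of_mem_ball hz
  obtain ⟨i, hi⟩ := exists_norm_apply_eq_norm (F z)
  have hzi : F z i ≠ 0 := norm_ne_zero_iff.1 (hi ▸ norm_ne_zero_iff.2 (hF0 z))
  have hsi := hreg i ⟨z, hzi⟩
  have hFi : Differentiable ℂ fun z => F z i := differentiable_pi.1 hF i
  have hz2 : 0 ≤ R ^ 2 - ‖z‖ ^ 2 := by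
    have := mem_ball_zero_iff.1 hz
    nlinarith [norm_nonneg z]
  calc Real.log ‖F z‖ = Real.log ‖F z i‖ := by rw [hi]
    _ ≤ Real.circleAverage (fun ζ => poissonKernel 0 z ζ * Real.log ‖F ζ i‖) 0 R :=
        log_norm_le_circleAverage_poissonKernel_mul hFi hsi hz hzi
    _ = (R ^ 2 - ‖z‖ ^ 2) *
        Real.circleAverage (fun ζ => Real.log ‖F ζ i‖ * (‖ζ - z‖ ^ 2)⁻¹) 0 R :=
        circleAverage_poissonKernel_mul_eq
    _ ≤ _ := by
        refine mul_le_mul_of_nonneg_left (Real.circleAverage_mono ?_ ?_ fun ζ hζ => ?_) hz2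
        · exact (continuousOn_mul_inv_norm_sub_sq hz (hFi.continuous.continuousOn.norm.log
            fun ζ hζ => norm_ne_zero_iff.2 (hsi ζ hζ))).circleIntegrable hR.le
        · exact (continuousOn_mul_inv_norm_sub_sq hz
            (continuous_log_norm hF.continuous hF0).continuousOn).circleIntegrable hR.le
        · rw [abs_of_pos hR] at hζ
          have := norm_pos_iff.2 (hsi ζ hζ)
          gcongr
          exact norm_le_pi_norm _ _

theorem orderFunction_le_of_regular (hF : Differentiable ℂ F) (hF0 : ∀ z, F z ≠ 0) (hr : 0 ≤ r)
    (hrR : r < R) (hreg : ∀ i, (∃ z, F z i ≠ 0) → ∀ ζ ∈ sphere 0 R, F ζ i ≠ 0) :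
    orderFunction F r ≤ orderFunction F R := by
  have hlog : ContinuousOn (fun z => Real.log ‖F z‖) (sphere 0 R) :=
    (continuous_log_norm hF.continuous hF0).continuousOn
  have hsub : R ^ 2 - r ^ 2 ≠ 0 := by nlinarith
  calc orderFunction F r
      ≤ Real.circleAverage (fun z => (R ^ 2 - r ^ 2) *
          Real.circleAverage (fun ζ => Real.log ‖F ζ‖ * (‖ζ - z‖ ^ 2)⁻¹) 0 R) 0 r := by
        refine Real.circleAverage_mono (circleIntegrable_log_norm hF.continuous hF0 r)
          (circleIntegrable_circleAverage_mul_inv_norm_sub_sq hr hrR hlog).const_fun_smul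
          fun z hz => ?_
        have hzr : ‖z‖ = r := by simpa [abs_of_nonneg hr] using hz
        rw [← hzr] at hrR ⊢
        exact log_norm_le_circleAverage_mul_inv_norm_sub_sq hF hF0 hreg (mem_ball_zero_iff.2 hrR)
    _ = orderFunction F R := by
        simp only [← smul_eq_mul (R ^ 2 - r ^ 2)]
        rw [Real.circleAverage_fun_smul,
          circleAverage_circleAverage_mul_inv_norm_sub_sq hr hrR hlog, smul_eq_mul,
          mul_inv_cancel_left₀ hsub, orderFunction_eq_circleAverage]

theorem orderFunction_le_of_le (hF : Differentiable ℂ F) (hF0 : ∀ z, F z ≠ 0) (hr : 0 ≤ r)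
    (hrR : r ≤ R) : orderFunction F r ≤ orderFunction F R := by
  rcases hrR.eq_or_lt with rfl | hlt
  · rfl
  have hcountable : (⋃ i ∈ {i | ∃ z, F z i ≠ 0}, norm '' {z | F z i = 0}).Countable :=
    (Set.to_countable _).biUnion fun i hi =>
      countable_norm_image_zeros (differentiable_pi.1 hF i) hi
  have hcont : Continuous (orderFunction F) :=
    Real.Continuous.circleAverage (continuous_log_norm hF.continuous hF0)
  by_contra! hcon
  obtain ⟨ρ, hρ, hlt', hrρ⟩ := ((mem_closure_iff_frequently.1
    (hcountable.dense_compl ℝ R)).and_eventually ((hcont.continuousAt.eventually_lt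
      continuousAt_const hcon).and (eventually_gt_nhds hlt))).exists
  refine hlt'.not_ge (orderFunction_le_of_regular hF hF0 hr hrρ fun i hi ζ hζ h0 => hρ ?_)
  exact Set.mem_biUnion hi ⟨ζ, h0, mem_sphere_zero_iff_norm.1 hζ⟩

end OrderFunction

section Borel

variable {τ : ℝ → ℝ}

theorem sub_le_inv_pow_of_growth (hmono : MonotoneOn τ (Set.Ici 1)) {k : ℕ} {x y : ℝ}
    (hx : 1 ≤ x) (hgrow : 2 * τ x < τ (x + (τ x)⁻¹)) (hkx : 2 ^ k ≤ τ x) (hyk : τ y < 2 ^ (k + 1)) :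
    y - x ≤ (2 ^ k)⁻¹ := by
  by_contra! hcon
  have hinv : (τ x)⁻¹ ≤ (2 ^ k)⁻¹ := inv_anti₀ (by positivity) hkx
  have hinv0 : 0 < (τ x)⁻¹ := inv_pos.2 (lt_of_lt_of_le (by positivity) hkx)
  have hle : τ (x + (τ x)⁻¹) ≤ τ y :=
    hmono (Set.mem_Ici.2 (by linarith)) (Set.mem_Ici.2 (by linarith)) (by linarith)
  rw [pow_succ] at hyk
  linarith

theorem volume_setOf_growth_gt_le (hmono : MonotoneOn τ (Set.Ici 1)) (k : ℕ) :
    volume {r | 1 ≤ r ∧ 2 * τ r < τ (r + (τ r)⁻¹) ∧ 2 ^ k ≤ τ r ∧ τ r < 2 ^ (k + 1)} ≤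
      ENNReal.ofReal ((1 / 2 : ℝ) ^ k) := by
  rw [one_div, inv_pow]
  refine (Real.volume_le_diam _).trans (Metric.ediam_le ?_)
  rintro x ⟨hx, hx_grow, hkx, hxk⟩ y ⟨hy, hy_grow, hky, hyk⟩
  rw [edist_dist, Real.dist_eq]
  exact ENNReal.ofReal_le_ofReal (abs_sub_le_iff.2
    ⟨sub_le_inv_pow_of_growth hmono hy hy_grow hky hxk,
      sub_le_inv_pow_of_growth hmono hx hx_grow hkx hyk⟩)

theorem exists_measure_lt_top_forall_growth_le (hτ1 : ∀ r, 1 ≤ τ r)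
    (hmono : MonotoneOn τ (Set.Ici 1)) :
    ∃ E : Set ℝ, volume E < ⊤ ∧ ∀ r, 1 ≤ r → r ∉ E → τ (r + (τ r)⁻¹) ≤ 2 * τ r := by
  refine ⟨⋃ k : ℕ, {r | 1 ≤ r ∧ 2 * τ r < τ (r + (τ r)⁻¹) ∧ 2 ^ k ≤ τ r ∧ τ r < 2 ^ (k + 1)},
    ?_, fun r hr hrE => ?_⟩
  · refine ((measure_iUnion_le _).trans
      (ENNReal.tsum_le_tsum (volume_setOf_growth_gt_le hmono))).trans_lt ?_
    rw [← ENNReal.ofReal_tsum_of_nonneg (fun k => by positivity) summable_geometric_two]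
    exact ENNReal.ofReal_lt_top
  · by_contra! hcon
    obtain ⟨k, hk1, hk2⟩ := exists_nat_pow_near (hτ1 r) one_lt_two
    exact hrE (Set.mem_iUnion.2 ⟨k, hr, hcon, hk1, hk2⟩)

end Borel

section Jensen

variable {u h : ℂ → ℂ} {r R : ℝ}

theorem log_div_max_one_nonneg (hr : 1 ≤ r) {x : ℝ} (hx : x ≤ r) : 0 ≤ Real.log (r / max 1 x) :=
  Real.log_nonneg ((one_le_div (by positivity)).2 (max_le hr hx))

theorem untop₀_meromorphicOrderAt_eq_zero_of_notMem (hu : Meromorphic u) {a : ℂ} (ha : ‖a‖ < r)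
    (hs : a ∉ zerosAndPoles hu r) : (meromorphicOrderAt u a).untop₀ = 0 := by
  rw [mem_zerosAndPoles, not_not,
    MeromorphicOn.divisor_apply hu.meromorphicOn (mem_ball_zero_iff.2 ha)] at hs
  exact hs

theorem circleAverage_log_norm_eq_sum (hu : Meromorphic u) {ρ : ℝ} (hρ : 0 < ρ) (hρr : ρ ≤ r) :
    Real.circleAverage (fun z => Real.log ‖u z‖) 0 ρ =
      ∑ a ∈ zerosAndPoles hu r, ((meromorphicOrderAt u a).untop₀ : ℝ) *
          (if ‖a‖ < ρ then Real.log (ρ * ‖a‖⁻¹) else 0) +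
        (meromorphicOrderAt u 0).untop₀ * Real.log ρ +
        Real.log ‖meromorphicTrailingCoeffAt u 0‖ := by
  have hterm : ∀ a, MeromorphicOn.divisor u (closedBall 0 ρ) a * Real.log (ρ * ‖a‖⁻¹) =
      ((meromorphicOrderAt u a).untop₀ : ℝ) *
        (if ‖a‖ < ρ then Real.log (ρ * ‖a‖⁻¹) else 0) := by
    intro a
    rcases lt_trichotomy ‖a‖ ρ with ha | ha | ha
    · rw [MeromorphicOn.divisor_apply hu.meromorphicOn (by simpa using ha.le), if_pos ha]
    · rw [ha, mul_inv_cancel₀ hρ.ne']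
      simp
    · rw [Function.locallyFinsuppWithin.apply_eq_zero_of_notMem _ (by simpa using ha),
        if_neg ha.not_gt]
      simp
  rw [MeromorphicOn.circleAverage_log_norm hρ.ne' hu.meromorphicOn, abs_of_pos hρ,
    MeromorphicOn.divisor_apply hu.meromorphicOn (by simpa using hρ.le)]
  simp only [zero_sub, norm_neg, hterm]
  rw [finsum_eq_sum_of_support_subset]
  intro a ha
  by_contra hmem
  refine ha ?_
  by_cases haρ : ‖a‖ < ρ
  · simp [untop₀_meromorphicOrderAt_eq_zero_of_notMem hu (haρ.trans_le hρr) hmem]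
  · simp [haρ]

theorem circleAverage_log_norm_sub_eq_sum (hu : Meromorphic u) (hr : 1 ≤ r) :
    Real.circleAverage (fun z => Real.log ‖u z‖) 0 r -
      Real.circleAverage (fun z => Real.log ‖u z‖) 0 1 =
    ∑ a ∈ zerosAndPoles hu r,
      ((meromorphicOrderAt u a).untop₀ : ℝ) * Real.log (r / max 1 ‖a‖) := by
  have hr0 : 0 < r := by linarith
  have hzero : ((meromorphicOrderAt u 0).untop₀ : ℝ) * Real.log r = ∑ a ∈ zerosAndPoles hu r,
      if a = 0 then ((meromorphicOrderAt u a).untop₀ : ℝ) * Real.log r else 0 := by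
    rw [Finset.sum_ite_eq']
    split_ifs with h
    · rfl
    · simp [untop₀_meromorphicOrderAt_eq_zero_of_notMem hu (by simpa using hr0) h]
  rw [circleAverage_log_norm_eq_sum hu hr0 le_rfl, circleAverage_log_norm_eq_sum hu one_pos hr,
    hzero, Real.log_one, mul_zero, add_zero, add_sub_add_right_eq_sub, ← Finset.sum_add_distrib,
    ← Finset.sum_sub_distrib]
  refine Finset.sum_congr rfl fun a ha => ?_
  rw [if_pos (mem_ball_zero_iff.1 (mem_ball_of_mem_zerosAndPoles ha)), one_mul]
  rcases eq_or_ne a 0 with rfl | ha0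
  · simp
  · have : 0 < ‖a‖ := norm_pos_iff.2 ha0
    rw [if_neg ha0]
    rcases lt_or_ge ‖a‖ 1 with h1 | h1
    · rw [if_pos h1, max_eq_left h1.le, div_one, Real.log_mul hr0.ne' (by positivity)]
      ring
    · rw [if_neg h1.not_gt, max_eq_right h1, div_eq_mul_inv]
      ring

theorem untop₀_meromorphicOrderAt_nonneg {a : ℂ} (ha : AnalyticAt ℂ h a) :
    (0 : ℝ) ≤ (meromorphicOrderAt h a).untop₀ :=
  mod_cast WithTop.untop₀_nonneg.2 ha.meromorphicOrderAt_nonneg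

theorem meromorphic_of_differentiable (hd : Differentiable ℂ h) : Meromorphic h :=
  fun z => (hd.analyticAt z).meromorphicAt

theorem circleAverage_log_norm_one_le (hd : Differentiable ℂ h) (hr : 1 ≤ r) :
    Real.circleAverage (fun z => Real.log ‖h z‖) 0 1 ≤
      Real.circleAverage (fun z => Real.log ‖h z‖) 0 r := by
  rw [← sub_nonneg, circleAverage_log_norm_sub_eq_sum (meromorphic_of_differentiable hd) hr]
  exact Finset.sum_nonneg fun a ha => mul_nonneg
    (untop₀_meromorphicOrderAt_nonneg (hd.analyticAt a))
    (log_div_max_one_nonneg hr (mem_ball_zero_iff.1 (mem_ball_of_mem_zerosAndPoles ha)).le)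

theorem sum_meromorphicOrderAt_mul_le (hd : Differentiable ℂ h) (hr : 1 ≤ r) (hrR : r < R)
    {s : Finset ℂ} (hs : ∀ a ∈ s, ‖a‖ < r) :
    (∑ a ∈ s, ((meromorphicOrderAt h a).untop₀ : ℝ)) * ((R - r) / R) ≤
      Real.circleAverage (fun z => Real.log ‖h z‖) 0 R -
        Real.circleAverage (fun z => Real.log ‖h z‖) 0 1 := by
  classical
  have hm := meromorphic_of_differentiable hd
  have hr0 : 0 < r := by linarith
  have hR0 : 0 < R := hr0.trans hrR
  have hord : ∀ a, (0 : ℝ) ≤ (meromorphicOrderAt h a).untop₀ := fun a =>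
    untop₀_meromorphicOrderAt_nonneg (hd.analyticAt a)
  have hlog : (R - r) / R ≤ Real.log (R / r) := by
    refine le_trans (le_of_eq ?_) (Real.one_sub_inv_le_log_of_pos (div_pos hR0 hr0))
    field_simp
  rw [circleAverage_log_norm_sub_eq_sum hm (hr.trans hrR.le), Finset.sum_mul]
  calc ∑ a ∈ s, ((meromorphicOrderAt h a).untop₀ : ℝ) * ((R - r) / R)
      ≤ ∑ a ∈ s, ((meromorphicOrderAt h a).untop₀ : ℝ) * Real.log (R / max 1 ‖a‖) := by
        refine Finset.sum_le_sum fun a ha => mul_le_mul_of_nonneg_left (hlog.trans ?_) (hord a)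
        have := hs a ha
        gcongr
        exact max_le hr this.le
    _ ≤ ∑ a ∈ s ∪ zerosAndPoles hm R,
          ((meromorphicOrderAt h a).untop₀ : ℝ) * Real.log (R / max 1 ‖a‖) := by
        refine Finset.sum_le_sum_of_subset_of_nonneg Finset.subset_union_left fun a ha has =>
          mul_nonneg (hord a) (log_div_max_one_nonneg (hr.trans hrR.le) ?_)
        have := (Finset.mem_union.1 ha).resolve_left has
        exact (mem_ball_zero_iff.1 (mem_ball_of_mem_zerosAndPoles this)).le
    _ = _ := by
        refine (Finset.sum_subset Finset.subset_union_right fun a ha hZ => ?_).symm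
        have haR : ‖a‖ < R := (hs a ((Finset.mem_union.1 ha).resolve_right hZ)).trans hrR
        simp [untop₀_meromorphicOrderAt_eq_zero_of_notMem hm haR hZ]

end Jensen

/-! ### The lemma on the logarithmic derivative -/

section ErrorTerm

variable {T S S' : ℝ → ℝ}

theorem IsSmallErrorTerm.add (h : IsSmallErrorTerm T S) (h' : IsSmallErrorTerm T S') :
    IsSmallErrorTerm T fun r => S r + S' r := by
  obtain ⟨C, h⟩ := h
  obtain ⟨C', h'⟩ := h'
  refine ⟨C + C', fun δ hδ => ?_⟩
  obtain ⟨E, hE, h⟩ := h (δ / 2) (by positivity)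
  obtain ⟨E', hE', h'⟩ := h' (δ / 2) (by positivity)
  refine ⟨E ∪ E', measure_union_lt_top hE hE', fun r hr hrE => ?_⟩
  rw [Set.mem_union, not_or] at hrE
  linarith [h r hr hrE.1, h' r hr hrE.2]

theorem isSmallErrorTerm_const (T : ℝ → ℝ) (c : ℝ) : IsSmallErrorTerm T fun _ => c := by
  refine ⟨0, fun δ hδ => ⟨Set.Ioo 0 (Real.exp (c / δ)), measure_Ioo_lt_top, fun r hr hrE => ?_⟩⟩
  have hlog : c / δ ≤ Real.log r :=
    (Real.le_log_iff_exp_le hr).2 (not_lt.1 fun hlt => hrE ⟨hr, hlt⟩)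
  rw [div_le_iff₀' hδ] at hlog
  rwa [zero_mul, zero_add]

theorem IsSmallErrorTerm.const_mul (h : IsSmallErrorTerm T S) {c : ℝ} (hc : 0 ≤ c) :
    IsSmallErrorTerm T fun r => c * S r := by
  rcases hc.eq_or_lt with rfl | hc
  · simpa only [zero_mul] using isSmallErrorTerm_const T 0
  obtain ⟨C, h⟩ := h
  refine ⟨c * C, fun δ hδ => ?_⟩
  obtain ⟨E, hE, h⟩ := h (δ / c) (by positivity)
  refine ⟨E, hE, fun r hr hrE => ?_⟩
  calc c * S r ≤ c * (C * Real.log (T r) + δ / c * Real.log r) := by gcongr; exact h r hr hrE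
    _ = c * C * Real.log (T r) + δ * Real.log r := by field_simp

theorem IsSmallErrorTerm.mono (h : IsSmallErrorTerm T S) {r₀ : ℝ} {E : Set ℝ}
    (hE : volume E < ⊤) (hS : ∀ r, r₀ ≤ r → r ∉ E → S' r ≤ S r) : IsSmallErrorTerm T S' := by
  obtain ⟨C, h⟩ := h
  refine ⟨C, fun δ hδ => ?_⟩
  obtain ⟨E', hE', h⟩ := h δ hδ
  refine ⟨Set.Ioo 0 r₀ ∪ E ∪ E',
    measure_union_lt_top (measure_union_lt_top measure_Ioo_lt_top hE) hE', fun r hr hrE => ?_⟩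
  simp only [Set.mem_union, Set.mem_Ioo, not_or, not_and, not_lt] at hrE
  exact (hS r (hrE.1.1 hr) hrE.1.2).trans (h r hr hrE.2)

theorem IsSmallErrorTerm.sum {ι : Type*} (s : Finset ι) {S : ι → ℝ → ℝ}
    (h : ∀ i ∈ s, IsSmallErrorTerm T (S i)) : IsSmallErrorTerm T fun r => ∑ i ∈ s, S i r := by
  classical
  induction s using Finset.induction_on with
  | empty => simpa only [Finset.sum_empty] using isSmallErrorTerm_const T 0
  | insert i s hi ih =>
    simp only [Finset.sum_insert hi]
    exact (h i (Finset.mem_insert_self _ _)).add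
      (ih fun j hj => h j (Finset.mem_insert_of_mem hj))

theorem IsSmallErrorTerm.of_max_one (hT : MonotoneOn T (Set.Ici 0))
    (h : IsSmallErrorTerm (fun r => max (T r) 1) S) : IsSmallErrorTerm T S := by
  obtain ⟨C, h⟩ := h
  by_cases hlarge : ∃ r₀, 0 ≤ r₀ ∧ 1 ≤ T r₀
  · obtain ⟨r₀, hr₀, hTr₀⟩ := hlarge
    refine ⟨C, fun δ hδ => ?_⟩
    obtain ⟨E, hE, h⟩ := h δ hδ
    refine ⟨Set.Ioo 0 r₀ ∪ E, measure_union_lt_top measure_Ioo_lt_top hE, fun r hr hrE => ?_⟩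
    simp only [Set.mem_union, Set.mem_Ioo, not_or, not_and, not_lt] at hrE
    simpa only [max_eq_left (hTr₀.trans (hT hr₀ hr.le (hrE.1 hr)))] using h r hr hrE.2
  · push Not at hlarge
    refine ⟨0, fun δ hδ => ?_⟩
    obtain ⟨E, hE, h⟩ := h δ hδ
    refine ⟨E, hE, fun r hr hrE => ?_⟩
    simpa only [max_eq_right (hlarge r hr.le).le, Real.log_one, mul_zero, zero_mul]
      using h r hr hrE

theorem div_mul_log_le {c C N t r α : ℝ} (hc : 0 ≤ c) (hC : 1 ≤ C) (hN : 0 ≤ N) (ht : 1 ≤ t)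
    (hr : 1 ≤ r) (hα : 1 / 2 ≤ α) (hα1 : α ≤ 1) :
    c / α * Real.log (C * t ^ N * r ^ (1 - α)) ≤
      2 * c * (Real.log C + N * Real.log t + (1 - α) * Real.log r) := by
  have hlogC := Real.log_nonneg hC
  have hlogt := Real.log_nonneg ht
  have hlogr : 0 ≤ (1 - α) * Real.log r := mul_nonneg (by linarith) (Real.log_nonneg hr)
  have hcα : c / α ≤ 2 * c := by
    rw [div_le_iff₀ (by linarith)]
    nlinarith
  rw [Real.log_mul (by positivity) (by positivity), Real.log_mul (by positivity) (by positivity),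
    Real.log_rpow (by positivity), Real.log_rpow (by positivity)]
  gcongr

theorem IsSmallErrorTerm.of_forall_log_le (hT : ∀ r, 1 ≤ T r) {c N : ℝ} (hc : 0 < c) (hN : 0 ≤ N)
    (h : ∀ α, 1 / 2 ≤ α → α < 1 → ∃ C : ℝ, 1 ≤ C ∧ ∃ E : Set ℝ, volume E < ⊤ ∧
      ∀ r, 1 ≤ r → r ∉ E → S r ≤ c / α * Real.log (C * T r ^ N * r ^ (1 - α))) :
    IsSmallErrorTerm T S := by
  refine ⟨2 * c * N, fun δ hδ => ?_⟩
  have hδc : 0 < δ / (4 * c) := by positivity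
  set α := max (1 / 2) (1 - δ / (4 * c))
  have hα : α < 1 := max_lt (by norm_num) (by linarith)
  have hαδ : 1 - α ≤ δ / (4 * c) := sub_le_comm.1 (le_max_right _ _)
  obtain ⟨C, hC, E, hE, h⟩ := h α (le_max_left _ _) hα
  set ρ := Real.exp (4 * c * Real.log C / δ)
  refine ⟨Set.Ioo 0 (max 1 ρ) ∪ E, measure_union_lt_top measure_Ioo_lt_top hE,
    fun r hr hrE => ?_⟩
  simp only [Set.mem_union, Set.mem_Ioo, not_or, not_and, not_lt] at hrE
  obtain ⟨hr1, hρr⟩ := max_le_iff.1 (hrE.1 hr)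
  have hlogC : 4 * c * Real.log C ≤ δ * Real.log r := by
    rw [mul_comm δ, ← div_le_iff₀ hδ]
    exact (Real.le_log_iff_exp_le hr).2 hρr
  have hlogr := Real.log_nonneg hr1
  calc S r ≤ c / α * Real.log (C * T r ^ N * r ^ (1 - α)) := h r hr1 hrE.2
    _ ≤ 2 * c * (Real.log C + N * Real.log (T r) + (1 - α) * Real.log r) :=
        div_mul_log_le hc.le hC hN (hT r) hr1 (le_max_left _ _) hα.le
    _ ≤ 2 * c * (Real.log C + N * Real.log (T r) + δ / (4 * c) * Real.log r) := by gcongr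
    _ = 4 * c * Real.log C / 2 + 2 * c * N * Real.log (T r) + δ / 2 * Real.log r := by
        field_simp
        ring
    _ ≤ 2 * c * N * Real.log (T r) + δ * Real.log r := by linarith

end ErrorTerm

/-- `h` is an entire function, not identically zero, that grows at most like the `d`-th power of
`‖F‖`: the typical example is a form of degree `d` evaluated along the curve. -/
structure DominatedBy {n : ℕ} (F : ℂ → Fin (n + 1) → ℂ) (d : ℕ) (h : ℂ → ℂ) : Prop where
  differentiable : Differentiable ℂ h
  exists_ne_zero : ∃ z, h z ≠ 0
  exists_le : ∃ B : ℝ, 0 < B ∧ ∀ z, ‖h z‖ ≤ B * ‖F z‖ ^ d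

theorem circleAverage_mono_codiscreteWithin {f g : ℂ → ℝ} {c : ℂ} {R : ℝ}
    (hf : CircleIntegrable f c R) (hg : CircleIntegrable g c R) (hR : R ≠ 0)
    (hfg : ∀ᶠ z in codiscreteWithin (sphere c |R|), f z ≤ g z) :
    Real.circleAverage f c R ≤ Real.circleAverage g c R := by
  have hmin : (fun z => min (f z) (g z)) =ᶠ[codiscreteWithin (sphere c |R|)] f :=
    hfg.mono fun z hz => min_eq_left hz
  rw [← Real.circleAverage_congr_codiscreteWithin hmin hR]
  exact Real.circleAverage_mono (hf.congr_codiscreteWithin hmin.symm) hg fun z _ =>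
    min_le_right _ _

theorem eventually_codiscreteWithin_ne_zero {h : ℂ → ℂ} (hd : Differentiable ℂ h)
    (h0 : ∃ z, h z ≠ 0) (s : Set ℂ) : ∀ᶠ z in codiscreteWithin s, h z ≠ 0 := by
  refine codiscreteWithin_mono (Set.subset_univ s) (mem_codiscrete.2 fun z => ?_)
  rw [disjoint_principal_right, compl_compl]
  exact eventually_nhdsNE_ne_zero hd h0 z

theorem regularOn_sphere {h : ℂ → ℂ} (hd : Differentiable ℂ h) {r : ℝ}
    (hr : r ∉ norm '' {z | h z = 0}) : RegularOn h (sphere 0 r) := fun z hz =>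
  ⟨hd.analyticAt z, fun h0 => hr ⟨z, h0, mem_sphere_zero_iff_norm.1 hz⟩⟩

section FirstMainTheorem

variable {n : ℕ} {F : ℂ → Fin (n + 1) → ℂ} {h : ℂ → ℂ} {b d R : ℝ}

theorem DominatedBy.exists_log_norm_le {d : ℕ} (hh : DominatedBy F d h) (hF0 : ∀ z, F z ≠ 0) :
    ∃ b : ℝ, ∀ z, h z ≠ 0 → Real.log ‖h z‖ ≤ b + d * Real.log ‖F z‖ := by
  obtain ⟨B, hB, hle⟩ := hh.exists_le
  refine ⟨Real.log B, fun z hz => ?_⟩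
  have hFz := norm_ne_zero_iff.2 (hF0 z)
  rw [← Real.log_pow, ← Real.log_mul hB.ne' (pow_ne_zero d hFz)]
  exact Real.log_le_log (norm_pos_iff.2 hz) (hle z)

theorem circleIntegrable_add_mul_log_norm (hF : Continuous F) (hF0 : ∀ z, F z ≠ 0) (b d R : ℝ) :
    CircleIntegrable (fun z => b + d * Real.log ‖F z‖) 0 R :=
  (circleIntegrable_const _ _ _).add (circleIntegrable_log_norm hF hF0 R).const_fun_smul

theorem circleAverage_add_mul_log_norm (hF : Continuous F) (hF0 : ∀ z, F z ≠ 0) (b d R : ℝ) :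
    Real.circleAverage (fun z => b + d * Real.log ‖F z‖) 0 R = b + d * orderFunction F R := by
  simp only [← smul_eq_mul (a := d)]
  rw [Real.circleAverage_fun_add (circleIntegrable_const _ _ _)
    (circleIntegrable_log_norm hF hF0 R).const_fun_smul, Real.circleAverage_const,
    Real.circleAverage_fun_smul, orderFunction_eq_circleAverage]

theorem circleAverage_log_norm_le (hF : Continuous F) (hF0 : ∀ z, F z ≠ 0)
    (hd : Differentiable ℂ h) (h0 : ∃ z, h z ≠ 0)
    (hb : ∀ z, h z ≠ 0 → Real.log ‖h z‖ ≤ b + d * Real.log ‖F z‖) (hR : R ≠ 0) :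
    Real.circleAverage (fun z => Real.log ‖h z‖) 0 R ≤ b + d * orderFunction F R := by
  rw [← circleAverage_add_mul_log_norm hF hF0]
  exact circleAverage_mono_codiscreteWithin
    (meromorphic_of_differentiable hd).meromorphicOn.circleIntegrable_log_norm
    (circleIntegrable_add_mul_log_norm hF hF0 b d R) hR
    ((eventually_codiscreteWithin_ne_zero hd h0 _).mono hb)

theorem exists_add_mul_sub_le_mul_max_one (hd : 0 ≤ d) (b c : ℝ) :
    ∃ K : ℝ, 0 ≤ K ∧ ∀ x : ℝ, b + d * x - c ≤ K * max x 1 := by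
  refine ⟨|b| + d + |c|, by positivity, fun x => ?_⟩
  have hx1 : 1 ≤ max x 1 := le_max_right _ _
  have hdx : d * x ≤ d * max x 1 := mul_le_mul_of_nonneg_left (le_max_left _ _) hd
  nlinarith [le_abs_self b, neg_abs_le c, abs_nonneg b, abs_nonneg c]

theorem exists_circleAverage_sub_log_norm_le (hF : Continuous F) (hF0 : ∀ z, F z ≠ 0)
    (hh : Differentiable ℂ h) (hd : 0 ≤ d) (b : ℝ) :
    ∃ K : ℝ, 0 ≤ K ∧ ∀ R, 1 ≤ R →
      Real.circleAverage (fun z => b + d * Real.log ‖F z‖ - Real.log ‖h z‖) 0 R ≤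
        K * max (orderFunction F R) 1 := by
  obtain ⟨K, hK, hle⟩ := exists_add_mul_sub_le_mul_max_one hd b
    (Real.circleAverage (fun z => Real.log ‖h z‖) 0 1)
  refine ⟨K, hK, fun R hR => ?_⟩
  rw [Real.circleAverage_fun_sub (circleIntegrable_add_mul_log_norm hF hF0 b d R)
    (meromorphic_of_differentiable hh).meromorphicOn.circleIntegrable_log_norm,
    circleAverage_add_mul_log_norm hF hF0]
  linarith [hle (orderFunction F R), circleAverage_log_norm_one_le hh hR]

theorem DominatedBy.exists_sum_meromorphicOrderAt_le {d : ℕ} (hh : DominatedBy F d h)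
    (hF : Continuous F) (hF0 : ∀ z, F z ≠ 0) :
    ∃ K : ℝ, 0 ≤ K ∧ ∀ r R : ℝ, 1 ≤ r → r < R → ∀ s : Finset ℂ, (∀ a ∈ s, ‖a‖ < r) →
      (∑ a ∈ s, ((meromorphicOrderAt h a).untop₀ : ℝ)) ≤
        K * (max (orderFunction F R) 1 * (R / (R - r))) := by
  obtain ⟨b, hb⟩ := hh.exists_log_norm_le hF0
  obtain ⟨K, hK, hle⟩ := exists_add_mul_sub_le_mul_max_one (Nat.cast_nonneg d) b
    (Real.circleAverage (fun z => Real.log ‖h z‖) 0 1)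
  refine ⟨K, hK, fun r R hr hrR s hs => ?_⟩
  have hR : 0 < R := by linarith
  have : 0 < R - r := by linarith
  have hsum := sum_meromorphicOrderAt_mul_le hh.differentiable hr hrR hs
  rw [← inv_div R (R - r), ← div_eq_mul_inv, div_le_iff₀ (by positivity)] at hsum
  rw [← mul_assoc]
  refine hsum.trans (mul_le_mul_of_nonneg_right ?_ (by positivity))
  linarith [hle (orderFunction F R),
    circleAverage_log_norm_le hF hF0 hh.differentiable hh.exists_ne_zero hb hR.ne']

end FirstMainTheorem

section Quotient

variable {n : ℕ} {F : ℂ → Fin (n + 1) → ℂ} {d : ℕ} {h₁ h₂ : ℂ → ℂ}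

theorem meromorphicOrderAt_div_ne_top {z : ℂ} (hm₁ : MeromorphicAt h₁ z)
    (hm₂ : MeromorphicAt h₂ z) (h₁t : meromorphicOrderAt h₁ z ≠ ⊤)
    (h₂t : meromorphicOrderAt h₂ z ≠ ⊤) :
    meromorphicOrderAt (fun z => h₁ z / h₂ z) z ≠ ⊤ := by
  rw [meromorphicOrderAt_ne_top_iff_eventually_ne_zero (hm₁.fun_div hm₂)]
  filter_upwards [(meromorphicOrderAt_ne_top_iff_eventually_ne_zero hm₁).1 h₁t,
    (meromorphicOrderAt_ne_top_iff_eventually_ne_zero hm₂).1 h₂t] with w hw₁ hw₂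
  exact div_ne_zero hw₁ hw₂

theorem abs_untop₀_meromorphicOrderAt_div_le {a : ℂ} (ha₁ : AnalyticAt ℂ h₁ a)
    (ha₂ : AnalyticAt ℂ h₂ a) (h₁t : meromorphicOrderAt h₁ a ≠ ⊤)
    (h₂t : meromorphicOrderAt h₂ a ≠ ⊤) :
    |((meromorphicOrderAt (fun z => h₁ z / h₂ z) a).untop₀ : ℝ)| ≤
      (meromorphicOrderAt h₁ a).untop₀ + (meromorphicOrderAt h₂ a).untop₀ := by
  have h₁nonneg := untop₀_meromorphicOrderAt_nonneg ha₁
  have h₂nonneg := untop₀_meromorphicOrderAt_nonneg ha₂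
  rw [fun_meromorphicOrderAt_div ha₁.meromorphicAt ha₂.meromorphicAt]
  lift meromorphicOrderAt h₁ a to ℤ using h₁t with p
  lift meromorphicOrderAt h₂ a to ℤ using h₂t with q
  rw [← WithTop.LinearOrderedAddCommGroup.coe_sub]
  simp only [WithTop.untop₀_coe, Int.cast_sub] at h₁nonneg h₂nonneg ⊢
  rw [abs_le]
  constructor <;> linarith

theorem RegularOn.fun_div {s : Set ℂ} (hs₁ : RegularOn h₁ s) (hs₂ : RegularOn h₂ s) :
    RegularOn (fun z => h₁ z / h₂ z) s := fun z hz =>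
  ⟨(hs₁ z hz).1.fun_div (hs₂ z hz).1 (hs₂ z hz).2, div_ne_zero (hs₁ z hz).2 (hs₂ z hz).2⟩

theorem DominatedBy.meromorphic_div (hh₁ : DominatedBy F d h₁) (hh₂ : DominatedBy F d h₂) :
    Meromorphic fun z => h₁ z / h₂ z := fun z =>
  (meromorphic_of_differentiable hh₁.differentiable z).fun_div
    (meromorphic_of_differentiable hh₂.differentiable z)

theorem DominatedBy.exists_circleAverage_abs_log_norm_div_le (hF : Continuous F)
    (hF0 : ∀ z, F z ≠ 0) (hh₁ : DominatedBy F d h₁) (hh₂ : DominatedBy F d h₂) :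
    ∃ K : ℝ, 0 ≤ K ∧ ∀ R, 1 ≤ R → RegularOn h₁ (sphere 0 R) → RegularOn h₂ (sphere 0 R) →
      Real.circleAverage (fun z => |Real.log ‖h₁ z / h₂ z‖|) 0 R ≤
        K * max (orderFunction F R) 1 := by
  obtain ⟨b₁, hb₁⟩ := hh₁.exists_log_norm_le hF0
  obtain ⟨b₂, hb₂⟩ := hh₂.exists_log_norm_le hF0
  set b := max b₁ b₂
  obtain ⟨K₁, hK₁, hle₁⟩ := exists_circleAverage_sub_log_norm_le hF hF0 hh₁.differentiable
    (Nat.cast_nonneg d) b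
  obtain ⟨K₂, hK₂, hle₂⟩ := exists_circleAverage_sub_log_norm_le hF hF0 hh₂.differentiable
    (Nat.cast_nonneg d) b
  refine ⟨K₁ + K₂, by positivity, fun R hR hs₁ hs₂ => ?_⟩
  have hR0 : 0 ≤ R := by linarith
  have hintegrable {h : ℂ → ℂ} (hs : RegularOn h (sphere 0 R)) :
      CircleIntegrable (fun z => b + d * Real.log ‖F z‖ - Real.log ‖h z‖) 0 R :=
    (circleIntegrable_add_mul_log_norm hF hF0 b d R).sub
      (hs.continuousOn_log_norm.circleIntegrable hR0)
  -- `|x - y| ≤ (M - x) + (M - y)` for every common upper bound `M` of `x` and `y`.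
  have hpointwise : ∀ z ∈ sphere (0 : ℂ) |R|, |Real.log ‖h₁ z / h₂ z‖| ≤
      (b + d * Real.log ‖F z‖ - Real.log ‖h₁ z‖) +
        (b + d * Real.log ‖F z‖ - Real.log ‖h₂ z‖) := fun z hz => by
    rw [abs_of_nonneg hR0] at hz
    have hz₁ := (hs₁ z hz).2
    have hz₂ := (hs₂ z hz).2
    rw [norm_div, Real.log_div (norm_ne_zero_iff.2 hz₁) (norm_ne_zero_iff.2 hz₂), abs_le]
    constructor <;> linarith [hb₁ z hz₁, hb₂ z hz₂, le_max_left b₁ b₂, le_max_right b₁ b₂]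
  calc Real.circleAverage (fun z => |Real.log ‖h₁ z / h₂ z‖|) 0 R
      ≤ _ := Real.circleAverage_mono
        ((hs₁.fun_div hs₂).continuousOn_log_norm.abs.circleIntegrable hR0)
        ((hintegrable hs₁).add (hintegrable hs₂)) hpointwise
    _ = _ := Real.circleAverage_add (hintegrable hs₁) (hintegrable hs₂)
    _ ≤ (K₁ + K₂) * max (orderFunction F R) 1 := by
      rw [add_mul]
      exact add_le_add (hle₁ R hR) (hle₂ R hR)

theorem DominatedBy.exists_sum_abs_divisor_div_le (hF : Continuous F) (hF0 : ∀ z, F z ≠ 0)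
    (hh₁ : DominatedBy F d h₁) (hh₂ : DominatedBy F d h₂) :
    ∃ K : ℝ, 0 ≤ K ∧ ∀ r R : ℝ, 1 ≤ r → r < R →
      ∑ a ∈ zerosAndPoles (hh₁.meromorphic_div hh₂) r,
          |(MeromorphicOn.divisor (fun z => h₁ z / h₂ z) (ball 0 r) a : ℝ)| ≤
        K * (max (orderFunction F R) 1 * (R / (R - r))) := by
  obtain ⟨K₁, hK₁, hle₁⟩ := hh₁.exists_sum_meromorphicOrderAt_le hF hF0
  obtain ⟨K₂, hK₂, hle₂⟩ := hh₂.exists_sum_meromorphicOrderAt_le hF hF0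
  refine ⟨K₁ + K₂, by positivity, fun r R hr hrR => ?_⟩
  set s := zerosAndPoles (hh₁.meromorphic_div hh₂) r
  have hs : ∀ a ∈ s, ‖a‖ < r := fun a ha => mem_ball_zero_iff.1 (mem_ball_of_mem_zerosAndPoles ha)
  calc ∑ a ∈ s, |(MeromorphicOn.divisor (fun z => h₁ z / h₂ z) (ball 0 r) a : ℝ)|
      ≤ ∑ a ∈ s, (((meromorphicOrderAt h₁ a).untop₀ : ℝ) + (meromorphicOrderAt h₂ a).untop₀) := by
        refine Finset.sum_le_sum fun a ha => ?_
        rw [MeromorphicOn.divisor_apply (hh₁.meromorphic_div hh₂).meromorphicOn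
          (mem_ball_of_mem_zerosAndPoles ha)]
        exact abs_untop₀_meromorphicOrderAt_div_le (hh₁.differentiable.analyticAt a)
          (hh₂.differentiable.analyticAt a)
          (meromorphicOrderAt_ne_top_of_differentiable hh₁.differentiable hh₁.exists_ne_zero a)
          (meromorphicOrderAt_ne_top_of_differentiable hh₂.differentiable hh₂.exists_ne_zero a)
    _ ≤ _ := by
        rw [Finset.sum_add_distrib, add_mul]
        exact add_le_add (hle₁ r R hr hrR s hs) (hle₂ r R hr hrR s hs)

theorem DominatedBy.exists_circleAverage_log_iteratedDeriv_logDeriv_div_le (hF : Continuous F)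
    (hF0 : ∀ z, F z ≠ 0) (hh₁ : DominatedBy F d h₁) (hh₂ : DominatedBy F d h₂) (j : ℕ) {α : ℝ}
    (hα0 : 0 < α) (hα1 : α < 1) :
    ∃ C : ℝ, 0 ≤ C ∧ ∀ r ρ R : ℝ, 1 ≤ r → r < ρ → ρ < R →
      r ∉ norm '' {z | h₁ z = 0} ∪ norm '' {z | h₂ z = 0} →
      ρ ∉ norm '' {z | h₁ z = 0} ∪ norm '' {z | h₂ z = 0} →
      Real.circleAverage
          (fun z => Real.log (1 + ‖iteratedDeriv j (logDeriv fun w => h₁ w / h₂ w) z‖)) 0 r ≤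
        (j + 1) / α * Real.log
          (2 + C * (max (orderFunction F R) 1 * (R / (R - ρ))) * r ^ (-α) +
            C * ((ρ - r) ^ (j + 1))⁻¹ * max (orderFunction F ρ) 1) := by
  obtain ⟨K₁, hK₁, havg⟩ := exists_circleAverage_abs_log_norm_div_le hF hF0 hh₁ hh₂
  obtain ⟨K₂, hK₂, hdiv⟩ := exists_sum_abs_divisor_div_le hF hF0 hh₁ hh₂
  obtain ⟨C, hC, hmain⟩ := exists_circleAverage_log_iteratedDeriv_logDeriv_le j hα0 hα1
  refine ⟨C * K₂ + C * K₁, by positivity, fun r ρ R hr hrρ hρR hrreg hρreg => ?_⟩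
  rw [Set.mem_union, not_or] at hrreg hρreg
  have hreg₁ := regularOn_sphere hh₁.differentiable hρreg.1
  have hreg₂ := regularOn_sphere hh₂.differentiable hρreg.2
  have hord (z : ℂ) : meromorphicOrderAt (fun w => h₁ w / h₂ w) z ≠ ⊤ :=
    meromorphicOrderAt_div_ne_top (meromorphic_of_differentiable hh₁.differentiable z)
      (meromorphic_of_differentiable hh₂.differentiable z)
      (meromorphicOrderAt_ne_top_of_differentiable hh₁.differentiable hh₁.exists_ne_zero z)
      (meromorphicOrderAt_ne_top_of_differentiable hh₂.differentiable hh₂.exists_ne_zero z)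
  have hr0 : 0 < r := by linarith
  have : 0 < ρ - r := by linarith
  have : 0 < R - ρ := by linarith
  have hR : 0 < R := by linarith
  have : 0 ≤ Real.circleAverage (fun z => |Real.log ‖h₁ z / h₂ z‖|) 0 ρ :=
    Real.circleAverage_nonneg_of_nonneg fun z _ => abs_nonneg _
  refine (hmain _ r ρ (hh₁.meromorphic_div hh₂) hr0 hrρ hord
    ((regularOn_sphere hh₁.differentiable hrreg.1).fun_div
      (regularOn_sphere hh₂.differentiable hrreg.2)) (hreg₁.fun_div hreg₂)).trans ?_
  gcongr ?_ * Real.log (2 + ?_ + ?_)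
  · calc _ ≤ C * (K₂ * (max (orderFunction F R) 1 * (R / (R - ρ)))) * r ^ (-α) := by
          gcongr; exact hdiv ρ R (by linarith) hρR
      _ ≤ _ := by rw [← mul_assoc C]; gcongr; nlinarith
  · calc _ ≤ C * ((ρ - r) ^ (j + 1))⁻¹ * (K₁ * max (orderFunction F ρ) 1) := by
          gcongr; exact havg ρ (by linarith) hreg₁ hreg₂
      _ = C * K₁ * ((ρ - r) ^ (j + 1))⁻¹ * max (orderFunction F ρ) 1 := by ring
      _ ≤ _ := by gcongr; nlinarith

end Quotient

theorem add_error_terms_le {C t r ρ tρ tR α : ℝ} (hC : 0 ≤ C) (ht : 1 ≤ t) (hr : 1 ≤ r)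
    (hα : α ≤ 1) (hrρ : r + t⁻¹ / 3 ≤ ρ) (hρR : ρ ≤ r + 2 * t⁻¹ / 3) (htρ : tρ ≤ 2 * t)
    (htR : tR ≤ 2 * t) (j : ℕ) :
    2 + C * (tR * ((r + t⁻¹) / (r + t⁻¹ - ρ))) * r ^ (-α) + C * ((ρ - r) ^ (j + 1))⁻¹ * tρ ≤
      (2 + 12 * C + 2 * 3 ^ (j + 1) * C) * t ^ (j + 2 : ℝ) * r ^ (1 - α) := by
  have : 0 < t := by linarith
  have hr0 : 0 < r := by linarith
  have htinv : 0 < t⁻¹ := by positivity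
  have htinv1 : t⁻¹ ≤ 1 := inv_le_one_of_one_le₀ ht
  have htN : t ^ (j + 2 : ℝ) = t ^ (j + 2) := by rw [← Real.rpow_natCast]; norm_num
  have htj : 1 ≤ t ^ (j + 2) := one_le_pow₀ ht
  have ht2 : t ^ 2 ≤ t ^ (j + 2) := pow_le_pow_right₀ ht (by lia)
  have hrα : 1 ≤ r ^ (1 - α) := Real.one_le_rpow hr (by linarith)
  have hrr : r * r ^ (-α) = r ^ (1 - α) := by
    rw [sub_eq_add_neg, Real.rpow_add hr0, Real.rpow_one]
  have hfrac : (r + t⁻¹) / (r + t⁻¹ - ρ) ≤ 6 * r * t := by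
    rw [div_le_iff₀ (by linarith)]
    calc r + t⁻¹ ≤ 2 * r := by linarith
      _ = 6 * r * t * (t⁻¹ / 3) := by field_simp; norm_num
      _ ≤ 6 * r * t * (r + t⁻¹ - ρ) := by gcongr; linarith
  have hpow : ((ρ - r) ^ (j + 1))⁻¹ ≤ 3 ^ (j + 1) * t ^ (j + 1) := by
    rw [← mul_pow, ← inv_pow]
    refine pow_le_pow_left₀ (inv_nonneg.2 (by linarith)) ?_ _
    rw [inv_le_comm₀ (by linarith) (by positivity), mul_inv]
    linarith
  have hzeros : C * (tR * ((r + t⁻¹) / (r + t⁻¹ - ρ))) * r ^ (-α) ≤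
      12 * C * t ^ (j + 2) * r ^ (1 - α) := by
    have : 0 ≤ (r + t⁻¹) / (r + t⁻¹ - ρ) := div_nonneg (by linarith) (by linarith)
    calc _ ≤ C * (2 * t * (6 * r * t)) * r ^ (-α) := by gcongr
      _ = 12 * C * t ^ 2 * (r * r ^ (-α)) := by ring
      _ ≤ _ := by rw [hrr]; gcongr
  have hproximity : C * ((ρ - r) ^ (j + 1))⁻¹ * tρ ≤
      2 * 3 ^ (j + 1) * C * t ^ (j + 2) * r ^ (1 - α) := by
    have : 0 < ρ - r := by linarith
    calc _ ≤ C * ((ρ - r) ^ (j + 1))⁻¹ * (2 * t) := by gcongr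
      _ ≤ C * (3 ^ (j + 1) * t ^ (j + 1)) * (2 * t) := by gcongr
      _ = 2 * 3 ^ (j + 1) * C * t ^ (j + 2) * 1 := by ring
      _ ≤ _ := by gcongr
  rw [htN]
  nlinarith [mul_nonneg (sub_nonneg.2 htj) (sub_nonneg.2 hrα)]

theorem DominatedBy.isSmallErrorTerm {n : ℕ} {F : ℂ → Fin (n + 1) → ℂ}
    (hF : Differentiable ℂ F) (hF0 : ∀ z, F z ≠ 0) {d : ℕ} {h₁ h₂ : ℂ → ℂ}
    (hh₁ : DominatedBy F d h₁) (hh₂ : DominatedBy F d h₂) (j : ℕ) :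
    IsSmallErrorTerm (fun r => max (orderFunction F r) 1) fun r => Real.circleAverage
      (fun z => Real.log (1 + ‖iteratedDeriv j (logDeriv fun w => h₁ w / h₂ w) z‖)) 0 r := by
  set τ : ℝ → ℝ := fun r => max (orderFunction F r) 1
  have hτ1 (r : ℝ) : 1 ≤ τ r := le_max_right _ _
  have hmono : MonotoneOn τ (Set.Ici 1) := fun r hr s _ hrs =>
    max_le_max_right _ (orderFunction_le_of_le hF hF0 (zero_le_one.trans hr) hrs)
  obtain ⟨E, hE, hEτ⟩ := exists_measure_lt_top_forall_growth_le hτ1 hmono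
  set Z := norm '' {z | h₁ z = 0} ∪ norm '' {z | h₂ z = 0}
  have hZ : Z.Countable := (countable_norm_image_zeros hh₁.1 hh₁.2).union
    (countable_norm_image_zeros hh₂.1 hh₂.2)
  refine IsSmallErrorTerm.of_forall_log_le hτ1 (c := j + 1) (N := j + 2) (by positivity)
    (by positivity) fun α hα hα1 => ?_
  obtain ⟨C, hC, hmain⟩ := hh₁.exists_circleAverage_log_iteratedDeriv_logDeriv_div_le
    hF.continuous hF0 hh₂ j (by linarith : 0 < α) hα1
  refine ⟨2 + 12 * C + 2 * 3 ^ (j + 1) * C, by nlinarith [pow_pos (zero_lt_three' ℝ) (j + 1)],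
    E ∪ Z, measure_union_lt_top hE (by simp [hZ.measure_zero]), fun r hr hrEZ => ?_⟩
  rw [Set.mem_union, not_or] at hrEZ
  have hinv : 0 < (τ r)⁻¹ := inv_pos.2 (by linarith [hτ1 r])
  obtain ⟨ρ, hρZ, hrρ, hρR⟩ := (hZ.dense_compl ℝ).exists_between
    (by linarith : r + (τ r)⁻¹ / 3 < r + 2 * (τ r)⁻¹ / 3)
  have hτR : τ (r + (τ r)⁻¹) ≤ 2 * τ r := hEτ r hr hrEZ.1
  have hτρ : τ ρ ≤ 2 * τ r :=
    (hmono (by grind) (by grind) (by linarith)).trans hτR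
  refine (hmain r ρ (r + (τ r)⁻¹) hr (by linarith) (by linarith) hrEZ.2 hρZ).trans ?_
  have : 0 < ρ - r := by linarith
  have : 0 ≤ (r + (τ r)⁻¹) / (r + (τ r)⁻¹ - ρ) := div_nonneg (by linarith) (by linarith)
  gcongr
  exact add_error_terms_le hC (hτ1 r) hr hα1.le hrρ.le hρR.le hτρ hτR j

/-! ### Jet differentials along a curve -/

theorem eval_smul_of_isHomogeneous {σ R : Type*} [CommSemiring R] {Q : MvPolynomial σ R} {d : ℕ}
    (hQ : Q.IsHomogeneous d) (c : R) (v : σ → R) :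
    MvPolynomial.eval (c • v) Q = c ^ d * MvPolynomial.eval v Q := by
  rw [MvPolynomial.eval_eq, MvPolynomial.eval_eq, Finset.mul_sum]
  refine Finset.sum_congr rfl fun α hα => ?_
  have hdeg : ∑ i ∈ α.support, α i = d := by
    simpa [Finsupp.weight_apply, Finsupp.sum] using hQ (MvPolynomial.mem_support_iff.1 hα)
  simp only [Pi.smul_apply, smul_eq_mul, mul_pow, Finset.prod_mul_distrib,
    Finset.prod_pow_eq_pow_sum, hdeg]
  ring

theorem mk_mem_hypersurface_iff {n d : ℕ} {Q : MvPolynomial (Fin (n + 1)) ℂ}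
    (hQ : Q.IsHomogeneous d) {v : Fin (n + 1) → ℂ} (hv : v ≠ 0) :
    Projectivization.mk ℂ v hv ∈ hypersurface Q ↔ MvPolynomial.eval v Q = 0 := by
  refine ⟨fun h => h v hv rfl, fun h w hw hwv => ?_⟩
  obtain ⟨c, rfl⟩ := (Projectivization.mk_eq_mk_iff' ℂ _ _ hw hv).1 hwv
  rw [eval_smul_of_isHomogeneous hQ, h, mul_zero]

theorem onCone_of_ne_zero {n : ℕ} {E : Type*} [Zero E] (φ : Pn n → E) {v : Fin (n + 1) → ℂ}
    (hv : v ≠ 0) : onCone φ v = φ (Projectivization.mk ℂ v hv) :=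
  dif_pos hv

namespace IsReducedRepresentation

variable {n : ℕ} {F : ℂ → Fin (n + 1) → ℂ} {f : ℂ → Pn n} {z : ℂ}

theorem ne_zero (hF : IsReducedRepresentation F f) (z : ℂ) : F z ≠ 0 := (hF.2 z).1

theorem onCone_eq (hF : IsReducedRepresentation F f) {E : Type*} [Zero E] (φ : Pn n → E) (z : ℂ) :
    onCone φ (F z) = φ (f z) := by
  rw [onCone_of_ne_zero φ (hF.ne_zero z), (hF.2 z).2]

theorem mem_cone_iff (hF : IsReducedRepresentation F f) {U : Set (Pn n)} :
    F z ∈ cone U ↔ f z ∈ U :=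
  ⟨fun ⟨_, hU⟩ => (hF.2 z).2 ▸ hU, fun hU => ⟨hF.ne_zero z, (hF.2 z).2.symm ▸ hU⟩⟩

theorem mem_hypersurface_iff (hF : IsReducedRepresentation F f) {d : ℕ}
    {Q : MvPolynomial (Fin (n + 1)) ℂ} (hQ : Q.IsHomogeneous d) :
    f z ∈ hypersurface Q ↔ MvPolynomial.eval (F z) Q = 0 := by
  rw [← mk_mem_hypersurface_iff hQ (hF.ne_zero z), (hF.2 z).2]

end IsReducedRepresentation

section PoleOrder

variable {u v : ℂ → ℂ} {a : ℂ} {p q : ℕ}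

/-- `u` is meromorphic at `a` with a pole of order at most `p`, that is, of order at least `-p`
(in the sense of `meromorphicOrderAt`). -/
def PoleOrderLE (u : ℂ → ℂ) (a : ℂ) (p : ℕ) : Prop :=
  MeromorphicAt u a ∧ ((-(p : ℤ) : ℤ) : WithTop ℤ) ≤ meromorphicOrderAt u a

theorem poleOrderLE_of_analyticAt (hu : AnalyticAt ℂ u a) (p : ℕ) : PoleOrderLE u a p :=
  ⟨hu.meromorphicAt, le_trans (mod_cast (by lia : (-(p : ℤ)) ≤ 0)) hu.meromorphicOrderAt_nonneg⟩

theorem PoleOrderLE.congr (hu : PoleOrderLE u a p) (huv : u =ᶠ[𝓝[≠] a] v) : PoleOrderLE v a p :=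
  ⟨hu.1.congr huv, meromorphicOrderAt_congr huv ▸ hu.2⟩

theorem PoleOrderLE.mul (hu : PoleOrderLE u a p) (hv : PoleOrderLE v a q) :
    PoleOrderLE (fun z => u z * v z) a (p + q) := by
  refine ⟨hu.1.fun_mul hv.1, ?_⟩
  calc ((-((p + q : ℕ) : ℤ) : ℤ) : WithTop ℤ)
      = ((-(p : ℤ) : ℤ) : WithTop ℤ) + ((-(q : ℤ) : ℤ) : WithTop ℤ) := by
        rw [← WithTop.coe_add, Nat.cast_add, neg_add]
    _ ≤ meromorphicOrderAt (fun z => u z * v z) a := by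
        rw [fun_meromorphicOrderAt_mul hu.1 hv.1]
        exact add_le_add hu.2 hv.2

theorem PoleOrderLE.prod {ι : Type*} (s : Finset ι) {u : ι → ℂ → ℂ} {p : ι → ℕ}
    (hu : ∀ i ∈ s, PoleOrderLE (u i) a (p i)) :
    PoleOrderLE (fun z => ∏ i ∈ s, u i z) a (∑ i ∈ s, p i) := by
  classical
  induction s using Finset.induction_on with
  | empty => exact poleOrderLE_of_analyticAt analyticAt_const 0
  | insert i s hi ih =>
    simp only [Finset.prod_insert hi, Finset.sum_insert hi]
    exact (hu i (Finset.mem_insert_self _ _)).mul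
      (ih fun j hj => hu j (Finset.mem_insert_of_mem hj))

theorem PoleOrderLE.pow (hu : PoleOrderLE u a p) (N : ℕ) :
    PoleOrderLE (fun z => u z ^ N) a (N * p) := by
  simpa only [Finset.prod_const, Finset.sum_const, Finset.card_range, smul_eq_mul]
    using PoleOrderLE.prod (Finset.range N) (u := fun _ => u) fun _ _ => hu

theorem PoleOrderLE.add (hu : PoleOrderLE u a p) (hv : PoleOrderLE v a p) :
    PoleOrderLE (fun z => u z + v z) a p :=
  ⟨hu.1.fun_add hv.1, (le_min hu.2 hv.2).trans (meromorphicOrderAt_add hu.1 hv.1)⟩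

theorem PoleOrderLE.sum {ι : Type*} (s : Finset ι) {u : ι → ℂ → ℂ}
    (hu : ∀ i ∈ s, PoleOrderLE (u i) a p) : PoleOrderLE (fun z => ∑ i ∈ s, u i z) a p := by
  classical
  induction s using Finset.induction_on with
  | empty => exact poleOrderLE_of_analyticAt analyticAt_const p
  | insert i s hi ih =>
    simp only [Finset.sum_insert hi]
    exact (hu i (Finset.mem_insert_self _ _)).add
      (ih fun j hj => hu j (Finset.mem_insert_of_mem hj))

theorem PoleOrderLE.deriv (hu : PoleOrderLE u a p) : PoleOrderLE (deriv u) a (p + 1) := by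
  rcases le_or_gt 0 (meromorphicOrderAt u a) with hnonneg | hneg
  · obtain ⟨g, hg, hug⟩ := hu.1.meromorphicOrderAt_nonneg_iff.1 hnonneg
    exact (poleOrderLE_of_analyticAt hg.deriv _).congr hug.symm.nhdsNE_deriv
  · obtain ⟨m, hm⟩ := WithTop.ne_top_iff_exists.1 (hneg.trans (WithTop.coe_lt_top 0)).ne
    have hpm := hu.2
    rw [← hm, WithTop.coe_le_coe] at hpm
    rw [← hm] at hneg
    have hm0 : m < 0 := mod_cast hneg
    refine ⟨hu.1.deriv, ?_⟩
    rw [meromorphicOrderAt_deriv_eq_sub_one (n := m) (mod_cast hm0.ne) hm.symm]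
    exact_mod_cast (by lia : -((p + 1 : ℕ) : ℤ) ≤ m - 1)

theorem PoleOrderLE.iteratedDeriv (hu : PoleOrderLE u a p) (j : ℕ) :
    PoleOrderLE (iteratedDeriv j u) a (p + j) := by
  induction j with
  | zero => rwa [iteratedDeriv_zero, add_zero]
  | succ j ih =>
    rw [iteratedDeriv_succ]
    exact ih.deriv

theorem poleOrderLE_logDeriv (hu : MeromorphicAt u a) : PoleOrderLE (logDeriv u) a 1 := by
  refine ⟨hu.deriv.div hu, ?_⟩
  by_cases h0 : meromorphicOrderAt u a = 0
  · refine le_trans ?_ (meromorphicOrderAt_logDeriv_nonneg hu h0)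
    exact_mod_cast (by norm_num : -((1 : ℕ) : ℤ) ≤ 0)
  by_cases ht : meromorphicOrderAt u a = ⊤
  · have hzero : logDeriv u =ᶠ[𝓝[≠] a] fun _ => 0 := by
      filter_upwards [meromorphicOrderAt_eq_top_iff.1 ht] with z hz
      rw [logDeriv_apply, hz, div_zero]
    rw [meromorphicOrderAt_eq_top_iff.2 hzero]
    exact le_top
  · rw [meromorphicOrderAt_logDeriv_eq_neg_one hu h0 ht]
    norm_num

end PoleOrder

/-- The exponents of the monomials of weighted degree `m` in the jet-coordinates, where the
coordinate of index `(j, i)` has weight `j + 1`. -/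
noncomputable def jetExponents (k n m : ℕ) : Finset ((Fin k × Fin n) →₀ ℕ) :=
  (Finset.Iic (Finsupp.equivFunOnFinite.symm fun _ => m)).filter
    fun α => ∑ p, α p * ((p.1 : ℕ) + 1) = m

theorem mem_jetExponents {k n m : ℕ} {α : (Fin k × Fin n) →₀ ℕ} :
    α ∈ jetExponents k n m ↔ ∑ p, α p * ((p.1 : ℕ) + 1) = m := by
  rw [jetExponents, Finset.mem_filter, and_iff_right_iff_imp, Finset.mem_Iic]
  rintro rfl p
  calc α p ≤ α p * ((p.1 : ℕ) + 1) := Nat.le_mul_of_pos_right _ (Nat.succ_pos _)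
    _ ≤ ∑ p, α p * ((p.1 : ℕ) + 1) :=
      Finset.single_le_sum (f := fun p : Fin k × Fin n => α p * ((p.1 : ℕ) + 1))
        (fun _ _ => Nat.zero_le _) (Finset.mem_univ p)

theorem eval_eq_sum_jetExponents {R : Type*} [CommSemiring R] {k n m : ℕ}
    {A : MvPolynomial (Fin k × Fin n) R}
    (hA : A.IsWeightedHomogeneous (fun p : Fin k × Fin n => (p.1 : ℕ) + 1) m)
    (y : Fin k × Fin n → R) :
    MvPolynomial.eval y A = ∑ α ∈ jetExponents k n m, A.coeff α * ∏ p, y p ^ α p := by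
  rw [MvPolynomial.eval_eq']
  refine Finset.sum_subset (fun α hα => ?_) fun α _ hα => ?_
  · rw [mem_jetExponents, ← hA (MvPolynomial.mem_support_iff.1 hα), Finsupp.weight_apply,
      Finsupp.sum_fintype _ _ (by simp)]
    simp only [smul_eq_mul]
  · rw [MvPolynomial.notMem_support_iff.1 hα, zero_mul]

theorem analyticAt_comp_of_differentiableOn {E : Type*} [NormedAddCommGroup E] [NormedSpace ℂ E]
    [CompleteSpace E] {G : ℂ → E} {a : ℂ} (hG : AnalyticAt ℂ G a) {H : E → ℂ} {W : Set E}
    (hW : IsOpen W) (hH : DifferentiableOn ℂ H W) (ha : G a ∈ W) :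
    AnalyticAt ℂ (fun z => H (G z)) a := by
  rw [Complex.analyticAt_iff_eventually_differentiableAt]
  filter_upwards [hG.eventually_analyticAt,
    hG.continuousAt.preimage_mem_nhds (hW.mem_nhds ha)] with z hz hzW
  exact (hH.differentiableAt (hW.mem_nhds hzW)).comp z hz.differentiableAt

namespace LogChart

variable {n k : ℕ} {Q : MvPolynomial (Fin (n + 1)) ℂ} {F : ℂ → Fin (n + 1) → ℂ} {f : ℂ → Pn n}
  {a : ℂ}

/-- The logarithmic jet-coordinates of a curve `f`, as functions of `z`; the coordinate of index
`(j, i)` has order `j + 1`, as in `LogChart.jetCoord`. -/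
noncomputable def jetAlong (c : LogChart Q) (k : ℕ) (f : ℂ → Pn n) (z : ℂ)
    (p : Fin k × Fin n) : ℂ :=
  if p.2 ∈ c.logIndex then
    iteratedDeriv (p.1 : ℕ) (logDeriv fun w => c.coord (f w) p.2) z
  else
    iteratedDeriv ((p.1 : ℕ) + 1) (fun w => c.coord (f w) p.2) z

theorem jetCoord_translate (c : LogChart Q) (k : ℕ) {z : ℂ}
    (h : HolomorphicCurveAt (fun t => f (z + t)) 0) :
    c.jetCoord k ⟨fun t => f (z + t), h⟩ = c.jetAlong k f z := by
  funext p
  have hlogDeriv : (logDeriv fun t => c.coord (f (z + t)) p.2) =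
      fun t => logDeriv (fun w => c.coord (f w) p.2) (z + t) := by
    funext t
    rw [logDeriv_apply, logDeriv_apply, deriv_comp_const_add (f := fun w => c.coord (f w) p.2)]
  simp only [LogChart.jetCoord, jetAlong, hlogDeriv]
  rw [iteratedDeriv_comp_const_add (f := logDeriv fun w => c.coord (f w) p.2),
    iteratedDeriv_comp_const_add (f := fun w => c.coord (f w) p.2)]
  simp only [add_zero]

theorem analyticAt_coord (c : LogChart Q) (hF : IsReducedRepresentation F f)
    (ha : f a ∈ c.source) (i : Fin n) : AnalyticAt ℂ (fun w => c.coord (f w) i) a := by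
  simpa only [hF.onCone_eq] using analyticAt_comp_of_differentiableOn (hF.1.analyticAt a)
    c.isOpen_source (differentiableOn_pi.1 c.holomorphic i) (hF.mem_cone_iff.2 ha)

theorem coord_ne_zero (c : LogChart Q) {x : Pn n} (hx : x ∈ c.source) (hD : x ∉ hypersurface Q)
    {i : Fin n} (hi : i ∈ c.logIndex) : c.coord x i ≠ 0 := fun h =>
  hD ((c.mem_hypersurface_iff x hx).2 ⟨i, hi, h⟩)

theorem analyticAt_jetAlong (c : LogChart Q) (hF : IsReducedRepresentation F f)
    (ha : f a ∈ c.source) (hD : f a ∉ hypersurface Q) (p : Fin k × Fin n) :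
    AnalyticAt ℂ (fun z => c.jetAlong k f z p) a := by
  have hcoord := c.analyticAt_coord hF ha p.2
  by_cases hp : p.2 ∈ c.logIndex
  · simp only [jetAlong, if_pos hp]
    exact analyticAt_iteratedDeriv_logDeriv hcoord (c.coord_ne_zero ha hD hp) _
  · simp only [jetAlong, if_neg hp, iteratedDeriv_eq_iterate]
    exact hcoord.iterated_deriv _

theorem poleOrderLE_jetAlong (c : LogChart Q) (hF : IsReducedRepresentation F f)
    (ha : f a ∈ c.source) (p : Fin k × Fin n) :
    PoleOrderLE (fun z => c.jetAlong k f z p) a ((p.1 : ℕ) + 1) := by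
  have hcoord := c.analyticAt_coord hF ha p.2
  by_cases hp : p.2 ∈ c.logIndex
  · simp only [jetAlong, if_pos hp]
    rw [add_comm]
    exact (poleOrderLE_logDeriv hcoord.meromorphicAt).iteratedDeriv _
  · simp only [jetAlong, if_neg hp, iteratedDeriv_eq_iterate]
    exact poleOrderLE_of_analyticAt (hcoord.iterated_deriv _) _

end LogChart

/-- `A` represents the jet differential `P` in the chart `c`: these are the four conditions on the
coefficients in `LogJetDifferential.local_form`. -/
structure IsLocalForm {n : ℕ} {Q : MvPolynomial (Fin (n + 1)) ℂ} {k m μ : ℕ}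
    (P : LogJetDifferential Q k m μ) (c : LogChart Q)
    (A : (Fin (n + 1) → ℂ) → MvPolynomial (Fin k × Fin n) ℂ) : Prop where
  weighted : ∀ v ∈ cone c.source,
    (A v).IsWeightedHomogeneous (fun p : Fin k × Fin n => (p.1 : ℕ) + 1) m
  holomorphic : ∀ α : (Fin k × Fin n) →₀ ℕ,
    DifferentiableOn ℂ (fun v => (A v).coeff α) (cone c.source)
  smul_eq : ∀ v ∈ cone c.source, ∀ a : ℂ, a ≠ 0 → A (a • v) = (a ^ μ)⁻¹ • A v
  toFun_eq : ∀ g : CurveGerm n, g.1 0 ∈ c.source → g.1 0 ∉ hypersurface Q →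
    ∀ (v : Fin (n + 1) → ℂ) (h : v ≠ 0), Projectivization.mk ℂ v h = g.1 0 →
      P.toFun (g.jet k) v = MvPolynomial.eval (c.jetCoord k g) (A v)

theorem LogJetDifferential.exists_isLocalForm {n : ℕ} {Q : MvPolynomial (Fin (n + 1)) ℂ}
    {k m μ : ℕ} (P : LogJetDifferential Q k m μ) (x : Pn n) :
    ∃ (c : LogChart Q) (A : _), x ∈ c.source ∧ IsLocalForm P c A := by
  obtain ⟨c, hx, A, hweighted, hholomorphic, hsmul, htoFun⟩ := P.local_form x
  exact ⟨c, A, hx, hweighted, hholomorphic, hsmul, htoFun⟩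

section CurveJet

variable {n d k m μ : ℕ} {Q : MvPolynomial (Fin (n + 1)) ℂ} {P : LogJetDifferential Q k m μ}
  {c : LogChart Q} {A : (Fin (n + 1) → ℂ) → MvPolynomial (Fin k × Fin n) ℂ}
  {F : ℂ → Fin (n + 1) → ℂ} {f : ℂ → Pn n}

theorem IsReducedRepresentation.eventually_mem_source (hF : IsReducedRepresentation F f) {a : ℂ}
    (c : LogChart Q) (ha : f a ∈ c.source) : ∀ᶠ z in 𝓝 a, f z ∈ c.source := by
  filter_upwards [hF.1.continuous.continuousAt.preimage_mem_nhds
    (c.isOpen_source.mem_nhds (hF.mem_cone_iff.2 ha))] with z hz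
  exact hF.mem_cone_iff.1 hz

theorem differentiable_mvPolynomial_eval {σ : Type*} [Finite σ] (Q : MvPolynomial σ ℂ) :
    Differentiable ℂ fun v : σ → ℂ => MvPolynomial.eval v Q := by
  have := Fintype.ofFinite σ
  simp only [MvPolynomial.eval_eq']
  fun_prop

theorem differentiable_eval_comp (hF : Differentiable ℂ F) (Q : MvPolynomial (Fin (n + 1)) ℂ) :
    Differentiable ℂ fun z => MvPolynomial.eval (F z) Q :=
  (differentiable_mvPolynomial_eval Q).comp hF

theorem IsLocalForm.analyticAt_coeff (hA : IsLocalForm P c A) (hF : IsReducedRepresentation F f)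
    {a : ℂ} (ha : f a ∈ c.source) (α : (Fin k × Fin n) →₀ ℕ) :
    AnalyticAt ℂ (fun z => (A (F z)).coeff α) a :=
  analyticAt_comp_of_differentiableOn (hF.1.analyticAt a) c.isOpen_source (hA.holomorphic α)
    (hF.mem_cone_iff.2 ha)

theorem IsLocalForm.toFun_curveJet_eq_sum (hA : IsLocalForm P c A) (hf : IsEntireCurve f) {z : ℂ}
    {v : Fin (n + 1) → ℂ} (hv : v ≠ 0) (hvf : Projectivization.mk ℂ v hv = f z)
    (hz : f z ∈ c.source) (hzD : f z ∉ hypersurface Q) :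
    P.toFun (curveJet k f hf z) v = ∑ α ∈ jetExponents k n m,
      (A v).coeff α * ∏ p, c.jetAlong k f z p ^ α p := by
  rw [← eval_eq_sum_jetExponents (hA.weighted v ⟨hv, by rwa [hvf]⟩),
    ← c.jetCoord_translate k (hf z).translate]
  exact hA.toFun_eq ⟨fun t => f (z + t), (hf z).translate⟩ (by simpa using hz)
    (by simpa using hzD) v hv (by simpa using hvf)

theorem LogJetDifferential.analyticAt_curveJet (P : LogJetDifferential Q k m μ)
    (hQ : Q.IsHomogeneous d) (hf : IsEntireCurve f) (hF : IsReducedRepresentation F f) {a : ℂ}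
    (ha : MvPolynomial.eval (F a) Q ≠ 0) :
    AnalyticAt ℂ (fun z => P.toFun (curveJet k f hf z) (F z)) a := by
  obtain ⟨c, A, hac, hA⟩ := P.exists_isLocalForm (f a)
  have hD : ∀ z, MvPolynomial.eval (F z) Q ≠ 0 → f z ∉ hypersurface Q := fun z hz h =>
    hz ((hF.mem_hypersurface_iff hQ).1 h)
  have hsum : AnalyticAt ℂ (fun z => ∑ α ∈ jetExponents k n m,
      (A (F z)).coeff α * ∏ p, c.jetAlong k f z p ^ α p) a :=
    Finset.analyticAt_fun_sum _ fun α _ => (hA.analyticAt_coeff hF hac α).fun_mul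
      (Finset.analyticAt_fun_prod _ fun p _ =>
        (c.analyticAt_jetAlong hF hac (hD a ha) p).fun_pow _)
  refine hsum.congr ?_
  filter_upwards [hF.eventually_mem_source c hac,
    (differentiable_eval_comp hF.1 Q).continuous.continuousAt.eventually_ne ha] with z hz hQz
  exact (hA.toFun_curveJet_eq_sum hf (hF.ne_zero z) (hF.2 z).2 hz (hD z hQz)).symm

theorem LogJetDifferential.poleOrderLE_curveJet (P : LogJetDifferential Q k m μ)
    (hQ : Q.IsHomogeneous d) (hf : IsEntireCurve f) (hF : IsReducedRepresentation F f)
    (hQF : ∃ z, MvPolynomial.eval (F z) Q ≠ 0) (a : ℂ) :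
    PoleOrderLE (fun z => P.toFun (curveJet k f hf z) (F z)) a m := by
  obtain ⟨c, A, hac, hA⟩ := P.exists_isLocalForm (f a)
  have hsum : PoleOrderLE (fun z => ∑ α ∈ jetExponents k n m,
      (A (F z)).coeff α * ∏ p, c.jetAlong k f z p ^ α p) a m := by
    refine PoleOrderLE.sum _ fun α hα => ?_
    have hmonomial := (poleOrderLE_of_analyticAt (hA.analyticAt_coeff hF hac α) 0).mul
      (PoleOrderLE.prod Finset.univ fun p _ =>
        (c.poleOrderLE_jetAlong (k := k) hF hac p).pow (α p))
    rwa [mem_jetExponents.1 hα, zero_add] at hmonomial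
  refine hsum.congr ?_
  filter_upwards [(hF.eventually_mem_source c hac).filter_mono nhdsWithin_le_nhds,
    eventually_nhdsNE_ne_zero (differentiable_eval_comp hF.1 Q) hQF a] with z hz hQz
  exact (hA.toFun_curveJet_eq_sum hf (hF.ne_zero z) (hF.2 z).2 hz
    fun h => hQz ((hF.mem_hypersurface_iff hQ).1 h)).symm

end CurveJet

section TruncatedCounting

variable {u h : ℂ → ℂ} {a : ℂ} {r : ℝ}

theorem intervalIntegrable_indicator_div (ρ : ℝ) (hr : 1 ≤ r) :
    IntervalIntegrable (fun t : ℝ => (if ρ < t then (1 : ℝ) else 0) / t) volume 1 r := by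
  have hinv : IntervalIntegrable (fun t : ℝ => t⁻¹) volume 1 r := by
    refine intervalIntegral.intervalIntegrable_inv (fun x hx => ?_) continuousOn_id
    rw [Set.uIcc_of_le hr] at hx
    exact (zero_lt_one.trans_le hx.1).ne'
  have hmeas : Measurable fun t : ℝ => (if ρ < t then (1 : ℝ) else 0) / t :=
    (Measurable.ite measurableSet_Ioi measurable_const measurable_const).div measurable_id
  refine hinv.mono_fun hmeas.aestronglyMeasurable (Eventually.of_forall fun t => ?_)
  by_cases ht : ρ < t <;> simp [ht]

theorem integral_indicator_div {ρ : ℝ} (hr : 1 ≤ r) (hρ : ρ ≤ r) :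
    ∫ t in (1 : ℝ)..r, (if ρ < t then (1 : ℝ) else 0) / t = Real.log (r / max 1 ρ) := by
  have hM1 : 1 ≤ max 1 ρ := le_max_left _ _
  have hMr : max 1 ρ ≤ r := max_le hr hρ
  have hintegrable := intervalIntegrable_indicator_div ρ hr
  have hbelow : ∫ t in (1 : ℝ)..max 1 ρ, (if ρ < t then (1 : ℝ) else 0) / t = 0 := by
    refine (intervalIntegral.integral_congr_Ioo_of_le hM1 fun t ht => ?_).trans
      intervalIntegral.integral_zero
    have hρt : ¬ρ < t := ((lt_max_iff.1 ht.2).resolve_left ht.1.not_gt).not_gt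
    simp only [if_neg hρt, zero_div]
  have habove : ∫ t in max 1 ρ..r, (if ρ < t then (1 : ℝ) else 0) / t =
      ∫ t in max 1 ρ..r, t⁻¹ := by
    refine intervalIntegral.integral_congr_Ioo_of_le hMr fun t ht => ?_
    simp only [if_pos ((le_max_right 1 ρ).trans_lt ht.1), one_div]
  rw [← intervalIntegral.integral_add_adjacent_intervals (b := max 1 ρ)
      (hintegrable.mono_set (Set.uIcc_subset_uIcc_left (Set.mem_uIcc_of_le hM1 hMr)))
      (hintegrable.mono_set (Set.uIcc_subset_uIcc_right (Set.mem_uIcc_of_le hM1 hMr))),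
    hbelow, habove, zero_add, integral_inv_of_pos (by linarith) (by linarith)]

theorem mem_zerosAndPoles_of_differentiable (hd : Differentiable ℂ h) (h0 : ∃ z, h z ≠ 0) :
    a ∈ zerosAndPoles (meromorphic_of_differentiable hd) r ↔ ‖a‖ < r ∧ h a = 0 := by
  rw [← mem_ball_zero_iff]
  by_cases ha : a ∈ ball 0 r
  · rw [mem_zerosAndPoles,
      MeromorphicOn.divisor_apply (meromorphic_of_differentiable hd).meromorphicOn ha, Ne,
      WithTop.untop₀_eq_zero, or_iff_left (meromorphicOrderAt_ne_top_of_differentiable hd h0 a),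
      (hd.analyticAt a).meromorphicNFAt.meromorphicOrderAt_eq_zero_iff, not_not,
      and_iff_right ha]
  · exact iff_of_false (fun hmem => ha (mem_ball_of_mem_zerosAndPoles hmem)) fun hmem => ha hmem.1

theorem toNat_min_one_analyticOrderAt (ha : AnalyticAt ℂ h a) :
    (min 1 (analyticOrderAt h a)).toNat = if h a = 0 then 1 else 0 := by
  split_ifs with hzero
  · rw [min_eq_left (Order.one_le_iff_ne_zero.2 (ha.analyticOrderAt_ne_zero.2 hzero)),
      ENat.toNat_one]
  · rw [ha.analyticOrderAt_eq_zero.2 hzero, min_eq_right zero_le_one, ENat.toNat_zero]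

theorem truncatedDegree_one_eq_sum (hd : Differentiable ℂ h) (h0 : ∃ z, h z ≠ 0) {t : ℝ}
    (htr : t ≤ r) :
    truncatedDegree 1 h t = ∑ a ∈ zerosAndPoles (meromorphic_of_differentiable hd) r,
      if ‖a‖ < t then 1 else 0 := by
  have hterm : ∀ a, (∑ᶠ _ : a ∈ ball (0 : ℂ) t, (min 1 (analyticOrderAt h a)).toNat) =
      if ‖a‖ < t ∧ h a = 0 then 1 else 0 := fun a => by
    classical
    rw [finsum_eq_if, toNat_min_one_analyticOrderAt (hd.analyticAt a), ← ite_and]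
    simp only [mem_ball_zero_iff]
  rw [truncatedDegree, finsum_eq_sum_of_support_subset (s := zerosAndPoles _ r)]
  · refine Finset.sum_congr rfl fun a ha => ?_
    rw [hterm]
    simp only [((mem_zerosAndPoles_of_differentiable hd h0).1 ha).2, and_true]
  · intro a ha
    rw [Function.mem_support, hterm, ite_ne_right_iff] at ha
    exact (mem_zerosAndPoles_of_differentiable hd h0).2 ⟨ha.1.1.trans_le htr, ha.1.2⟩

theorem countingFunction_one_eq_sum {n : ℕ} {F : ℂ → Fin (n + 1) → ℂ}
    {Q : MvPolynomial (Fin (n + 1)) ℂ} (hd : Differentiable ℂ fun z => MvPolynomial.eval (F z) Q)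
    (h0 : ∃ z, MvPolynomial.eval (F z) Q ≠ 0) (hr : 1 ≤ r) :
    countingFunction 1 F Q r = ∑ a ∈ zerosAndPoles (meromorphic_of_differentiable hd) r,
      Real.log (r / max 1 ‖a‖) := by
  calc countingFunction 1 F Q r
      = ∫ t in (1 : ℝ)..r, ∑ a ∈ zerosAndPoles (meromorphic_of_differentiable hd) r,
          (if ‖a‖ < t then (1 : ℝ) else 0) / t := by
        refine intervalIntegral.integral_congr fun t ht => ?_
        rw [Set.uIcc_of_le hr] at ht
        simp only [truncatedDegree_one_eq_sum hd h0 ht.2, Nat.cast_sum, Nat.cast_ite, Nat.cast_one,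
          Nat.cast_zero, Finset.sum_div]
    _ = _ := by
        rw [intervalIntegral.integral_finsetSum fun a _ => intervalIntegrable_indicator_div _ hr]
        exact Finset.sum_congr rfl fun a ha => integral_indicator_div hr
          (mem_ball_zero_iff.1 (mem_ball_of_mem_zerosAndPoles ha)).le

theorem PoleOrderLE.neg_le_untop₀ {p : ℕ} (hu : PoleOrderLE u a p) :
    -(p : ℝ) ≤ (meromorphicOrderAt u a).untop₀ := by
  have horder := hu.2
  rcases eq_or_ne (meromorphicOrderAt u a) ⊤ with htop | htop
  · simp [htop]
  · rw [← WithTop.coe_untop₀_of_ne_top htop, WithTop.coe_le_coe] at horder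
    exact_mod_cast horder

theorem circleAverage_log_norm_one_sub_le (hu : Meromorphic u) (hd : Differentiable ℂ h)
    (h0 : ∃ z, h z ≠ 0) {m : ℕ} (hpole : ∀ a, PoleOrderLE u a (if h a = 0 then m else 0))
    (hr : 1 ≤ r) :
    Real.circleAverage (fun z => Real.log ‖u z‖) 0 1 -
        m * ∑ a ∈ zerosAndPoles (meromorphic_of_differentiable hd) r, Real.log (r / max 1 ‖a‖) ≤
      Real.circleAverage (fun z => Real.log ‖u z‖) 0 r := by
  have hlog : ∀ {v : ℂ → ℂ} (hv : Meromorphic v), ∀ a ∈ zerosAndPoles hv r,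
      0 ≤ Real.log (r / max 1 ‖a‖) := fun hv a ha =>
    log_div_max_one_nonneg hr (mem_ball_zero_iff.1 (mem_ball_of_mem_zerosAndPoles ha)).le
  have hzeros : ∑ a ∈ zerosAndPoles hu r, ((if h a = 0 then m else 0 : ℕ) : ℝ) *
        Real.log (r / max 1 ‖a‖) ≤
      m * ∑ a ∈ zerosAndPoles (meromorphic_of_differentiable hd) r, Real.log (r / max 1 ‖a‖) := by
    simp only [Nat.cast_ite, Nat.cast_zero, ite_mul, zero_mul]
    rw [← Finset.sum_filter, Finset.mul_sum]
    refine Finset.sum_le_sum_of_subset_of_nonneg (fun a ha => ?_) fun a ha _ =>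
      mul_nonneg m.cast_nonneg (hlog _ a ha)
    obtain ⟨ha, hzero⟩ := Finset.mem_filter.1 ha
    exact (mem_zerosAndPoles_of_differentiable hd h0).2
      ⟨mem_ball_zero_iff.1 (mem_ball_of_mem_zerosAndPoles ha), hzero⟩
  have hpoles : -∑ a ∈ zerosAndPoles hu r, ((if h a = 0 then m else 0 : ℕ) : ℝ) *
        Real.log (r / max 1 ‖a‖) ≤
      ∑ a ∈ zerosAndPoles hu r,
        ((meromorphicOrderAt u a).untop₀ : ℝ) * Real.log (r / max 1 ‖a‖) := by
    rw [← Finset.sum_neg_distrib]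
    refine Finset.sum_le_sum fun a ha => ?_
    rw [← neg_mul]
    exact mul_le_mul_of_nonneg_right (hpole a).neg_le_untop₀ (hlog _ a ha)
  linarith [circleAverage_log_norm_sub_eq_sum hu hr]

theorem LogJetDifferential.circleAverage_log_norm_one_sub_le {n d k m μ : ℕ}
    {Q : MvPolynomial (Fin (n + 1)) ℂ} {F : ℂ → Fin (n + 1) → ℂ} {f : ℂ → Pn n}
    (P : LogJetDifferential Q k m μ) (hQ : Q.IsHomogeneous d) (hf : IsEntireCurve f)
    (hF : IsReducedRepresentation F f) (hQF : ∃ z, MvPolynomial.eval (F z) Q ≠ 0)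
    (hr : 1 ≤ r) :
    Real.circleAverage (fun z => Real.log ‖P.toFun (curveJet k f hf z) (F z)‖) 0 1 -
        m * countingFunction 1 F Q r ≤
      Real.circleAverage (fun z => Real.log ‖P.toFun (curveJet k f hf z) (F z)‖) 0 r := by
  have hd := differentiable_eval_comp hF.1 Q
  rw [countingFunction_one_eq_sum hd hQF hr]
  refine _root_.circleAverage_log_norm_one_sub_le
    (fun a => (P.poleOrderLE_curveJet hQ hf hF hQF a).1) hd hQF (fun a => ?_) hr
  split_ifs with ha
  · exact P.poleOrderLE_curveJet hQ hf hF hQF a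
  · exact poleOrderLE_of_analyticAt (P.analyticAt_curveJet hQ hf hF ha) 0

end TruncatedCounting

/-! ### Bounds on jet differentials -/

theorem hasFDerivAt_mvPolynomial_eval {𝕜 σ : Type*} [NontriviallyNormedField 𝕜] [Fintype σ]
    (Q : MvPolynomial σ 𝕜) (v : σ → 𝕜) :
    HasFDerivAt (fun v : σ → 𝕜 => MvPolynomial.eval v Q)
      (∑ i, MvPolynomial.eval v (MvPolynomial.pderiv i Q) •
        (ContinuousLinearMap.proj i : (σ → 𝕜) →L[𝕜] 𝕜)) v := by
  classical
  induction Q using MvPolynomial.induction_on with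
  | C a =>
    simp only [MvPolynomial.eval_C]
    exact (hasFDerivAt_const a v).congr_fderiv (ContinuousLinearMap.ext fun w => by simp)
  | add p q hp hq =>
    simp only [map_add]
    refine (hp.fun_add hq).congr_fderiv (ContinuousLinearMap.ext fun w => ?_)
    simp [add_mul, Finset.sum_add_distrib]
  | mul_X p j hp =>
    simp only [map_mul, MvPolynomial.eval_X]
    refine (hp.fun_mul (hasFDerivAt_apply j v)).congr_fderiv (ContinuousLinearMap.ext fun w => ?_)
    simp [Derivation.leibniz, MvPolynomial.pderiv_X, Pi.single_apply, apply_ite, add_mul,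
      Finset.sum_add_distrib, Finset.mul_sum, mul_assoc]

theorem fderiv_mvPolynomial_eval_ne_zero {𝕜 σ : Type*} [NontriviallyNormedField 𝕜] [Finite σ]
    {Q : MvPolynomial σ 𝕜} {v : σ → 𝕜} {i : σ}
    (h : MvPolynomial.eval v (MvPolynomial.pderiv i Q) ≠ 0) :
    fderiv 𝕜 (fun v : σ → 𝕜 => MvPolynomial.eval v Q) v ≠ 0 := by
  classical
  have := Fintype.ofFinite σ
  intro hzero
  refine h ?_
  have happly := congrArg (fun L => L (Pi.single i 1)) hzero
  simpa [(hasFDerivAt_mvPolynomial_eval Q v).fderiv, Pi.single_apply] using happly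

theorem iteratedDeriv_apply {𝕜 ι : Type*} [NontriviallyNormedField 𝕜] [Fintype ι] {E : ι → Type*}
    [∀ s, NormedAddCommGroup (E s)] [∀ s, NormedSpace 𝕜 (E s)] {G : 𝕜 → ∀ s, E s} {z : 𝕜} {i : ℕ}
    (hG : ContDiffAt 𝕜 i G z) (s : ι) :
    iteratedDeriv i G z s = iteratedDeriv i (fun w => G w s) z := by
  rw [iteratedDeriv_eq_iteratedFDeriv, iteratedDeriv_eq_iteratedFDeriv]
  exact (congrArg (fun L => L fun _ => (1 : 𝕜)) ((ContinuousLinearMap.proj (R := 𝕜)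
    (φ := E) s).iteratedFDeriv_comp_left hG le_rfl)).symm

theorem logDeriv_mul_exp_eventuallyEq {u g : ℂ → ℂ} {z : ℂ} (hu : AnalyticAt ℂ u z)
    (h0 : u z ≠ 0) (hg : AnalyticAt ℂ g z) :
    logDeriv (fun w => u w * Complex.exp (g w)) =ᶠ[𝓝 z] fun w => logDeriv u w + deriv g w := by
  filter_upwards [hu.eventually_analyticAt, hu.continuousAt.eventually_ne h0,
    hg.eventually_analyticAt] with w hw hw0 hgw
  rw [logDeriv_mul (g := fun w => Complex.exp (g w)) w hw0 (Complex.exp_ne_zero _)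
    hw.differentiableAt hgw.differentiableAt.cexp, logDeriv_apply (fun w => Complex.exp (g w)),
    hgw.differentiableAt.hasDerivAt.cexp.deriv, mul_div_cancel_left₀ _ (Complex.exp_ne_zero _)]

theorem iteratedDeriv_logDeriv_mul_exp {u g : ℂ → ℂ} {z : ℂ} (hu : AnalyticAt ℂ u z)
    (h0 : u z ≠ 0) (hg : AnalyticAt ℂ g z) (j : ℕ) :
    iteratedDeriv j (logDeriv fun w => u w * Complex.exp (g w)) z =
      iteratedDeriv j (logDeriv u) z + iteratedDeriv (j + 1) g z := by
  have hlogDeriv : AnalyticAt ℂ (logDeriv u) z := hu.deriv.div hu h0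
  rw [(logDeriv_mul_exp_eventuallyEq hu h0 hg).iteratedDeriv_eq,
    iteratedDeriv_fun_add hlogDeriv.contDiffAt hg.deriv.contDiffAt, ← iteratedDeriv_succ']

theorem exists_eventuallyEq_mul_exp {u : ℂ → ℂ} {z : ℂ} (hu : AnalyticAt ℂ u z) (h0 : u z ≠ 0) :
    ∃ L : ℂ → ℂ, AnalyticAt ℂ L z ∧ L z = 0 ∧ (u =ᶠ[𝓝 z] fun w => u z * Complex.exp (L w)) ∧
      deriv L =ᶠ[𝓝 z] logDeriv u := by
  have hlog : AnalyticAt ℂ (fun w => Complex.log (u w / u z)) z :=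
    (hu.fun_div analyticAt_const h0).clog (by rw [div_self h0]; exact Complex.one_mem_slitPlane)
  have hexp : u =ᶠ[𝓝 z] fun w => u z * Complex.exp (Complex.log (u w / u z)) := by
    filter_upwards [hu.continuousAt.eventually_ne h0] with w hw
    rw [Complex.exp_log (div_ne_zero hw h0), mul_div_cancel₀ _ h0]
  refine ⟨_, hlog, by simp only [div_self h0, Complex.log_one], hexp, ?_⟩
  filter_upwards [hexp.eventuallyEq_nhds,
    logDeriv_mul_exp_eventuallyEq (u := fun _ => u z) analyticAt_const h0 hlog] with w hw hlogw
  rw [logDeriv_apply u, hw.deriv_eq, hw.eq_of_nhds, ← logDeriv_apply, hlogw, logDeriv_const,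
    Pi.zero_apply, zero_add]

theorem exists_bound_iteratedDeriv_of_logDeriv (k : ℕ) :
    ∃ C : ℝ, 1 ≤ C ∧ ∀ (u : ℂ → ℂ) (z : ℂ) (D : ℝ), AnalyticAt ℂ u z → u z ≠ 0 → ‖u z‖ ≤ 1 →
      1 ≤ D → (∀ j < k, ‖iteratedDeriv j (logDeriv u) z‖ ≤ D) →
      ∀ i ≤ k, ‖iteratedDeriv i u z‖ ≤ C * D ^ k := by
  obtain ⟨V, hV, C, hC, hbound⟩ := exists_bound_iteratedDeriv_comp (isOpen_univ (X := ℂ))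
    Complex.differentiable_exp.differentiableOn (Set.mem_univ (0 : ℂ)) k
  refine ⟨C + 1, by linarith, fun u z D hu h0 hle hD hlogDeriv i hi => ?_⟩
  obtain ⟨L, hL, hLz, hexp, hderiv⟩ := exists_eventuallyEq_mul_exp hu h0
  have hiteratedDeriv : ∀ j, 1 ≤ j → j ≤ k → ‖iteratedDeriv j L z‖ ≤ D := by
    rintro (_ | j) hj hjk
    · lia
    · rw [iteratedDeriv_succ', hderiv.iteratedDeriv_eq]
      exact hlogDeriv j hjk
  rw [hexp.iteratedDeriv_eq, iteratedDeriv_const_mul_field, norm_mul]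
  calc ‖u z‖ * ‖iteratedDeriv i (fun w => Complex.exp (L w)) z‖
      ≤ 1 * (C * D ^ k) := by
        gcongr
        exact hbound L z D hL (hLz ▸ mem_of_mem_nhds hV) hD hiteratedDeriv i hi
    _ ≤ (C + 1) * D ^ k := by
        rw [one_mul]
        gcongr
        linarith

/-- `G` is a local holomorphic representation of `f` near `z`, that is, `f = [G]` there. -/
def RepresentsAt {n : ℕ} (G : ℂ → Fin (n + 1) → ℂ) (f : ℂ → Pn n) (z : ℂ) : Prop :=
  AnalyticAt ℂ G z ∧ ∀ᶠ w in 𝓝 z, ∃ h : G w ≠ 0, Projectivization.mk ℂ (G w) h = f w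

/-- `D ≥ 1` bounds the `k`-jet at `z ∉ f⁻¹(D)` of a local representation `G` of `f` together with
the logarithmic `k`-jet of `Q ∘ G`; the value `G z` itself is not bounded. -/
structure IsJetBound {n : ℕ} (Q : MvPolynomial (Fin (n + 1)) ℂ) (k : ℕ) (f : ℂ → Pn n)
    (G : ℂ → Fin (n + 1) → ℂ) (z : ℂ) (D : ℝ) : Prop where
  representsAt : RepresentsAt G f z
  eval_ne_zero : MvPolynomial.eval (G z) Q ≠ 0
  one_le : 1 ≤ D
  norm_iteratedDeriv_le : ∀ i, 1 ≤ i → i ≤ k → ‖iteratedDeriv i G z‖ ≤ D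
  norm_iteratedDeriv_logDeriv_le : ∀ j < k,
    ‖iteratedDeriv j (logDeriv fun w => MvPolynomial.eval (G w) Q) z‖ ≤ D

section LocalBound

variable {n d k m μ : ℕ} {Q : MvPolynomial (Fin (n + 1)) ℂ} {f : ℂ → Pn n}
  {G : ℂ → Fin (n + 1) → ℂ} {z : ℂ} {v : Fin (n + 1) → ℂ}

theorem RepresentsAt.onCone_eventuallyEq (hG : RepresentsAt G f z) {E : Type*} [Zero E]
    (φ : Pn n → E) : (fun w => φ (f w)) =ᶠ[𝓝 z] fun w => onCone φ (G w) := by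
  filter_upwards [hG.2] with w ⟨h, hw⟩
  rw [onCone_of_ne_zero φ h, hw]

theorem ProjChart.fderiv_coord_ne_zero (c : ProjChart n) (hv : v ∈ cone c.source) (i : Fin n) :
    fderiv ℂ (fun v => onCone c.coord v i) v ≠ 0 := by
  intro hzero
  obtain ⟨w, hw⟩ := c.submersive v hv (Pi.single i 1)
  have hderiv : HasFDerivAt (fun v => onCone c.coord v i)
      ((ContinuousLinearMap.proj i).comp (fderiv ℂ (onCone c.coord) v)) v :=
    hasFDerivAt_pi'.1 (c.holomorphic.differentiableAt (c.isOpen_source.mem_nhds hv)).hasFDerivAt i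
  rw [hderiv.fderiv] at hzero
  simpa [hw] using congrArg (fun L => L w) hzero

theorem LogChart.eval_eq_zero_iff (c : LogChart Q) (hQ : Q.IsHomogeneous d)
    (hv : v ∈ cone c.source) {i : Fin n} (hi : i ∈ c.logIndex) :
    MvPolynomial.eval v Q = 0 ↔ onCone c.coord v i = 0 := by
  obtain ⟨h0, hsource⟩ := hv
  rw [← mk_mem_hypersurface_iff hQ h0, c.mem_hypersurface_iff _ hsource,
    onCone_of_ne_zero c.coord h0]
  refine ⟨fun ⟨j, hj, hzero⟩ => ?_, fun hzero => ⟨i, hi, hzero⟩⟩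
  rwa [Option.mem_unique hi hj]

theorem LogChart.exists_coord_eq_eval_mul_exp (c : LogChart Q) (hQ : IsSmoothEquation Q d)
    (hv : v ∈ cone c.source) {i : Fin n} (hi : i ∈ c.logIndex) :
    ∃ (V : Set (Fin (n + 1) → ℂ)) (ℓ : (Fin (n + 1) → ℂ) → ℂ), IsOpen V ∧ v ∈ V ∧
      DifferentiableOn ℂ ℓ V ∧
      ∀ w ∈ V, onCone c.coord w i = MvPolynomial.eval w Q * Complex.exp (ℓ w) := by
  obtain ⟨V, ℓ, hV, hvV, -, hℓ, hmul⟩ := exists_eq_mul_exp_of_zeros_eq c.isOpen_source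
    (differentiableOn_pi.1 c.holomorphic i) (differentiable_mvPolynomial_eval Q).differentiableOn hv
    (fun hzero => (hQ.smooth v hv.1 hzero).elim fun _ => fderiv_mvPolynomial_eval_ne_zero)
    (fun _ => c.fderiv_coord_ne_zero hv i) fun w hw => c.eval_eq_zero_iff hQ.homogeneous hw hi
  exact ⟨V, ℓ, hV, hvV, hℓ, hmul⟩

theorem LogChart.exists_bound_iteratedDeriv_logDeriv_coord (c : LogChart Q)
    (hQ : IsSmoothEquation Q d) (hv : v ∈ cone c.source) {i : Fin n} (hi : i ∈ c.logIndex)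
    (k : ℕ) :
    ∃ V ∈ 𝓝 v, ∃ C : ℝ, 0 ≤ C ∧ ∀ (f : ℂ → Pn n) (G : ℂ → Fin (n + 1) → ℂ) (z : ℂ) (D : ℝ),
      IsJetBound Q k f G z D → G z ∈ V → ∀ j < k,
        ‖iteratedDeriv j (logDeriv fun w => c.coord (f w) i) z‖ ≤ C * D ^ k := by
  obtain ⟨V, ℓ, hV, hvV, hℓ, hmul⟩ := c.exists_coord_eq_eval_mul_exp hQ hv hi
  obtain ⟨V', hV', C, hC, hbound⟩ := exists_bound_iteratedDeriv_comp hV hℓ hvV k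
  refine ⟨V ∩ V', inter_mem (hV.mem_nhds hvV) hV', 1 + C, by positivity, ?_⟩
  intro f G z D h ⟨hzV, hzV'⟩ j hj
  have hG := h.representsAt.1
  have hcoord : (fun w => c.coord (f w) i) =ᶠ[𝓝 z]
      fun w => MvPolynomial.eval (G w) Q * Complex.exp (ℓ (G w)) := by
    filter_upwards [h.representsAt.onCone_eventuallyEq c.coord,
      hG.continuousAt.preimage_mem_nhds (hV.mem_nhds hzV)] with w hw hwV
    rw [congrFun hw i, hmul _ hwV]
  have hlogDeriv : (logDeriv fun w => c.coord (f w) i) =ᶠ[𝓝 z]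
      logDeriv fun w => MvPolynomial.eval (G w) Q * Complex.exp (ℓ (G w)) := by
    filter_upwards [hcoord.eventuallyEq_nhds] with w hw
    rw [logDeriv_apply, hw.deriv_eq, hw.eq_of_nhds, ← logDeriv_apply]
  have hQG : AnalyticAt ℂ (fun w => MvPolynomial.eval (G w) Q) z :=
    analyticAt_comp_of_differentiableOn hG isOpen_univ
      (differentiable_mvPolynomial_eval Q).differentiableOn (Set.mem_univ _)
  rw [hlogDeriv.iteratedDeriv_eq, iteratedDeriv_logDeriv_mul_exp hQG h.eval_ne_zero
    (analyticAt_comp_of_differentiableOn hG hV hℓ hzV), add_mul, one_mul]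
  exact norm_add_le_of_le
    ((h.norm_iteratedDeriv_logDeriv_le j hj).trans (le_self_pow₀ h.one_le (by lia)))
    (hbound G z D hG hzV' h.one_le h.norm_iteratedDeriv_le (j + 1) hj)

theorem LogChart.exists_bound_jetAlong (c : LogChart Q) (hQ : IsSmoothEquation Q d)
    (hv : v ∈ cone c.source) (p : Fin k × Fin n) :
    ∃ V ∈ 𝓝 v, ∃ C : ℝ, 0 ≤ C ∧ ∀ (f : ℂ → Pn n) (G : ℂ → Fin (n + 1) → ℂ) (z : ℂ) (D : ℝ),
      IsJetBound Q k f G z D → G z ∈ V → ‖c.jetAlong k f z p‖ ≤ C * D ^ k := by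
  by_cases hp : p.2 ∈ c.logIndex
  · obtain ⟨V, hV, C, hC, hbound⟩ := c.exists_bound_iteratedDeriv_logDeriv_coord hQ hv hp k
    refine ⟨V, hV, C, hC, fun f G z D h hzV => ?_⟩
    rw [LogChart.jetAlong, if_pos hp]
    exact hbound f G z D h hzV p.1 p.1.2
  · obtain ⟨V, hV, C, hC, hbound⟩ := exists_bound_iteratedDeriv_comp c.isOpen_source
      (differentiableOn_pi.1 c.holomorphic p.2) hv k
    refine ⟨V, hV, C, hC, fun f G z D h hzV => ?_⟩
    have hcoord : (fun w => c.coord (f w) p.2) =ᶠ[𝓝 z] fun w => onCone c.coord (G w) p.2 :=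
      (h.representsAt.onCone_eventuallyEq c.coord).fun_comp fun x => x p.2
    rw [LogChart.jetAlong, if_neg hp, hcoord.iteratedDeriv_eq]
    exact hbound G z D h.representsAt.1 hzV h.one_le h.norm_iteratedDeriv_le _ p.1.2

theorem LogChart.exists_bound_jetAlong_uniform (c : LogChart Q) (hQ : IsSmoothEquation Q d)
    (hv : v ∈ cone c.source) (k : ℕ) :
    ∃ V ∈ 𝓝 v, ∃ M : ℝ, 1 ≤ M ∧ ∀ (f : ℂ → Pn n) (G : ℂ → Fin (n + 1) → ℂ) (z : ℂ) (D : ℝ),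
      IsJetBound Q k f G z D → G z ∈ V → ∀ p, ‖c.jetAlong k f z p‖ ≤ M * D ^ k := by
  choose V hV C hC hbound using fun p : Fin k × Fin n => c.exists_bound_jetAlong hQ hv p
  refine ⟨⋂ p, V p, iInter_mem.2 hV, 1 + ∑ p, C p,
    le_add_of_nonneg_right (Finset.sum_nonneg fun p _ => hC p), fun f G z D h hzV p => ?_⟩
  have : 0 ≤ D := zero_le_one.trans h.one_le
  refine (hbound p f G z D h (Set.mem_iInter.1 hzV p)).trans ?_
  gcongr
  linarith [Finset.single_le_sum (f := C) (fun p _ => hC p) (Finset.mem_univ p)]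

theorem norm_prod_pow_le_of_mem_jetExponents {α : (Fin k × Fin n) →₀ ℕ}
    (hα : α ∈ jetExponents k n m) {y : Fin k × Fin n → ℂ} {M : ℝ} (hM : 1 ≤ M)
    (hy : ∀ p, ‖y p‖ ≤ M) : ‖∏ p, y p ^ α p‖ ≤ M ^ m := by
  calc ‖∏ p, y p ^ α p‖ ≤ ∏ p, M ^ α p := by
        rw [norm_prod]
        gcongr with p
        rw [norm_pow]
        gcongr
        exact hy p
    _ = M ^ ∑ p, α p := Finset.prod_pow_eq_pow_sum _ _ _
    _ ≤ M ^ m := by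
        refine pow_le_pow_right₀ hM ?_
        rw [← mem_jetExponents.1 hα]
        exact Finset.sum_le_sum fun p _ => Nat.le_mul_of_pos_right _ (Nat.succ_pos _)

variable {P : LogJetDifferential Q k m μ}

theorem IsLocalForm.eventually_norm_coeff_le {c : LogChart Q}
    {A : (Fin (n + 1) → ℂ) → MvPolynomial (Fin k × Fin n) ℂ} (hA : IsLocalForm P c A)
    (hv : v ∈ cone c.source) : ∀ᶠ w in 𝓝 v, ∀ α ∈ jetExponents k n m,
      ‖(A w).coeff α‖ ≤ ‖(A v).coeff α‖ + 1 := by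
  refine (Filter.eventually_all_finset _).2 fun α _ => ?_
  have hcont := ((hA.holomorphic α).continuousOn.continuousAt (c.isOpen_source.mem_nhds hv)).norm
  exact (hcont.eventually_lt continuousAt_const (lt_add_one _)).mono fun w hw => hw.le

theorem LogJetDifferential.exists_local_bound (P : LogJetDifferential Q k m μ)
    (hQ : IsSmoothEquation Q d) (hv : v ≠ 0) :
    ∃ V ∈ 𝓝 v, ∃ C : ℝ, 0 ≤ C ∧ ∀ (f : ℂ → Pn n) (hf : IsEntireCurve f)
      (G : ℂ → Fin (n + 1) → ℂ) (z : ℂ) (D : ℝ), IsJetBound Q k f G z D → G z ∈ V →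
      ‖P.toFun (curveJet k f hf z) (G z)‖ ≤ C * (D ^ k) ^ m := by
  obtain ⟨c, A, hc, hA⟩ := P.exists_isLocalForm (Projectivization.mk ℂ v hv)
  have hvc : v ∈ cone c.source := ⟨hv, hc⟩
  obtain ⟨V, hV, M, hM, hbound⟩ := c.exists_bound_jetAlong_uniform hQ hvc k
  refine ⟨V ∩ {w | ∀ α ∈ jetExponents k n m, ‖(A w).coeff α‖ ≤ ‖(A v).coeff α‖ + 1} ∩
      cone c.source, inter_mem (inter_mem hV (hA.eventually_norm_coeff_le hvc))
      (c.isOpen_source.mem_nhds hvc),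
    (∑ α ∈ jetExponents k n m, (‖(A v).coeff α‖ + 1)) * M ^ m, by positivity, ?_⟩
  rintro f hf G z D h ⟨⟨hzV, hcoeff⟩, _, hsource⟩
  obtain ⟨hG0, hGf⟩ := h.representsAt.2.self_of_nhds
  rw [hGf] at hsource
  have hzD : f z ∉ hypersurface Q := by
    rw [← hGf, mk_mem_hypersurface_iff hQ.homogeneous hG0]
    exact h.eval_ne_zero
  have hMD : 1 ≤ M * D ^ k := one_le_mul_of_one_le_of_one_le hM (one_le_pow₀ h.one_le)
  rw [hA.toFun_curveJet_eq_sum hf hG0 hGf hsource hzD, mul_assoc, ← mul_pow, Finset.sum_mul]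
  refine norm_sum_le_of_le _ fun α hα => ?_
  rw [norm_mul]
  gcongr
  · exact hcoeff α hα
  · exact norm_prod_pow_le_of_mem_jetExponents hα hMD (hbound f G z D h hzV)

theorem LogJetDifferential.exists_bound (P : LogJetDifferential Q k m μ)
    (hQ : IsSmoothEquation Q d) {K : Set (Fin (n + 1) → ℂ)} (hK : IsCompact K) (h0 : 0 ∉ K) :
    ∃ C : ℝ, 0 ≤ C ∧ ∀ (f : ℂ → Pn n) (hf : IsEntireCurve f)
      (G : ℂ → Fin (n + 1) → ℂ) (z : ℂ) (D : ℝ), IsJetBound Q k f G z D → G z ∈ K →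
      ‖P.toFun (curveJet k f hf z) (G z)‖ ≤ C * (D ^ k) ^ m := by
  refine hK.induction_on
    ⟨0, le_rfl, fun _ _ _ _ _ _ hmem => absurd hmem (Set.notMem_empty _)⟩
    (fun s t hst ⟨C, hC, h⟩ => ⟨C, hC, fun f hf G z D hD hmem => h f hf G z D hD (hst hmem)⟩)
    (fun s t ⟨C, hC, h⟩ ⟨C', hC', h'⟩ => ⟨C + C', by positivity, fun f hf G z D hD hmem => ?_⟩)
    fun v hv => ?_
  · have : 0 ≤ (D ^ k) ^ m := pow_nonneg (pow_nonneg (zero_le_one.trans hD.one_le) _) _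
    rcases hmem with hmem | hmem
    · exact (h f hf G z D hD hmem).trans (by gcongr; linarith)
    · exact (h' f hf G z D hD hmem).trans (by gcongr; linarith)
  · obtain ⟨V, hV, h⟩ := P.exists_local_bound hQ (ne_of_mem_of_not_mem hv h0)
    exact ⟨V, mem_nhdsWithin_of_mem_nhds hV, h⟩

theorem mk_smul_eq {a : ℂ} (ha : a ≠ 0) (hv : v ≠ 0) :
    Projectivization.mk ℂ (a • v) (smul_ne_zero ha hv) = Projectivization.mk ℂ v hv :=
  (Projectivization.mk_eq_mk_iff' ℂ _ _ _ _).2 ⟨a, rfl⟩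

theorem LogJetDifferential.toFun_smul (P : LogJetDifferential Q k m μ) (hf : IsEntireCurve f)
    (hv : v ≠ 0) (hvf : Projectivization.mk ℂ v hv = f z) (hzD : f z ∉ hypersurface Q) {a : ℂ}
    (ha : a ≠ 0) :
    P.toFun (curveJet k f hf z) (a • v) = (a ^ μ)⁻¹ * P.toFun (curveJet k f hf z) v := by
  obtain ⟨c, A, hc, hA⟩ := P.exists_isLocalForm (f z)
  rw [hA.toFun_curveJet_eq_sum hf hv hvf hc hzD, hA.toFun_curveJet_eq_sum hf (smul_ne_zero ha hv)
    ((mk_smul_eq ha hv).trans hvf) hc hzD, hA.smul_eq v ⟨hv, by rwa [hvf]⟩ a ha, Finset.mul_sum]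
  refine Finset.sum_congr rfl fun α _ => ?_
  rw [MvPolynomial.coeff_smul, smul_eq_mul, mul_assoc]

end LocalBound

section GlobalBound

variable {n d k m μ : ℕ} {Q : MvPolynomial (Fin (n + 1)) ℂ} {F : ℂ → Fin (n + 1) → ℂ}
  {f : ℂ → Pn n} {z : ℂ} {l : Fin (n + 1)}

/-- A point `z` where neither `Q ∘ F` nor any coordinate of `F` that is not identically zero
vanishes. -/
structure IsNonvanishingPoint (F : ℂ → Fin (n + 1) → ℂ) (Q : MvPolynomial (Fin (n + 1)) ℂ) (z : ℂ) :
    Prop where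
  eval_ne_zero : MvPolynomial.eval (F z) Q ≠ 0
  apply_ne_zero : ∀ i, (∃ w, F w i ≠ 0) → F z i ≠ 0

/-- The representation of `[F]` by vectors whose `l`-th coordinate is `1`; where `F w l = 0` it
takes the junk value `0`. -/
noncomputable def dehomogenization (F : ℂ → Fin (n + 1) → ℂ) (l : Fin (n + 1)) :
    ℂ → Fin (n + 1) → ℂ :=
  fun w => (F w l)⁻¹ • F w

/-- The quotients `F_s / F_l`, of index `some s`, and `Q(F) / F_l ^ d`, of index `none`: the
quotients to which the lemma on the logarithmic derivative is applied. -/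
noncomputable def quotientAlong (F : ℂ → Fin (n + 1) → ℂ) (Q : MvPolynomial (Fin (n + 1)) ℂ)
    (d : ℕ) : Option (Fin (n + 1)) → Fin (n + 1) → ℂ → ℂ
  | none, l => fun w => MvPolynomial.eval (F w) Q / F w l ^ d
  | some s, l => fun w => F w s / F w l

open Classical in
/-- The indices `(o, l, j)` for which the `j`-th derivative of the logarithmic derivative of
`quotientAlong F Q d o l` enters the bound for a jet differential: neither `F_l` nor, if
`o = some s`, `F_s` is identically zero. -/
noncomputable def quotientIndices (F : ℂ → Fin (n + 1) → ℂ) (k : ℕ) :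
    Finset (Option (Fin (n + 1)) × Fin (n + 1) × Fin k) :=
  {a | (∃ z, F z a.2.1 ≠ 0) ∧ ∀ s ∈ a.1, ∃ z, F z s ≠ 0}

/-- The size at `z` of the `j`-th derivative of the logarithmic derivative of
`quotientAlong F Q d o l`, where `a = (o, l, j)`. -/
noncomputable def quotientSize (F : ℂ → Fin (n + 1) → ℂ) (Q : MvPolynomial (Fin (n + 1)) ℂ)
    (d : ℕ) (a : Option (Fin (n + 1)) × Fin (n + 1) × Fin k) (z : ℂ) : ℝ :=
  ‖iteratedDeriv (a.2.2 : ℕ) (logDeriv (quotientAlong F Q d a.1 a.2.1)) z‖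

theorem mem_quotientIndices {a : Option (Fin (n + 1)) × Fin (n + 1) × Fin k} :
    a ∈ quotientIndices F k ↔ (∃ z, F z a.2.1 ≠ 0) ∧ ∀ s ∈ a.1, ∃ z, F z s ≠ 0 := by
  simp only [quotientIndices, Finset.mem_filter, Finset.mem_univ, true_and]

theorem quotientSize_nonneg (F : ℂ → Fin (n + 1) → ℂ) (Q : MvPolynomial (Fin (n + 1)) ℂ) (d : ℕ)
    (a : Option (Fin (n + 1)) × Fin (n + 1) × Fin k) (z : ℂ) : 0 ≤ quotientSize F Q d a z :=
  norm_nonneg _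

theorem le_prod_one_add {ι R : Type*} [CommRing R] [LinearOrder R] [IsStrictOrderedRing R]
    {s : Finset ι} {g : ι → R} (hg : ∀ b ∈ s, 0 ≤ g b) {a : ι} (ha : a ∈ s) :
    g a ≤ ∏ b ∈ s, (1 + g b) := by
  classical
  have hone : 1 ≤ ∏ b ∈ s.erase a, (1 + g b) := Finset.one_le_prod fun b hb =>
    le_add_of_nonneg_right (hg b (Finset.mem_of_mem_erase hb))
  rw [← Finset.mul_prod_erase _ _ ha]
  exact (le_add_of_nonneg_left zero_le_one).trans
    (le_mul_of_one_le_right (add_nonneg zero_le_one (hg a ha)) hone)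

theorem IsReducedRepresentation.representsAt_dehomogenization (hF : IsReducedRepresentation F f)
    (hl : F z l ≠ 0) : RepresentsAt (dehomogenization F l) f z := by
  have hla : AnalyticAt ℂ (fun w => F w l) z := (differentiable_pi.1 hF.1 l).analyticAt z
  refine ⟨(hla.fun_inv hl).fun_smul (hF.1.analyticAt z), ?_⟩
  filter_upwards [hla.continuousAt.eventually_ne hl] with w hw
  exact ⟨smul_ne_zero (inv_ne_zero hw) (hF.ne_zero w),
    (mk_smul_eq (inv_ne_zero hw) (hF.ne_zero w)).trans (hF.2 w).2⟩

theorem dehomogenization_apply (F : ℂ → Fin (n + 1) → ℂ) (Q : MvPolynomial (Fin (n + 1)) ℂ)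
    (d : ℕ) (l s : Fin (n + 1)) :
    (fun w => dehomogenization F l w s) = quotientAlong F Q d (some s) l :=
  funext fun w => (div_eq_inv_mul (F w s) (F w l)).symm

theorem eval_dehomogenization (hQ : Q.IsHomogeneous d) (F : ℂ → Fin (n + 1) → ℂ)
    (l : Fin (n + 1)) :
    (fun w => MvPolynomial.eval (dehomogenization F l w) Q) = quotientAlong F Q d none l :=
  funext fun w => by
    rw [dehomogenization, eval_smul_of_isHomogeneous hQ, inv_pow]
    exact (div_eq_inv_mul _ _).symm

theorem norm_dehomogenization (h0 : F z ≠ 0) (hl : ‖F z l‖ = ‖F z‖) :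
    ‖dehomogenization F l z‖ = 1 := by
  rw [dehomogenization, norm_smul, norm_inv, hl, inv_mul_cancel₀ (norm_ne_zero_iff.2 h0)]

theorem exists_norm_iteratedDeriv_quotientAlong_le (hF : Differentiable ℂ F)
    (Q : MvPolynomial (Fin (n + 1)) ℂ) (d k : ℕ) :
    ∃ C : ℝ, 1 ≤ C ∧ ∀ z l, IsNonvanishingPoint F Q z → F z l ≠ 0 → ‖F z l‖ = ‖F z‖ →
      ∀ s i, 1 ≤ i → i ≤ k → ‖iteratedDeriv i (quotientAlong F Q d (some s) l) z‖ ≤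
          C * (∏ a ∈ quotientIndices F k, (1 + quotientSize F Q d a z)) ^ k := by
  obtain ⟨C, hC, hbound⟩ := exists_bound_iteratedDeriv_of_logDeriv k
  refine ⟨C, hC, fun z l hz hl0 hl s i hi1 hik => ?_⟩
  have hprod : 1 ≤ ∏ a ∈ quotientIndices F k, (1 + quotientSize F Q d a z) :=
    Finset.one_le_prod fun a _ => le_add_of_nonneg_right (quotientSize_nonneg F Q d a z)
  by_cases hs : ∃ w, F w s ≠ 0
  · refine hbound (quotientAlong F Q d (some s) l) z _ ?_
      (div_ne_zero (hz.apply_ne_zero s hs) hl0) ?_ hprod (fun j hj => ?_) i hik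
    · exact ((differentiable_pi.1 hF s).analyticAt z).fun_div
        ((differentiable_pi.1 hF l).analyticAt z) hl0
    · rw [quotientAlong, norm_div, hl]
      exact div_le_one_of_le₀ (norm_le_pi_norm _ _) (norm_nonneg _)
    · refine le_prod_one_add (fun a _ => quotientSize_nonneg F Q d a z)
        (a := (some s, l, ⟨j, hj⟩)) (mem_quotientIndices.2 ⟨⟨z, hl0⟩, fun s' hs' => ?_⟩)
      rwa [← Option.some_inj.1 hs']
  · push Not at hs
    have hzero : quotientAlong F Q d (some s) l = fun _ => 0 := funext fun w =>
      div_eq_zero_iff.2 (Or.inl (hs w))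
    rw [hzero, iteratedDeriv_const, if_neg (Nat.one_le_iff_ne_zero.1 hi1), norm_zero]
    positivity

theorem IsReducedRepresentation.exists_isJetBound_dehomogenization (hQ : Q.IsHomogeneous d)
    (hF : IsReducedRepresentation F f) (k : ℕ) :
    ∃ C : ℝ, 1 ≤ C ∧ ∀ z l, IsNonvanishingPoint F Q z → ‖F z l‖ = ‖F z‖ →
      IsJetBound Q k f (dehomogenization F l) z
        (C * (∏ a ∈ quotientIndices F k, (1 + quotientSize F Q d a z)) ^ k) := by
  obtain ⟨C, hC, hbound⟩ := exists_norm_iteratedDeriv_quotientAlong_le hF.1 Q d k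
  refine ⟨C, hC, fun z l hz hl => ?_⟩
  set D := ∏ a ∈ quotientIndices F k, (1 + quotientSize F Q d a z)
  have hD1 : 1 ≤ D :=
    Finset.one_le_prod fun a _ => le_add_of_nonneg_right (quotientSize_nonneg F Q d a z)
  have hl0 : F z l ≠ 0 := norm_ne_zero_iff.1 (hl ▸ norm_ne_zero_iff.2 (hF.ne_zero z))
  have hrep : RepresentsAt (dehomogenization F l) f z := hF.representsAt_dehomogenization hl0
  refine ⟨hrep, ?_, one_le_mul_of_one_le_of_one_le hC (one_le_pow₀ hD1), fun i hi1 hik => ?_,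
    fun j hj => ?_⟩
  · rw [dehomogenization, eval_smul_of_isHomogeneous hQ]
    exact mul_ne_zero (pow_ne_zero _ (inv_ne_zero hl0)) hz.eval_ne_zero
  · refine (pi_norm_le_iff_of_nonneg (by positivity)).2 fun s => ?_
    rw [iteratedDeriv_apply hrep.1.contDiffAt, dehomogenization_apply F Q d]
    exact hbound z l hz hl0 hl s i hi1 hik
  · rw [eval_dehomogenization hQ]
    calc quotientSize F Q d (none, l, (⟨j, hj⟩ : Fin k)) z
        ≤ D := le_prod_one_add (fun a _ => quotientSize_nonneg F Q d a z)
          (mem_quotientIndices.2 ⟨⟨z, hl0⟩, fun s hs => absurd hs (Option.not_mem_none s)⟩)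
      _ ≤ D ^ k := le_self_pow₀ hD1 (by lia)
      _ ≤ C * D ^ k := le_mul_of_one_le_left (by positivity) hC

theorem LogJetDifferential.norm_toFun_mul_norm_pow (P : LogJetDifferential Q k m μ)
    (hQ : Q.IsHomogeneous d) (hf : IsEntireCurve f) (hF : IsReducedRepresentation F f)
    (hz : MvPolynomial.eval (F z) Q ≠ 0) (hl : ‖F z l‖ = ‖F z‖) :
    ‖P.toFun (curveJet k f hf z) (F z)‖ * ‖F z‖ ^ μ =
      ‖P.toFun (curveJet k f hf z) (dehomogenization F l z)‖ := by
  have hnorm : ‖F z‖ ≠ 0 := norm_ne_zero_iff.2 (hF.ne_zero z)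
  have hl0 : F z l ≠ 0 := norm_ne_zero_iff.1 (hl ▸ hnorm)
  rw [dehomogenization, P.toFun_smul hf (hF.ne_zero z) (hF.2 z).2
    (fun h => hz ((hF.mem_hypersurface_iff hQ).1 h)) (inv_ne_zero hl0), norm_mul, norm_inv,
    norm_pow, norm_inv, hl, inv_pow, inv_inv, mul_comm]

theorem LogJetDifferential.exists_norm_mul_le (P : LogJetDifferential Q k m μ)
    (hQ : IsSmoothEquation Q d) (hf : IsEntireCurve f) (hF : IsReducedRepresentation F f) :
    ∃ C : ℝ, 0 < C ∧ ∀ z, IsNonvanishingPoint F Q z →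
      ‖P.toFun (curveJet k f hf z) (F z)‖ * ‖F z‖ ^ μ ≤
        C * (∏ a ∈ quotientIndices F k, (1 + quotientSize F Q d a z)) ^ (k * k * m) := by
  obtain ⟨C, hC, hbound⟩ := P.exists_bound hQ (isCompact_sphere (0 : Fin (n + 1) → ℂ) 1)
    (by simp)
  obtain ⟨C₁, hC₁, hjet⟩ := hF.exists_isJetBound_dehomogenization hQ.homogeneous k
  refine ⟨(C + 1) * (C₁ ^ k) ^ m, by positivity, fun z hz => ?_⟩
  -- Normalizing by a coordinate of maximal modulus puts the representation on the unit sphere.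
  obtain ⟨l, hl⟩ := exists_norm_apply_eq_norm (F z)
  set D := ∏ a ∈ quotientIndices F k, (1 + quotientSize F Q d a z)
  have hD : 0 ≤ D := Finset.prod_nonneg fun a _ =>
    add_nonneg zero_le_one (quotientSize_nonneg F Q d a z)
  calc ‖P.toFun (curveJet k f hf z) (F z)‖ * ‖F z‖ ^ μ
      = ‖P.toFun (curveJet k f hf z) (dehomogenization F l z)‖ :=
        P.norm_toFun_mul_norm_pow hQ.homogeneous hf hF hz.eval_ne_zero hl
    _ ≤ C * ((C₁ * D ^ k) ^ k) ^ m := hbound f hf _ z _ (hjet z l hz hl)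
        (mem_sphere_zero_iff_norm.2 (norm_dehomogenization (hF.ne_zero z) hl))
    _ = C * (C₁ ^ k) ^ m * D ^ (k * k * m) := by
        rw [mul_pow, mul_pow, ← pow_mul D, ← pow_mul D, ← mul_assoc]
    _ ≤ (C + 1) * (C₁ ^ k) ^ m * D ^ (k * k * m) := by
        gcongr
        linarith

end GlobalBound

/-! ### The main estimate -/

theorem circleAverage_log_norm_add_le {ι E : Type*} [NormedAddCommGroup E] {u : ℂ → ℂ}
    {F : ℂ → E} (hu : Meromorphic u) (hF : Continuous F) (hF0 : ∀ z, F z ≠ 0) {μ N : ℕ} {C r : ℝ}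
    (hC : 0 < C) (hr : 0 ≤ r) {J : Finset ι} {g : ι → ℂ → ℝ} (hg : ∀ a ∈ J, ∀ z, 0 ≤ g a z)
    (hgi : ∀ a ∈ J, CircleIntegrable (fun z => Real.log (1 + g a z)) 0 r)
    (hu0 : ∀ z ∈ sphere 0 r, u z ≠ 0)
    (hle : ∀ z ∈ sphere 0 r, ‖u z‖ * ‖F z‖ ^ μ ≤ C * (∏ a ∈ J, (1 + g a z)) ^ N) :
    Real.circleAverage (fun z => Real.log ‖u z‖) 0 r +
        μ * Real.circleAverage (fun z => Real.log ‖F z‖) 0 r ≤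
      Real.log C + N * ∑ a ∈ J, Real.circleAverage (fun z => Real.log (1 + g a z)) 0 r := by
  have hui : CircleIntegrable (fun z => Real.log ‖u z‖) 0 r :=
    hu.meromorphicOn.circleIntegrable_log_norm
  have hFi : CircleIntegrable (fun z => (μ : ℝ) • Real.log ‖F z‖) 0 r :=
    (circleIntegrable_log_norm hF hF0 r).const_fun_smul
  have hNi : CircleIntegrable (fun z => (N : ℝ) • ∑ a ∈ J, Real.log (1 + g a z)) 0 r :=
    (CircleIntegrable.fun_sum J hgi).const_fun_smul
  have havg : Real.circleAverage (fun z => Real.log ‖u z‖ + (μ : ℝ) • Real.log ‖F z‖) 0 r ≤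
      Real.circleAverage (fun z => Real.log C + (N : ℝ) • ∑ a ∈ J, Real.log (1 + g a z)) 0 r := by
    refine Real.circleAverage_mono (hui.add hFi) ((circleIntegrable_const _ _ _).add hNi)
      fun z hz => ?_
    rw [abs_of_nonneg hr] at hz
    have hpos : ∀ a ∈ J, 0 < 1 + g a z := fun a ha => by linarith [hg a ha z]
    have huz : 0 < ‖u z‖ := norm_pos_iff.2 (hu0 z hz)
    have hFz : 0 < ‖F z‖ := norm_pos_iff.2 (hF0 z)
    have hlog := Real.log_le_log (by positivity) (hle z hz)
    rwa [Real.log_mul huz.ne' (by positivity), Real.log_pow,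
      Real.log_mul hC.ne' (pow_ne_zero _ (Finset.prod_pos hpos).ne'), Real.log_pow,
      Real.log_prod fun a ha => (hpos a ha).ne'] at hlog
  rwa [Real.circleAverage_fun_add hui hFi, Real.circleAverage_fun_smul,
    Real.circleAverage_fun_add (circleIntegrable_const _ _ _) hNi, Real.circleAverage_const,
    Real.circleAverage_fun_smul, Real.circleAverage_fun_sum hgi] at havg

theorem norm_mvPolynomial_eval_le {𝕜 σ : Type*} [NormedField 𝕜] [Fintype σ]
    {Q : MvPolynomial σ 𝕜} {d : ℕ} (hQ : Q.IsHomogeneous d) (v : σ → 𝕜) :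
    ‖MvPolynomial.eval v Q‖ ≤ (∑ α ∈ Q.support, ‖Q.coeff α‖) * ‖v‖ ^ d := by
  rw [MvPolynomial.eval_eq', Finset.sum_mul]
  refine norm_sum_le_of_le _ fun α hα => ?_
  have hdegree : ∑ i, α i = d := by
    have hweight := hQ (MvPolynomial.mem_support_iff.1 hα)
    simp only [Finsupp.weight_apply, Pi.one_apply, smul_eq_mul, mul_one] at hweight
    rwa [← Finsupp.sum_fintype α (fun _ c => c) fun _ => rfl]
  rw [norm_mul, norm_prod, ← hdegree, ← Finset.prod_pow_eq_pow_sum]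
  gcongr with i
  rw [norm_pow]
  gcongr
  exact norm_le_pi_norm v i

section QuotientSize

variable {n d k : ℕ} {F : ℂ → Fin (n + 1) → ℂ} {Q : MvPolynomial (Fin (n + 1)) ℂ}
  {a : Option (Fin (n + 1)) × Fin (n + 1) × Fin k}

theorem dominatedBy_apply_pow (hF : Differentiable ℂ F) {l : Fin (n + 1)} (hl : ∃ z, F z l ≠ 0)
    (d : ℕ) : DominatedBy F d fun z => F z l ^ d where
  differentiable := (differentiable_pi.1 hF l).fun_pow d
  exists_ne_zero := hl.imp fun _ => pow_ne_zero d
  exists_le := ⟨1, one_pos, fun z => by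
    rw [norm_pow, one_mul]
    gcongr
    exact norm_le_pi_norm _ _⟩

theorem dominatedBy_apply (hF : Differentiable ℂ F) {l : Fin (n + 1)} (hl : ∃ z, F z l ≠ 0) :
    DominatedBy F 1 fun z => F z l := by
  simpa only [pow_one] using dominatedBy_apply_pow hF hl 1

theorem dominatedBy_eval (hF : Differentiable ℂ F) (hQ : Q.IsHomogeneous d)
    (hQF : ∃ z, MvPolynomial.eval (F z) Q ≠ 0) :
    DominatedBy F d fun z => MvPolynomial.eval (F z) Q where
  differentiable := differentiable_eval_comp hF Q
  exists_ne_zero := hQF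
  exists_le := ⟨1 + ∑ α ∈ Q.support, ‖Q.coeff α‖, by positivity, fun z =>
    (norm_mvPolynomial_eval_le hQ (F z)).trans (by gcongr; linarith)⟩

theorem isSmallErrorTerm_quotientSize (hF : Differentiable ℂ F) (hF0 : ∀ z, F z ≠ 0)
    (hQ : Q.IsHomogeneous d) (hQF : ∃ z, MvPolynomial.eval (F z) Q ≠ 0)
    (ha : a ∈ quotientIndices F k) :
    IsSmallErrorTerm (fun r => max (orderFunction F r) 1) fun r =>
      Real.circleAverage (fun z => Real.log (1 + quotientSize F Q d a z)) 0 r := by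
  obtain ⟨o, l, j⟩ := a
  obtain ⟨hl, ho⟩ := mem_quotientIndices.1 ha
  cases o with
  | none =>
    exact (dominatedBy_eval hF hQ hQF).isSmallErrorTerm hF hF0 (dominatedBy_apply_pow hF hl d) j
  | some s =>
    exact (dominatedBy_apply hF (ho s rfl)).isSmallErrorTerm hF hF0 (dominatedBy_apply hF hl) j

theorem regularOn_quotientAlong (hF : Differentiable ℂ F) {s : Set ℂ}
    (hs : ∀ z ∈ s, IsNonvanishingPoint F Q z) (ha : a ∈ quotientIndices F k) :
    RegularOn (quotientAlong F Q d a.1 a.2.1) s := by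
  obtain ⟨o, l, j⟩ := a
  obtain ⟨hl, ho⟩ := mem_quotientIndices.1 ha
  have hcoord : ∀ i, (∃ w, F w i ≠ 0) → RegularOn (fun w => F w i) s := fun i hi z hz =>
    ⟨(differentiable_pi.1 hF i).analyticAt z, (hs z hz).apply_ne_zero i hi⟩
  cases o with
  | none =>
    have heval : RegularOn (fun z => MvPolynomial.eval (F z) Q) s := fun z hz =>
      ⟨(differentiable_eval_comp hF Q).analyticAt z, (hs z hz).eval_ne_zero⟩
    have hpow : RegularOn (fun z => F z l ^ d) s := fun z hz =>
      ⟨(hcoord l hl z hz).1.fun_pow d, pow_ne_zero d (hcoord l hl z hz).2⟩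
    exact heval.fun_div hpow
  | some i => exact (hcoord i (ho i rfl)).fun_div (hcoord l hl)

theorem circleIntegrable_log_quotientSize (hF : Differentiable ℂ F) {r : ℝ} (hr : 0 ≤ r)
    (hs : ∀ z ∈ sphere 0 r, IsNonvanishingPoint F Q z) (ha : a ∈ quotientIndices F k) :
    CircleIntegrable (fun z => Real.log (1 + quotientSize F Q d a z)) 0 r := by
  refine ContinuousOn.circleIntegrable hr (ContinuousOn.log ?_ fun z _ =>
    (add_pos_of_pos_of_nonneg one_pos (quotientSize_nonneg F Q d a z)).ne')
  exact continuousOn_const.add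
    ((regularOn_quotientAlong hF hs ha).continuousOn_iteratedDeriv_logDeriv _).norm

end QuotientSize

section MainEstimate

variable {n d k m μ : ℕ} {Q : MvPolynomial (Fin (n + 1)) ℂ} {F : ℂ → Fin (n + 1) → ℂ}
  {f : ℂ → Pn n}

theorem eventually_isNonvanishingPoint (hF : Differentiable ℂ F)
    (hQF : ∃ z, MvPolynomial.eval (F z) Q ≠ 0) (z : ℂ) :
    ∀ᶠ w in 𝓝[≠] z, IsNonvanishingPoint F Q w := by
  have hcoord : ∀ᶠ w in 𝓝[≠] z, ∀ i, (∃ w, F w i ≠ 0) → F w i ≠ 0 := eventually_all.2 fun i =>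
    eventually_imp_distrib_left.2 fun hi =>
      eventually_nhdsNE_ne_zero (differentiable_pi.1 hF i) hi z
  filter_upwards [eventually_nhdsNE_ne_zero (differentiable_eval_comp hF Q) hQF z, hcoord]
    with w hQw hw using ⟨hQw, hw⟩

theorem LogJetDifferential.eventually_toFun_curveJet_ne_zero (P : LogJetDifferential Q k m μ)
    (hQ : Q.IsHomogeneous d) (hf : IsEntireCurve f) (hF : IsReducedRepresentation F f) {z₀ : ℂ}
    (hQz₀ : MvPolynomial.eval (F z₀) Q ≠ 0) (hPz₀ : P.toFun (curveJet k f hf z₀) (F z₀) ≠ 0)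
    (z : ℂ) : ∀ᶠ w in 𝓝[≠] z, P.toFun (curveJet k f hf w) (F w) ≠ 0 := by
  have hu : Meromorphic fun z => P.toFun (curveJet k f hf z) (F z) := fun a =>
    (P.poleOrderLE_curveJet hQ hf hF ⟨z₀, hQz₀⟩ a).1
  refine (meromorphicOrderAt_ne_top_iff_eventually_ne_zero (hu z)).1 ?_
  refine hu.meromorphicOn.meromorphicOrderAt_ne_top_of_isPreconnected isPreconnected_univ
    (Set.mem_univ z₀) (Set.mem_univ z) ?_
  rw [(P.analyticAt_curveJet hQ hf hF
    hQz₀).meromorphicNFAt.meromorphicOrderAt_eq_zero_iff.2 hPz₀]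
  exact WithTop.zero_ne_top

theorem LogJetDifferential.exists_mul_orderFunction_sub_le (P : LogJetDifferential Q k m μ)
    (hQ : IsSmoothEquation Q d) (hf : IsEntireCurve f) (hF : IsReducedRepresentation F f) {z₀ : ℂ}
    (hQz₀ : MvPolynomial.eval (F z₀) Q ≠ 0) (hPz₀ : P.toFun (curveJet k f hf z₀) (F z₀) ≠ 0) :
    ∃ (c : ℝ) (E : Set ℝ), E.Countable ∧ ∀ r, 1 ≤ r → r ∉ E →
      μ * orderFunction F r - m * countingFunction 1 F Q r ≤
        c + (k * k * m : ℕ) * ∑ a ∈ quotientIndices F k,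
          Real.circleAverage (fun z => Real.log (1 + quotientSize F Q d a z)) 0 r := by
  obtain ⟨C, hC, hbound⟩ := P.exists_norm_mul_le hQ hf hF
  have hQF : ∃ z, MvPolynomial.eval (F z) Q ≠ 0 := ⟨z₀, hQz₀⟩
  set u : ℂ → ℂ := fun z => P.toFun (curveJet k f hf z) (F z)
  have hu : Meromorphic u := fun a => (P.poleOrderLE_curveJet hQ.homogeneous hf hF hQF a).1
  refine ⟨Real.log C - Real.circleAverage (fun z => Real.log ‖u z‖) 0 1,
    norm '' {z | ¬(u z ≠ 0 ∧ IsNonvanishingPoint F Q z)},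
    countable_norm_image_setOf_not fun z =>
      (P.eventually_toFun_curveJet_ne_zero hQ.homogeneous hf hF hQz₀ hPz₀ z).and
        (eventually_isNonvanishingPoint hF.1 hQF z), fun r hr hrE => ?_⟩
  have hregular : ∀ z ∈ sphere 0 r, u z ≠ 0 ∧ IsNonvanishingPoint F Q z := fun z hz =>
    not_not.1 fun h => hrE ⟨z, h, mem_sphere_zero_iff_norm.1 hz⟩
  have hr0 : 0 ≤ r := zero_le_one.trans hr
  have hupper := circleAverage_log_norm_add_le hu hF.1.continuous hF.ne_zero hC hr0
    (fun a _ z => quotientSize_nonneg F Q d a z)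
    (fun a ha => circleIntegrable_log_quotientSize hF.1 hr0 (fun z hz => (hregular z hz).2) ha)
    (fun z hz => (hregular z hz).1) fun z hz => hbound z (hregular z hz).2
  have hlower := P.circleAverage_log_norm_one_sub_le hQ.homogeneous hf hF hQF hr
  rw [orderFunction_eq_circleAverage]
  linarith

end MainEstimate

theorem mainTheorem2 (n d k m μ : ℕ) (hμ : 0 < μ)
    (Q : MvPolynomial (Fin (n + 1)) ℂ) (hQ : IsSmoothEquation Q d)
    (f : ℂ → Pn n) (hf : IsEntireCurve f)
    (F : ℂ → Fin (n + 1) → ℂ) (hF : IsReducedRepresentation F f)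
    (P : LogJetDifferential Q k m μ)
    (hP : ∃ z : ℂ, f z ∉ hypersurface Q ∧ P.toFun (curveJet k f hf z) (F z) ≠ 0) :
    ∃ S : ℝ → ℝ, IsSmallErrorTerm (orderFunction F) S ∧
      ∀ r : ℝ, 1 < r →
        orderFunction F r ≤ (m : ℝ) / (μ : ℝ) * countingFunction 1 F Q r + S r := by
  obtain ⟨z₀, hz₀D, hPz₀⟩ := hP
  have hQz₀ : MvPolynomial.eval (F z₀) Q ≠ 0 :=
    fun h => hz₀D ((hF.mem_hypersurface_iff hQ.homogeneous).2 h)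
  obtain ⟨c, E, hE, hmain⟩ := P.exists_mul_orderFunction_sub_le hQ hf hF hQz₀ hPz₀
  have hT : MonotoneOn (orderFunction F) (Set.Ici 0) := fun r hr s _ hrs =>
    orderFunction_le_of_le hF.1 hF.ne_zero hr hrs
  have hsmall := ((isSmallErrorTerm_const _ c).add ((IsSmallErrorTerm.sum (quotientIndices F k)
    fun a ha => isSmallErrorTerm_quotientSize hF.1 hF.ne_zero hQ.homogeneous ⟨z₀, hQz₀⟩
      ha).const_mul (Nat.cast_nonneg (k * k * m)))).const_mul (inv_nonneg.2 (Nat.cast_nonneg μ))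
  refine ⟨fun r => orderFunction F r - m / μ * countingFunction 1 F Q r,
    .of_max_one hT (hsmall.mono (r₀ := 1) (E := E) ?_ fun r hr hrE => ?_),
    fun r _ => (add_sub_cancel _ _).ge⟩
  · rw [hE.measure_zero]
    exact ENNReal.zero_lt_top
  · calc orderFunction F r - m / μ * countingFunction 1 F Q r
        = (μ : ℝ)⁻¹ * (μ * orderFunction F r - m * countingFunction 1 F Q r) := by field_simp
      _ ≤ _ := mul_le_mul_of_nonneg_left (hmain r hr hrE) (inv_nonneg.2 (Nat.cast_nonneg μ))
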